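/- Throughout, $\mathbb{R}^2\subset\mathbb{RP}^2$ via $(x,y)\mapsto[x:y:1]$. A set $X\subseteq\mathbb{RP}^2$ is \emph{convex} if it is disjoint from some projective line and any two points of $X$ can be joined by a (projective) line segment contained in $X$. A \emph{projective convex hull} of $Y$ is an inclusion-wise minimal convex set containing $Y$. For a finite $P\subset\mathbb{RP}^2$ in general position and $k\ge 3$, a \emph{projective $k$-hole} in $P$ is a projective convex hull $G$ of some $k$-point set $I\subseteq P$ such that all points of $I$ lie on the boundary of $G$ and no point of $P$ lies in the interior of $G$. For finite sets $X,Y\subset\mathbb{R}^2$ of points with distinct $x$-coordinates, $X$ lies \emph{deep below} $Y$ if every point of $X$ lies below every line through two points of $Y$ and every point of $Y$ lies above every line through two points of $X$. Let $H=\{p_1,\dots,p_n\}\subset\mathbb{R}^2$ have distinct $x$-coordinates and be sorted by increasing $x$-coordinate; let $H_0$ and $H_1$ be the sets of $p_i$ with $i$ odd and with $i$ even, respectively. The set $H$ is \emph{Horton} if $|H|\le1$, or if $|H|\ge2$, both $H_0$ and $H_1$ are Horton, and one of $H_0,H_1$ lies deep below the other; the former is then called $L(H)$, the lower part of $H$,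 and the latter $U(H)$. (If $|H|=2$, either choice is allowed.) The \emph{layers} of $H$ are $H$ and all sets obtained from $H$ by repeatedly passing to lower or upper parts. A Horton set is \emph{perfect} if, for each of its layers $X$ with $|X|\ge2$, the leftmost point of $X$ lies in $L(X)$. Horton sets are in general position. \textbf{Theorem.} (i) For every $k\in\{3,\dots,7\}$, a Horton set of size $n$ in $\mathbb{R}^2\subset\mathbb{RP}^2$ has $\Theta(n^2)$ projective $k$-holes; that is, there are constants $c,C>0$ and $N$, depending only on $k$, such that every Horton set of size $n$ has at most $Cn^2$ projective $k$-holes and, if $n\ge N$, at least $cn^2$ of them. (ii) If $H$ is a perfect Horton set of size $n=2^z$ with an integer $z\ge1$, then the number of projective $3$-holes in $H$ equals \[ 4.25\cdot2^{2z}+2^z\left(-\tfrac{3z^2}{2}-\tfrac z2-5.5\right)-4z+2 =4.25\,n^2-1.5\,n\log_2^2 n-\Theta(n\log_2 n). \] -/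

import Mathlib

noncomputable section

open scoped Classical

namespace ProjHoles

/-! ### The real projective plane -/

/-- The real projective plane: lines through the origin of `ℝ³`. -/
abbrev RP2 : Type := Projectivization ℝ (Fin 3 → ℝ)

/-- The quotient topology on the real projective plane. -/
instance : TopologicalSpace RP2 :=
  TopologicalSpace.coinduced (Projectivization.mk' ℝ (V := Fin 3 → ℝ)) inferInstance

/-- A projective line: the points contained in a fixed plane through the origin of `ℝ³`. -/
def IsProjLine (l : Set RP2) : Prop :=
  ∃ W : Submodule ℝ (Fin 3 → ℝ), Module.finrank ℝ W = 2 ∧ l = {p | p.submodule ≤ W}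

/-- The projective segment with end points `[v]` and `[w]` consisting of the points
`[a v + b w]` with `a, b ≥ 0`. For `[v] ≠ [w]`, the two segments joining `[v]` and `[w]`
are `projSegment v w` and `projSegment v (-w)`. -/
def projSegment (v w : Fin 3 → ℝ) : Set RP2 :=
  {p | ∃ a b : ℝ, 0 ≤ a ∧ 0 ≤ b ∧ ∃ h : a • v + b • w ≠ 0,
    p = Projectivization.mk ℝ (a • v + b • w) h}

/-- Any two points of `X` are joined by a line segment contained in `X`. -/
def IsSemiconvex (X : Set RP2) : Prop :=
  ∀ p ∈ X, ∀ q ∈ X, ∃ (v w : Fin 3 → ℝ) (hv : v ≠ 0) (hw : w ≠ 0),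
    Projectivization.mk ℝ v hv = p ∧ Projectivization.mk ℝ w hw = q ∧ projSegment v w ⊆ X

/-- `X` is semiconvex and contained in a plane, that is, in the complement of a projective
line. -/
def IsProjConvex (X : Set RP2) : Prop :=
  IsSemiconvex X ∧ ∃ l : Set RP2, IsProjLine l ∧ Disjoint X l

/-- `G` is a projective convex hull of `Y`: an inclusion-wise minimal convex set containing
`Y`. -/
def IsProjConvexHull (Y G : Set RP2) : Prop :=
  Minimal (fun X : Set RP2 => IsProjConvex X ∧ Y ⊆ X) G

/-- `G` is a projective `k`-gon determined by `P`. -/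
def IsProjGon (k : ℕ) (P G : Set RP2) : Prop :=
  ∃ I : Set RP2, I ⊆ P ∧ I.Finite ∧ I.ncard = k ∧ IsProjConvexHull I G ∧ I ⊆ frontier G

/-- The set of all projective `k`-holes in `P`. -/
def projHoles (k : ℕ) (P : Set RP2) : Set (Set RP2) :=
  {G | IsProjGon k P G ∧ Disjoint (interior G) P}

theorem vec_ne_zero (p : ℝ × ℝ) : (![p.1, p.2, 1] : Fin 3 → ℝ) ≠ 0 := fun h => by
  have := congrFun h 2
  simp at this

/-- The standard embedding `(x, y) ↦ [x : y : 1]` of the affine plane into the projective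
plane. -/
def embed (p : ℝ × ℝ) : RP2 :=
  Projectivization.mk ℝ ![p.1, p.2, 1] (vec_ne_zero p)

/-- The projective `k`-holes in a finite planar point set, viewed in the projective plane. -/
def planarProjHoles (k : ℕ) (H : Finset (ℝ × ℝ)) : Set (Set RP2) :=
  projHoles k (embed '' (H : Set (ℝ × ℝ)))

/-! ### Horton sets -/

/-- The height at abscissa `t` of the (non-vertical) line through `q` and `r`. -/
def lineAt (q r : ℝ × ℝ) (t : ℝ) : ℝ :=
  q.2 + (r.2 - q.2) / (r.1 - q.1) * (t - q.1)

/-- `X` lies deep below `Y` (and `Y` lies high above `X`). Only used for sets of points with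
distinct `x`-coordinates. -/
def DeepBelow (X Y : Finset (ℝ × ℝ)) : Prop :=
  (∀ p ∈ X, ∀ q ∈ Y, ∀ r ∈ Y, q ≠ r → p.2 < lineAt q r p.1) ∧
  (∀ p ∈ Y, ∀ q ∈ X, ∀ r ∈ X, q ≠ r → lineAt q r p.1 < p.2)

/-- The number of points of `H` to the left of `p`; so `p` is the point with index
`leftCount H p + 1` in the left-to-right order of `H`. -/
def leftCount (H : Finset (ℝ × ℝ)) (p : ℝ × ℝ) : ℕ :=
  (H.filter fun q => q.1 < p.1).card

/-- The points of `H` with odd index (first, third, ...) in the left-to-right order. -/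
def oddPart (H : Finset (ℝ × ℝ)) : Finset (ℝ × ℝ) :=
  H.filter fun p => Odd (leftCount H p + 1)

/-- The points of `H` with even index (second, fourth, ...) in the left-to-right order. -/
def evenPart (H : Finset (ℝ × ℝ)) : Finset (ℝ × ℝ) :=
  H.filter fun p => Even (leftCount H p + 1)

/-- Horton sets. -/
inductive IsHorton : Finset (ℝ × ℝ) → Prop
  | small (H : Finset (ℝ × ℝ)) (h : H.card ≤ 1) : IsHorton H
  | step (H : Finset (ℝ × ℝ)) (h : 2 ≤ H.card)
      (hx : Set.InjOn Prod.fst (H : Set (ℝ × ℝ)))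
      (h₀ : IsHorton (oddPart H)) (h₁ : IsHorton (evenPart H))
      (hd : DeepBelow (oddPart H) (evenPart H) ∨ DeepBelow (evenPart H) (oddPart H)) :
      IsHorton H

/-- `IsLayer H X`: the set `X` is a layer of `H`, that is, `H` itself or obtained from it by
repeatedly passing to one of the two parts of a set with at least two points. -/
inductive IsLayer (H : Finset (ℝ × ℝ)) : Finset (ℝ × ℝ) → Prop
  | self : IsLayer H H
  | odd (X : Finset (ℝ × ℝ)) (hX : IsLayer H X) (h : 2 ≤ X.card) : IsLayer H (oddPart X)
  | even (X : Finset (ℝ × ℝ)) (hX : IsLayer H X) (h : 2 ≤ X.card) : IsLayer H (evenPart X)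

/-- `L` and `U` are the lower and the upper part of `X`. (If `X` has exactly two points, either
of them may be called the lower part.) -/
def IsLowerUpper (X L U : Finset (ℝ × ℝ)) : Prop :=
  ((L = oddPart X ∧ U = evenPart X) ∨ (L = evenPart X ∧ U = oddPart X)) ∧ DeepBelow L U

/-- A perfect Horton set: a Horton set such that the leftmost point of each layer with at least
two points lies in the lower part of this layer. -/
def IsPerfectHorton (H : Finset (ℝ × ℝ)) : Prop :=
  IsHorton H ∧ ∀ X, IsLayer H X → 2 ≤ X.card →
    ∃ L U, IsLowerUpper X L U ∧ ∃ p ∈ L, ∀ q ∈ X, p.1 ≤ q.1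

end ProjHoles

end

namespace ProjHoles

/-! ### Cones and projective convex hulls -/

/-! A projective convex hull of a finite planar set `I` is the image of a cone: a line missing the
hull is the kernel of a functional `f`, the signs of `f` on the lifted points `vec p` give a signing
of `I`, and the hull consists of the classes of nonnegative combinations of the signed lifts
(`exists_hull_eq`, `isProjConvexHull_hull`). A point lies in the open signed triangle exactly when
three signed orientation determinants have one common strict sign. So every hole comes from a signed
set all of whose triangles satisfy `EmptyTri` (`exists_of_mem_planarProjHoles`), and 3-holes are in
bijection with empty signed triangles taken up to a global sign (`ncard_planarProjHoles_three`).

In a Horton set split into `L` and `U`, depth fixes most of these determinants. For `a`, `b` in one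
part and `c` in the other, equal signs at `a`, `b` make emptiness a condition on the pair alone: no
point of its part between them above (or below) the line. Opposite signs force `c` to be the
leftmost or rightmost point of its part, together with a condition on the points outside the strip
spanned by `a` and `b`. A triple inside one part is affected by the other part only in the signing
that negates the middle point, which is then never empty (`emptyTri_inner`).

Upper bound: the points of `L` of one sign in a hole that meets `U` form a set with no point of `L`
above, or none below, any of its segments. There are only linearly many such sets, since one that
contains a point of the wrong part is confined to that point and its two neighbours
(`IsHorton.card_cliques_le`). Both signs occur in `L` only if the hole uses just extreme points of
`U`. Hence there are quadratically many holes meeting both parts, and summing over the layers keeps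
the bound quadratic.

Lower bound: inside the lower part `L' ∪ U'`, take three consecutive points of `L'` forming a cap,
further right three consecutive points of `U'` forming a cup, and the rightmost point of `U`. With
the cap negated these seven points span a 7-hole, and every nonempty subset of them spans a hole as
well (`SevenConfig.hull_mem`). The cap and the cup can be placed in quadratically many ways.

Exact count: for a perfect set with `2m` points, `m = 2 ^ z`, the even and odd positions form the
lower and the upper part, and counting by parity gives `triTotal_two_mul`: the total is the sum of
the totals of both parts, minus their middle-negated empty triangles, plus the mixed triangles. The
pair counts for the mixed terms have closed forms by the same halving (`Perfect.innerCount_eq`,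
`Perfect.outerCount_add`), and `midTotal_two_mul` supplies the subtracted term. The mixed terms
contribute `8.5 m ^ 2` to leading order, whence the coefficient 4.25; terms of order `m z` add up
over the levels to the summand with the squared logarithm. -/

/-- The set of projective points represented by nonzero vectors of the convex cone spanned
by `W`. -/
def coneProj (W : Set (Fin 3 → ℝ)) : Set RP2 :=
  {p | ∃ x, ∃ hx : x ≠ 0, x ∈ Submodule.span NNReal W ∧ p = Projectivization.mk ℝ x hx}

theorem span_nonneg {W : Set (Fin 3 → ℝ)} {g : (Fin 3 → ℝ) →ₗ[ℝ] ℝ} (hg : ∀ w ∈ W, 0 ≤ g w)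
    {x : Fin 3 → ℝ} (hx : x ∈ Submodule.span NNReal W) : 0 ≤ g x := by
  induction hx using Submodule.span_induction with
  | mem x h => exact hg x h
  | zero => simp
  | add x y _ _ hx hy => rw [map_add]; exact add_nonneg hx hy
  | smul a x _ hx =>
    rw [NNReal.smul_def, map_smul, smul_eq_mul]
    exact mul_nonneg a.2 hx

theorem span_pos {W : Set (Fin 3 → ℝ)} {f : (Fin 3 → ℝ) →ₗ[ℝ] ℝ} (hf : ∀ w ∈ W, 0 < f w)
    {x : Fin 3 → ℝ} (hx : x ∈ Submodule.span NNReal W) : x = 0 ∨ 0 < f x := by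
  induction hx using Submodule.span_induction with
  | mem x h => exact Or.inr (hf x h)
  | zero => simp
  | add x y _ _ hx hy =>
    rcases hx with rfl | hx
    · simpa using hy
    rcases hy with rfl | hy
    · simpa using Or.inr hx
    right; rw [map_add]; exact add_pos hx hy
  | smul a x _ hx =>
    rcases hx with rfl | hx
    · simp
    rcases eq_or_ne a 0 with rfl | ha
    · simp
    right
    rw [NNReal.smul_def, map_smul, smul_eq_mul]
    exact mul_pos (NNReal.coe_pos.2 (pos_iff_ne_zero.2 ha)) hx

theorem mk_eq_mk_iff_smul {v w : Fin 3 → ℝ} (hv : v ≠ 0) (hw : w ≠ 0) :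
    Projectivization.mk ℝ v hv = Projectivization.mk ℝ w hw ↔ ∃ a : ℝ, a ≠ 0 ∧ a • w = v := by
  rw [Projectivization.mk_eq_mk_iff']
  constructor
  · rintro ⟨a, ha⟩
    refine ⟨a, ?_, ha⟩
    rintro rfl
    exact hv (by simpa using ha.symm)
  · rintro ⟨a, -, ha⟩
    exact ⟨a, ha⟩

theorem smul_mem_span {W : Set (Fin 3 → ℝ)} {x : Fin 3 → ℝ} {a : ℝ} (ha : 0 ≤ a)
    (hx : x ∈ Submodule.span NNReal W) : a • x ∈ Submodule.span NNReal W :=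
  Submodule.smul_mem _ (⟨a, ha⟩ : NNReal) hx

theorem mk_mem_coneProj {W : Set (Fin 3 → ℝ)} {x : Fin 3 → ℝ} (hx : x ≠ 0) :
    Projectivization.mk ℝ x hx ∈ coneProj W ↔
      x ∈ Submodule.span NNReal W ∨ -x ∈ Submodule.span NNReal W := by
  constructor
  · rintro ⟨y, hy, hyW, h⟩
    obtain ⟨a, ha, rfl⟩ := (mk_eq_mk_iff_smul hx hy).1 h
    rcases lt_or_gt_of_ne ha with h | h
    · right
      rw [← neg_smul]
      exact smul_mem_span (by linarith) hyW
    · left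
      exact smul_mem_span h.le hyW
  · rintro (h | h)
    · exact ⟨x, hx, h, rfl⟩
    · refine ⟨-x, neg_ne_zero.2 hx, h, (mk_eq_mk_iff_smul _ _).2 ⟨-1, by norm_num, by simp⟩⟩

theorem isProjLine_ker {f : (Fin 3 → ℝ) →ₗ[ℝ] ℝ} (hf : f ≠ 0) :
    IsProjLine {p | p.submodule ≤ LinearMap.ker f} := by
  refine ⟨LinearMap.ker f, ?_, rfl⟩
  have h1 := LinearMap.finrank_range_add_finrank_ker f
  rw [LinearMap.range_eq_top.2 (LinearMap.surjective hf)] at h1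
  simp at h1
  omega

theorem mk_submodule_le_ker {f : (Fin 3 → ℝ) →ₗ[ℝ] ℝ} {x : Fin 3 → ℝ} (hx : x ≠ 0) :
    (Projectivization.mk ℝ x hx).submodule ≤ LinearMap.ker f ↔ f x = 0 := by
  rw [Projectivization.submodule_mk, Submodule.span_singleton_le_iff_mem, LinearMap.mem_ker]

theorem isProjConvex_coneProj {W : Set (Fin 3 → ℝ)} {f : (Fin 3 → ℝ) →ₗ[ℝ] ℝ} (hf0 : f ≠ 0)
    (hf : ∀ w ∈ W, 0 < f w) : IsProjConvex (coneProj W) := by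
  refine ⟨?_, _, isProjLine_ker hf0, ?_⟩
  · rintro p ⟨x, hx, hxW, rfl⟩ q ⟨y, hy, hyW, rfl⟩
    refine ⟨x, y, hx, hy, rfl, rfl, ?_⟩
    rintro _ ⟨a, b, ha, hb, h, rfl⟩
    exact ⟨_, h, add_mem (smul_mem_span ha hxW) (smul_mem_span hb hyW), rfl⟩
  · rw [Set.disjoint_left]
    rintro p ⟨x, hx, hxW, rfl⟩ h
    have h0 := (mk_submodule_le_ker hx).1 h
    rcases span_pos hf hxW with h1 | h1
    · exact hx h1
    · exact h1.ne' h0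

/-- Minimality of the cone. By semiconvexity one of the two segments between two points of `X` lies
in `X`; since `X` misses the kernel of `f`, it must be the segment of sums of representatives on
which `f` is positive. -/
theorem coneProj_subset {W : Set (Fin 3 → ℝ)} {f : (Fin 3 → ℝ) →ₗ[ℝ] ℝ} {X : Set RP2}
    (hX : IsSemiconvex X) (hXf : ∀ x, ∀ hx : x ≠ 0, Projectivization.mk ℝ x hx ∈ X → f x ≠ 0)
    (hW : ∀ w ∈ W, 0 < f w ∧ ∀ hw : w ≠ 0, Projectivization.mk ℝ w hw ∈ X) :
    coneProj W ⊆ X := by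
  have key : ∀ x ∈ Submodule.span NNReal W,
      x = 0 ∨ (0 < f x ∧ ∀ hx : x ≠ 0, Projectivization.mk ℝ x hx ∈ X) := by
    intro x hx
    induction hx using Submodule.span_induction with
    | mem x h => exact Or.inr (hW x h)
    | zero => simp
    | smul a x _ hx =>
      rcases hx with rfl | ⟨hx, hxX⟩
      · simp
      rcases eq_or_ne a 0 with rfl | ha
      · simp
      have hx0 : x ≠ 0 := by rintro rfl; simp at hx
      have ha' : (0 : ℝ) < a := NNReal.coe_pos.2 (pos_iff_ne_zero.2 ha)
      right
      constructor
      · rw [NNReal.smul_def, map_smul, smul_eq_mul]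
        exact mul_pos ha' hx
      · intro h
        have : Projectivization.mk ℝ (a • x) h = Projectivization.mk ℝ x hx0 :=
          (mk_eq_mk_iff_smul _ _).2 ⟨a, ha'.ne', rfl⟩
        rw [this]; exact hxX hx0
    | add x y _ _ hx hy =>
      rcases hx with rfl | ⟨hx, hxX⟩
      · simpa using hy
      rcases hy with rfl | ⟨hy, hyX⟩
      · simpa using Or.inr ⟨hx, hxX⟩
      have hx0 : x ≠ 0 := by rintro rfl; simp at hx
      have hy0 : y ≠ 0 := by rintro rfl; simp at hy
      right
      refine ⟨by rw [map_add]; exact add_pos hx hy, fun hxy => ?_⟩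
      obtain ⟨v, w, hv, hw, hvx, hwy, hseg⟩ := hX _ (hxX hx0) _ (hyX hy0)
      obtain ⟨a, ha, rfl⟩ := (mk_eq_mk_iff_smul _ _).1 hvx
      obtain ⟨b, hb, rfl⟩ := (mk_eq_mk_iff_smul _ _).1 hwy
      -- Opposite signs of `a` and `b` describe the segment on the wrong side: it contains the class
      -- of `f y • x - f x • y`, where `f` vanishes, unless `x` and `y` are proportional.
      rcases lt_or_gt_of_ne (mul_ne_zero ha hb) with hab | hab
      · by_cases hz : f y • x - f x • y = 0
        · have hxy' : x = (f x / f y) • y := by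
            rw [sub_eq_zero] at hz
            rw [div_eq_inv_mul, mul_smul, ← hz, smul_smul, inv_mul_cancel₀ hy.ne', one_smul]
          have : Projectivization.mk ℝ (x + y) hxy = Projectivization.mk ℝ y hy0 :=
            (mk_eq_mk_iff_smul _ _).2 ⟨f x / f y + 1, by positivity, by
              rw [add_smul, ← hxy', one_smul]⟩
          rw [this]; exact hyX hy0
        · exfalso
          rcases lt_or_gt_of_ne ha with ha' | ha'
          · have hb' : 0 < b := by nlinarith
            have h0 : f x • y - f y • x ≠ 0 := by
              rw [← neg_ne_zero, neg_sub]; exact hz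
            refine hXf (f x • y - f y • x) h0 (hseg ⟨f y / (-a), f x / b, ?_, ?_, ?_⟩) ?_
            · exact div_nonneg hy.le (by linarith)
            · exact div_nonneg hx.le hb'.le
            · have e : (f y / -a) • a • x + (f x / b) • b • y = f x • y - f y • x := by
                rw [smul_smul, smul_smul, div_mul_cancel₀ _ hb'.ne', div_neg, neg_mul,
                  div_mul_cancel₀ _ ha, neg_smul]
                abel
              exact ⟨by rw [e]; exact h0, by simp only [e]⟩
            · simp [mul_comm]
          · have hb' : b < 0 := by nlinarith
            refine hXf (f y • x - f x • y) hz (hseg ⟨f y / a, f x / (-b), ?_, ?_, ?_⟩) ?_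
            · exact div_nonneg hy.le ha'.le
            · exact div_nonneg hx.le (by linarith)
            · have e : (f y / a) • a • x + (f x / -b) • b • y = f y • x - f x • y := by
                rw [smul_smul, smul_smul, div_mul_cancel₀ _ ha, div_neg, neg_mul,
                  div_mul_cancel₀ _ hb, neg_smul]
                abel
              exact ⟨by rw [e]; exact hz, by simp only [e]⟩
            · simp [mul_comm]
      · have e : |b| • a • x + |a| • b • y = (|b| * a) • (x + y) := by
          have : |a| * b = |b| * a := by
            rcases lt_or_gt_of_ne ha with ha' | ha'
            · have hb' : b < 0 := by nlinarith
              rw [abs_of_neg ha', abs_of_neg hb']; ring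
            · have hb' : 0 < b := by nlinarith
              rw [abs_of_pos ha', abs_of_pos hb']; ring
          rw [smul_smul, smul_smul, this, smul_add]
        have hne : |b| * a ≠ 0 := mul_ne_zero (abs_ne_zero.2 hb) ha
        refine hseg ⟨|b|, |a|, abs_nonneg _, abs_nonneg _, ?_, ?_⟩
        · rw [e]; exact smul_ne_zero hne hxy
        · refine (mk_eq_mk_iff_smul _ _).2 ⟨(|b| * a)⁻¹, inv_ne_zero hne, ?_⟩
          rw [e, smul_smul, inv_mul_cancel₀ hne, one_smul]
  rintro p ⟨x, hx, hxW, rfl⟩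
  rcases key x hxW with h | h
  · exact absurd h hx
  · exact h.2 hx

/-- The cone over a finite set in an open half-space gives a projective convex hull. -/
theorem isProjConvexHull_coneProj {W : Set (Fin 3 → ℝ)} {f : (Fin 3 → ℝ) →ₗ[ℝ] ℝ} (hf0 : f ≠ 0)
    (hf : ∀ w ∈ W, 0 < f w) {Y : Set RP2}
    (hY : ∀ p, p ∈ Y ↔ ∃ w ∈ W, ∃ hw : w ≠ 0, p = Projectivization.mk ℝ w hw) :
    IsProjConvexHull Y (coneProj W) := by
  refine ⟨⟨isProjConvex_coneProj hf0 hf, ?_⟩, ?_⟩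
  · intro p hp
    obtain ⟨w, hw, hw0, rfl⟩ := (hY p).1 hp
    exact ⟨w, hw0, Submodule.subset_span hw, rfl⟩
  · rintro X ⟨hX, hYX⟩ hXG
    refine coneProj_subset (f := f) hX.1 ?_ ?_
    · intro x hx hxX
      obtain ⟨y, hy, hyW, h⟩ := hXG hxX
      obtain ⟨a, ha, rfl⟩ := (mk_eq_mk_iff_smul hx hy).1 h
      have := (span_pos hf hyW).resolve_left hy
      rw [map_smul, smul_eq_mul]
      exact mul_ne_zero ha this.ne'
    · intro w hw
      exact ⟨hf w hw, fun hw0 => hYX ((hY _).2 ⟨w, hw, hw0, rfl⟩)⟩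

theorem exists_functional_of_isProjConvex {X : Set RP2} (hX : IsProjConvex X) :
    ∃ f : (Fin 3 → ℝ) →ₗ[ℝ] ℝ, f ≠ 0 ∧
      ∀ x, ∀ hx : x ≠ 0, Projectivization.mk ℝ x hx ∈ X → f x ≠ 0 := by
  obtain ⟨-, l, ⟨S, hS, rfl⟩, hd⟩ := hX
  have hlt : S < ⊤ := by
    rw [lt_top_iff_ne_top]; rintro rfl; simp at hS
  obtain ⟨f, hf, hSf⟩ := Submodule.exists_le_ker_of_lt_top S hlt
  refine ⟨f, hf, fun x hx hxX h0 => ?_⟩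
  have hker : S = LinearMap.ker f := by
    refine Submodule.eq_of_le_of_finrank_eq hSf ?_
    have h1 := LinearMap.finrank_range_add_finrank_ker f
    rw [LinearMap.range_eq_top.2 (LinearMap.surjective hf)] at h1
    simp at h1
    omega
  refine Set.disjoint_left.1 hd hxX ?_
  show Projectivization.submodule _ ≤ S
  rw [hker, mk_submodule_le_ker]; exact h0

/-- A point at which a nonzero linear functional that is nonnegative on the cone vanishes is not
in the interior. -/
theorem not_mem_interior_coneProj {W : Set (Fin 3 → ℝ)} {f g : (Fin 3 → ℝ) →ₗ[ℝ] ℝ}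
    (hf : ∀ w ∈ W, 0 < f w) (hg : ∀ w ∈ W, 0 ≤ g w) (hg0 : g ≠ 0) {x : Fin 3 → ℝ} (hx : x ≠ 0)
    (hfx : 0 < f x) (hgx : g x = 0) :
    Projectivization.mk ℝ x hx ∉ interior (coneProj W) := by
  intro hmem
  -- Moving from `x` slightly in direction `-u` makes `g` negative while `f` stays positive, so
  -- neither the new vector nor its negative lies in the cone.
  obtain ⟨u, hu⟩ : ∃ u, g u = 1 := LinearMap.surjective hg0 1
  have hopen : IsOpen ((Projectivization.mk' ℝ (V := Fin 3 → ℝ)) ⁻¹' interior (coneProj W)) :=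
    isOpen_coinduced.1 isOpen_interior
  obtain ⟨O, hO, hOe⟩ := isOpen_induced_iff.1 hopen
  have hxO : x ∈ O := by
    have : (⟨x, hx⟩ : {v : Fin 3 → ℝ // v ≠ 0}) ∈ Subtype.val ⁻¹' O := by
      rw [hOe]; exact hmem
    exact this
  have hc : Filter.Tendsto (fun t : ℝ => x - t • u) (nhdsWithin 0 (Set.Ioi 0)) (nhds x) := by
    have : Continuous (fun t : ℝ => x - t • u) := by fun_prop
    have h := this.tendsto 0
    simp only [zero_smul, sub_zero] at h
    exact h.mono_left nhdsWithin_le_nhds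
  have hfc : Filter.Tendsto (fun t : ℝ => f (x - t • u)) (nhdsWithin 0 (Set.Ioi 0))
      (nhds (f x)) := (LinearMap.continuous_of_finiteDimensional f).continuousAt.tendsto.comp hc
  obtain ⟨t, ⟨h1, h2⟩, h3⟩ := ((hc.eventually (hO.mem_nhds hxO)).and
    (hfc.eventually (lt_mem_nhds hfx)) |>.and self_mem_nhdsWithin).exists
  have h0 : x - t • u ≠ 0 := by intro h; rw [h] at h2; simp at h2
  have hm : (⟨_, h0⟩ : {v : Fin 3 → ℝ // v ≠ 0}) ∈
      (Projectivization.mk' ℝ (V := Fin 3 → ℝ)) ⁻¹' interior (coneProj W) := by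
    rw [← hOe]; exact h1
  have hm' : Projectivization.mk ℝ (x - t • u) h0 ∈ coneProj W := interior_subset hm
  rcases (mk_mem_coneProj h0).1 hm' with h | h
  · have := span_nonneg hg h
    rw [map_sub, map_smul, hgx, hu, smul_eq_mul] at this
    have h3' : 0 < t := h3
    linarith
  · have := span_nonneg (fun w hw => (hf w hw).le) h
    rw [map_neg] at this
    linarith

/-! ### Signed point sets and their hulls -/

/-- The standard representative of a planar point in homogeneous coordinates. -/
def vec (p : ℝ × ℝ) : Fin 3 → ℝ := ![p.1, p.2, 1]

/-- The orientation determinant of three planar points. -/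
def orient (a b c : ℝ × ℝ) : ℝ := (b.1 - a.1) * (c.2 - a.2) - (b.2 - a.2) * (c.1 - a.1)

/-- The linear functional vanishing on the line through `a` and `b`. -/
def lineForm (a b : ℝ × ℝ) : (Fin 3 → ℝ) →ₗ[ℝ] ℝ :=
  (a.2 - b.2) • LinearMap.proj 0 + (b.1 - a.1) • LinearMap.proj 1
    + (a.1 * b.2 - a.2 * b.1) • LinearMap.proj 2

theorem lineForm_apply (a b : ℝ × ℝ) (v : Fin 3 → ℝ) :
    lineForm a b v =
      (a.2 - b.2) * v 0 + (b.1 - a.1) * v 1 + (a.1 * b.2 - a.2 * b.1) * v 2 := by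
  simp [lineForm]

theorem lineForm_vec (a b p : ℝ × ℝ) : lineForm a b (vec p) = orient a b p := by
  rw [lineForm_apply]; simp [vec, orient]; ring

theorem orient_rotate (a b c : ℝ × ℝ) : orient b c a = orient a b c := by
  unfold orient; ring

theorem orient_swap (a b c : ℝ × ℝ) : orient b a c = -orient a b c := by
  unfold orient; ring

theorem orient_swap_right (a b c : ℝ × ℝ) : orient a c b = -orient a b c := by
  unfold orient; ring

theorem orient_self_left (a b : ℝ × ℝ) : orient a a b = 0 := by unfold orient; ring

theorem orient_self_right (a b : ℝ × ℝ) : orient a b b = 0 := by unfold orient; ring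

theorem orient_self_outer (a b : ℝ × ℝ) : orient a b a = 0 := by unfold orient; ring

theorem vec_ne (p : ℝ × ℝ) : vec p ≠ 0 := vec_ne_zero p

theorem embed_injective : Function.Injective embed := by
  intro p q h
  obtain ⟨a, -, ha⟩ := (mk_eq_mk_iff_smul _ _).1 h
  have h0 := congrFun ha 0
  have h1 := congrFun ha 1
  have h2 := congrFun ha 2
  simp at h0 h1 h2
  subst h2
  exact Prod.ext (by linarith) (by linarith)

/-- Cramer's rule. -/
theorem cramer (a b c : ℝ × ℝ) (v : Fin 3 → ℝ) :
    orient a b c • v = lineForm b c v • vec a + lineForm c a v • vec b + lineForm a b v • vec c := by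
  ext i
  fin_cases i <;> simp [lineForm_apply, vec, orient] <;> ring

/-- The points of `P` are in general position. -/
def GenPos (P : Finset (ℝ × ℝ)) : Prop :=
  ∀ a ∈ P, ∀ b ∈ P, ∀ c ∈ P, a ≠ b → a ≠ c → b ≠ c → orient a b c ≠ 0

/-- The projective triangle spanned by the points `a`, `b`, `c` with signs `x`, `y`, `z` has no
point of `P` in its interior. -/
def EmptyTri (P : Finset (ℝ × ℝ)) (a b c : ℝ × ℝ) (x y z : ℝ) : Prop :=
  ∀ p ∈ P, ¬(0 < x * orient p b c ∧ 0 < y * orient a p c ∧ 0 < z * orient a b p) ∧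
    ¬(x * orient p b c < 0 ∧ y * orient a p c < 0 ∧ z * orient a b p < 0)

/-- The projective hull of the points of `I` with signs `s`. -/
def hull (I : Finset (ℝ × ℝ)) (s : ℝ × ℝ → ℝ) : Set RP2 :=
  coneProj ((fun p => s p • vec p) '' I)

/-- A sign function. -/
def IsSign (s : ℝ × ℝ → ℝ) : Prop := ∀ p, s p = 1 ∨ s p = -1

theorem IsSign.mul_self {s : ℝ × ℝ → ℝ} (hs : IsSign s) (p : ℝ × ℝ) : s p * s p = 1 := by
  rcases hs p with h | h <;> rw [h] <;> norm_num

theorem IsSign.ne_zero {s : ℝ × ℝ → ℝ} (hs : IsSign s) (p : ℝ × ℝ) : s p ≠ 0 := by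
  rcases hs p with h | h <;> rw [h] <;> norm_num

theorem smul_vec_ne {s : ℝ × ℝ → ℝ} (hs : IsSign s) (p : ℝ × ℝ) : s p • vec p ≠ 0 :=
  smul_ne_zero (hs.ne_zero p) (vec_ne p)

theorem mk_smul_vec {s : ℝ × ℝ → ℝ} (hs : IsSign s) (p : ℝ × ℝ) :
    Projectivization.mk ℝ (s p • vec p) (smul_vec_ne hs p) = embed p :=
  (mk_eq_mk_iff_smul _ _).2 ⟨s p, hs.ne_zero p, rfl⟩

theorem mem_image_embed_iff {s : ℝ × ℝ → ℝ} (hs : IsSign s) (I : Finset (ℝ × ℝ)) (q : RP2) :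
    q ∈ embed '' (I : Set (ℝ × ℝ)) ↔ ∃ w ∈ (fun p => s p • vec p) '' (I : Set (ℝ × ℝ)),
      ∃ hw : w ≠ 0, q = Projectivization.mk ℝ w hw := by
  constructor
  · rintro ⟨p, hp, rfl⟩
    exact ⟨_, ⟨p, hp, rfl⟩, smul_vec_ne hs p, (mk_smul_vec hs p).symm⟩
  · rintro ⟨_, ⟨p, hp, rfl⟩, hw, rfl⟩
    exact ⟨p, hp, (mk_smul_vec hs p).symm⟩

theorem isProjConvexHull_hull {I : Finset (ℝ × ℝ)} {s : ℝ × ℝ → ℝ} (hs : IsSign s)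
    {f : (Fin 3 → ℝ) →ₗ[ℝ] ℝ} (hf0 : f ≠ 0) (hf : ∀ p ∈ I, 0 < s p * f (vec p)) :
    IsProjConvexHull (embed '' (I : Set (ℝ × ℝ))) (hull I s) := by
  refine isProjConvexHull_coneProj hf0 ?_ (mem_image_embed_iff hs I)
  rintro _ ⟨p, hp, rfl⟩
  rw [map_smul]
  exact hf p hp

/-- Every projective convex hull of a finite planar set is the hull of a signing of it. -/
theorem exists_hull_eq {I : Finset (ℝ × ℝ)} {G : Set RP2}
    (hG : IsProjConvexHull (embed '' (I : Set (ℝ × ℝ))) G) :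
    ∃ s, IsSign s ∧ G = hull I s := by
  obtain ⟨f, hf0, hf⟩ := exists_functional_of_isProjConvex hG.1.1
  -- The signing records the side of the missed line, so that `f` is positive on all signed lifts.
  let s : ℝ × ℝ → ℝ := fun p => if 0 < f (vec p) then 1 else -1
  have hs : IsSign s := fun p => by
    by_cases h : 0 < f (vec p) <;> simp [s, h]
  have hpos : ∀ p ∈ I, 0 < s p * f (vec p) := by
    intro p hp
    have h0 : f (vec p) ≠ 0 := hf _ (vec_ne p) (hG.1.2 ⟨p, hp, rfl⟩)
    rcases lt_or_gt_of_ne h0 with h | h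
    · have : s p = -1 := by simp [s, h.le]
      rw [this]; linarith
    · have : s p = 1 := by simp [s, h]
      rw [this]; linarith
  refine ⟨s, hs, ?_⟩
  have hH := isProjConvexHull_hull hs hf0 hpos
  -- Minimality of `G` turns the first inclusion into the second: both remaining goals say that the
  -- cone hull is contained in `G`.
  refine Set.Subset.antisymm (hG.2 hH.1 ?_) ?_ <;>
  · refine coneProj_subset (f := f) hG.1.1.1 hf ?_
    rintro _ ⟨p, hp, rfl⟩
    refine ⟨by rw [map_smul]; exact hpos p hp, fun hw => hG.1.2 ?_⟩
    exact (mem_image_embed_iff hs I _).2 ⟨_, ⟨p, hp, rfl⟩, hw, rfl⟩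

/-- Either `v` or `-v` lies in the cone, so all functionals nonnegative on the signed points have
the same weak sign at `v`. Two such functionals with strictly opposite signs at `v` therefore
exclude its class from the hull. -/
theorem mem_hull_functional {I : Finset (ℝ × ℝ)} {s : ℝ × ℝ → ℝ} {v : Fin 3 → ℝ} (hv : v ≠ 0)
    (h : Projectivization.mk ℝ v hv ∈ hull I s) :
    (∀ g : (Fin 3 → ℝ) →ₗ[ℝ] ℝ, (∀ q ∈ I, 0 ≤ s q * g (vec q)) → 0 ≤ g v) ∨
    (∀ g : (Fin 3 → ℝ) →ₗ[ℝ] ℝ, (∀ q ∈ I, 0 ≤ s q * g (vec q)) → g v ≤ 0) := by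
  have key : ∀ g : (Fin 3 → ℝ) →ₗ[ℝ] ℝ, (∀ q ∈ I, 0 ≤ s q * g (vec q)) →
      ∀ w ∈ (fun p => s p • vec p) '' (I : Set (ℝ × ℝ)), 0 ≤ g w := by
    rintro g hg _ ⟨q, hq, rfl⟩
    rw [map_smul]; exact hg q hq
  rcases (mk_mem_coneProj hv).1 h with h | h
  · exact Or.inl fun g hg => span_nonneg (key g hg) h
  · refine Or.inr fun g hg => ?_
    have := span_nonneg (key g hg) h
    rw [map_neg] at this
    linarith

theorem embed_mem_hull {I : Finset (ℝ × ℝ)} {s : ℝ × ℝ → ℝ} (hs : IsSign s) {p : ℝ × ℝ}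
    (hp : p ∈ I) : embed p ∈ hull I s := by
  rw [← mk_smul_vec hs p]
  exact ⟨_, _, Submodule.subset_span ⟨p, hp, rfl⟩, rfl⟩

theorem embed_not_mem_interior_hull {I : Finset (ℝ × ℝ)} {s : ℝ × ℝ → ℝ} (hs : IsSign s)
    {f g : (Fin 3 → ℝ) →ₗ[ℝ] ℝ} (hf : ∀ q ∈ I, 0 < s q * f (vec q))
    (hg : ∀ q ∈ I, 0 ≤ s q * g (vec q)) (hg0 : g ≠ 0) {p : ℝ × ℝ} (hfp : 0 < s p * f (vec p))
    (hgp : g (vec p) = 0) : embed p ∉ interior (hull I s) := by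
  rw [← mk_smul_vec hs p]
  refine not_mem_interior_coneProj (f := f) (g := g) ?_ ?_ hg0 _ ?_ ?_
  · rintro _ ⟨q, hq, rfl⟩
    rw [map_smul]; exact hf q hq
  · rintro _ ⟨q, hq, rfl⟩
    rw [map_smul]; exact hg q hq
  · rw [map_smul]; exact hfp
  · rw [map_smul, hgp, smul_zero]

/-- A criterion for a signed point set to span a projective hole. -/
theorem hull_mem_planarProjHoles {H I : Finset (ℝ × ℝ)} {s : ℝ × ℝ → ℝ} (hs : IsSign s)
    (hIH : I ⊆ H) {f : (Fin 3 → ℝ) →ₗ[ℝ] ℝ} (hf0 : f ≠ 0) (hf : ∀ q ∈ I, 0 < s q * f (vec q))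
    (hg : ∀ p ∈ I, ∃ g : (Fin 3 → ℝ) →ₗ[ℝ] ℝ, g ≠ 0 ∧ g (vec p) = 0 ∧
      ∀ q ∈ I, 0 ≤ s q * g (vec q))
    (hH : ∀ p ∈ H, p ∉ I → embed p ∉ interior (hull I s)) :
    hull I s ∈ planarProjHoles I.card H := by
  have hint : ∀ p ∈ I, embed p ∉ interior (hull I s) := by
    intro p hp
    obtain ⟨g, hg0, hgp, hgI⟩ := hg p hp
    exact embed_not_mem_interior_hull hs hf hgI hg0 (hf p hp) hgp
  refine ⟨⟨embed '' (I : Set (ℝ × ℝ)), Set.image_mono (by exact_mod_cast hIH),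
    I.finite_toSet.image _, ?_, isProjConvexHull_hull hs hf0 hf, ?_⟩, ?_⟩
  · rw [Set.ncard_image_of_injective _ embed_injective, Set.ncard_coe_finset]
  · rintro _ ⟨p, hp, rfl⟩
    exact ⟨subset_closure (embed_mem_hull hs hp), hint p hp⟩
  · rw [Set.disjoint_left]
    rintro _ h ⟨p, hp, rfl⟩
    by_cases hpI : p ∈ I
    · exact hint p hpI h
    · exact hH p hp hpI h

theorem mem_hull_of_coeff {I : Finset (ℝ × ℝ)} {s : ℝ × ℝ → ℝ} (hs : IsSign s) {a b c : ℝ × ℝ}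
    (ha : a ∈ I) (hb : b ∈ I) (hc : c ∈ I) (habc : orient a b c ≠ 0) {v : Fin 3 → ℝ} (hv : v ≠ 0)
    (h : (0 < s a * lineForm b c v ∧ 0 < s b * lineForm c a v ∧ 0 < s c * lineForm a b v) ∨
      (s a * lineForm b c v < 0 ∧ s b * lineForm c a v < 0 ∧ s c * lineForm a b v < 0)) :
    Projectivization.mk ℝ v hv ∈ hull I s := by
  have hmem : ∀ x y z : ℝ, 0 ≤ x → 0 ≤ y → 0 ≤ z →
      x • s a • vec a + y • s b • vec b + z • s c • vec c ∈
        Submodule.span NNReal ((fun p => s p • vec p) '' (I : Set (ℝ × ℝ))) := by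
    intro x y z hx hy hz
    exact add_mem (add_mem (smul_mem_span hx (Submodule.subset_span ⟨a, ha, rfl⟩))
      (smul_mem_span hy (Submodule.subset_span ⟨b, hb, rfl⟩)))
      (smul_mem_span hz (Submodule.subset_span ⟨c, hc, rfl⟩))
  have hv' : v = (s a * lineForm b c v / orient a b c) • s a • vec a +
      (s b * lineForm c a v / orient a b c) • s b • vec b +
      (s c * lineForm a b v / orient a b c) • s c • vec c := by
    have h1 := cramer a b c v
    have h2 : v = (orient a b c)⁻¹ • (orient a b c • v) := by
      rw [smul_smul, inv_mul_cancel₀ habc, one_smul]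
    rw [h1] at h2
    have e : ∀ (p : ℝ × ℝ) (t : ℝ), (s p * t / orient a b c) • s p • vec p
        = (orient a b c)⁻¹ • t • vec p := by
      intro p t
      rw [smul_smul, smul_smul]
      congr 1
      have := hs.mul_self p
      field_simp
      rw [sq]; rw [this]; ring
    rw [e, e, e, ← smul_add, ← smul_add]
    exact h2
  have hneg : -v = (-(s a * lineForm b c v / orient a b c)) • s a • vec a +
      (-(s b * lineForm c a v / orient a b c)) • s b • vec b +
      (-(s c * lineForm a b v / orient a b c)) • s c • vec c := by
    conv_lhs => rw [hv']
    simp only [neg_smul, neg_add]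
  refine (mk_mem_coneProj hv).2 ?_
  rcases lt_or_gt_of_ne habc with hd | hd <;> rcases h with ⟨h1, h2, h3⟩ | ⟨h1, h2, h3⟩
  · right; rw [hneg]
    exact hmem _ _ _ (neg_nonneg.2 (div_nonpos_of_nonneg_of_nonpos h1.le hd.le))
      (neg_nonneg.2 (div_nonpos_of_nonneg_of_nonpos h2.le hd.le))
      (neg_nonneg.2 (div_nonpos_of_nonneg_of_nonpos h3.le hd.le))
  · left; rw [hv']
    exact hmem _ _ _ (div_nonneg_of_nonpos h1.le hd.le) (div_nonneg_of_nonpos h2.le hd.le)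
      (div_nonneg_of_nonpos h3.le hd.le)
  · left; rw [hv']
    exact hmem _ _ _ (div_nonneg h1.le hd.le) (div_nonneg h2.le hd.le) (div_nonneg h3.le hd.le)
  · right; rw [hneg]
    exact hmem _ _ _ (neg_nonneg.2 (div_nonpos_of_nonpos_of_nonneg h1.le hd.le))
      (neg_nonneg.2 (div_nonpos_of_nonpos_of_nonneg h2.le hd.le))
      (neg_nonneg.2 (div_nonpos_of_nonpos_of_nonneg h3.le hd.le))

/-- The three strict sign conditions define an open set of vectors that is invariant under nonzero
scaling, so it descends to an open set of the projective plane; by Cramer's rule this set lies in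
the hull. -/
theorem mem_interior_hull {I : Finset (ℝ × ℝ)} {s : ℝ × ℝ → ℝ} (hs : IsSign s) {a b c : ℝ × ℝ}
    (ha : a ∈ I) (hb : b ∈ I) (hc : c ∈ I) (habc : orient a b c ≠ 0) {v : Fin 3 → ℝ} (hv : v ≠ 0)
    (h : (0 < s a * lineForm b c v ∧ 0 < s b * lineForm c a v ∧ 0 < s c * lineForm a b v) ∨
      (s a * lineForm b c v < 0 ∧ s b * lineForm c a v < 0 ∧ s c * lineForm a b v < 0)) :
    Projectivization.mk ℝ v hv ∈ interior (hull I s) := by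
  let S : Set (Fin 3 → ℝ) := {v |
    (0 < s a * lineForm b c v ∧ 0 < s b * lineForm c a v ∧ 0 < s c * lineForm a b v) ∨
      (s a * lineForm b c v < 0 ∧ s b * lineForm c a v < 0 ∧ s c * lineForm a b v < 0)}
  have hS : IsOpen S := by
    have hc1 : ∀ p q : ℝ × ℝ, Continuous (lineForm p q) := fun p q =>
      LinearMap.continuous_of_finiteDimensional _
    have hc2 : ∀ (t : ℝ) (p q : ℝ × ℝ), Continuous fun v => t * lineForm p q v := fun t p q =>
      continuous_const.mul (hc1 p q)
    refine IsOpen.union (IsOpen.inter ?_ (IsOpen.inter ?_ ?_))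
      (IsOpen.inter ?_ (IsOpen.inter ?_ ?_)) <;>
    first
    | exact isOpen_lt continuous_const (hc2 _ _ _)
    | exact isOpen_lt (hc2 _ _ _) continuous_const
  have hSneg : ∀ (t : ℝ) (w : Fin 3 → ℝ), t ≠ 0 → w ∈ S → t • w ∈ S := by
    intro t w ht hw
    have e : ∀ (r : ℝ) (p q : ℝ × ℝ), r * lineForm p q (t • w) = t * (r * lineForm p q w) := by
      intro r p q; rw [map_smul, smul_eq_mul]; ring
    show (_ ∧ _ ∧ _) ∨ (_ ∧ _ ∧ _)
    rw [e, e, e]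
    rcases lt_or_gt_of_ne ht with ht | ht <;> rcases hw with ⟨h1, h2, h3⟩ | ⟨h1, h2, h3⟩
    · exact Or.inr ⟨mul_neg_of_neg_of_pos ht h1, mul_neg_of_neg_of_pos ht h2,
        mul_neg_of_neg_of_pos ht h3⟩
    · exact Or.inl ⟨mul_pos_of_neg_of_neg ht h1, mul_pos_of_neg_of_neg ht h2,
        mul_pos_of_neg_of_neg ht h3⟩
    · exact Or.inl ⟨mul_pos ht h1, mul_pos ht h2, mul_pos ht h3⟩
    · exact Or.inr ⟨mul_neg_of_pos_of_neg ht h1, mul_neg_of_pos_of_neg ht h2,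
        mul_neg_of_pos_of_neg ht h3⟩
  let O : Set RP2 := {q | ∃ w, ∃ hw : w ≠ 0, w ∈ S ∧ q = Projectivization.mk ℝ w hw}
  have hO : IsOpen O := by
    refine isOpen_coinduced.2 ?_
    have : (Projectivization.mk' ℝ (V := Fin 3 → ℝ)) ⁻¹' O = Subtype.val ⁻¹' S := by
      ext ⟨w, hw⟩
      constructor
      · rintro ⟨u, hu, huS, h⟩
        obtain ⟨t, ht, rfl⟩ := (mk_eq_mk_iff_smul hw hu).1 h
        exact hSneg t u ht huS
      · intro h
        exact ⟨w, hw, h, rfl⟩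
    rw [this]
    exact hS.preimage continuous_subtype_val
  refine interior_maximal ?_ hO ⟨v, hv, h, rfl⟩
  rintro _ ⟨w, hw, hwS, rfl⟩
  exact mem_hull_of_coeff hs ha hb hc habc hw hwS

/-- Every projective hole of a planar set in general position is spanned by a signed point set
all of whose triangles are empty. -/
theorem exists_of_mem_planarProjHoles {k : ℕ} {H : Finset (ℝ × ℝ)} (hgp : GenPos H)
    {G : Set RP2} (hG : G ∈ planarProjHoles k H) :
    ∃ I ⊆ H, ∃ s, IsSign s ∧ I.card = k ∧ G = hull I s ∧
      ∀ a ∈ I, ∀ b ∈ I, ∀ c ∈ I, a ≠ b → a ≠ c → b ≠ c →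
        EmptyTri H a b c (s a) (s b) (s c) := by
  obtain ⟨⟨I', hI', hfin, hcard, hhull, -⟩, hdisj⟩ := hG
  obtain ⟨S, hS, rfl⟩ := Set.subset_image_iff.1 hI'
  obtain ⟨I, rfl⟩ := (H.finite_toSet.subset hS).exists_finset_coe
  rw [Set.ncard_image_of_injective _ embed_injective, Set.ncard_coe_finset] at hcard
  obtain ⟨s, hs, rfl⟩ := exists_hull_eq hhull
  have hIH : I ⊆ H := by exact_mod_cast hS
  refine ⟨I, hIH, s, hs, hcard, rfl, ?_⟩
  intro a ha b hb c hc hab hac hbc p hp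
  have habc := hgp a (hIH ha) b (hIH hb) c (hIH hc) hab hac hbc
  have key := fun h => Set.disjoint_left.1 hdisj
    (mem_interior_hull hs ha hb hc habc (vec_ne p) h) ⟨p, hp, rfl⟩
  have e1 : orient p b c = lineForm b c (vec p) := by
    rw [lineForm_vec]; exact (orient_rotate p b c).symm
  have e2 : orient a p c = lineForm c a (vec p) := by
    rw [lineForm_vec]; exact orient_rotate c a p
  rw [e1, e2, ← lineForm_vec]
  exact ⟨fun h => key (Or.inl h), fun h => key (Or.inr h)⟩

/-! ### Projective triangles -/

theorem hull_congr {I : Finset (ℝ × ℝ)} {s t : ℝ × ℝ → ℝ} (h : ∀ p ∈ I, s p = t p) :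
    hull I s = hull I t := by
  unfold hull
  congr 1
  exact Set.image_congr fun p hp => by rw [h p hp]

theorem coneProj_neg_subset (W : Set (Fin 3 → ℝ)) : coneProj (-W) ⊆ coneProj W := by
  rintro _ ⟨x, hx, hxW, rfl⟩
  refine (mk_mem_coneProj hx).2 (Or.inr ?_)
  induction hxW using Submodule.span_induction with
  | mem x h => exact Submodule.subset_span h
  | zero => simp
  | add x y _ _ hx' hy' =>
    rw [neg_add]
    by_cases h1 : x = 0
    · subst h1
      by_cases h2 : y = 0
      · subst h2; simp
      · simpa using hy' h2
    · by_cases h2 : y = 0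
      · subst h2; simpa using hx' h1
      · exact add_mem (hx' h1) (hy' h2)
  | smul a x _ hx' =>
    by_cases h1 : x = 0
    · subst h1; simp
    · rw [← smul_neg]
      exact Submodule.smul_mem _ _ (hx' h1)

theorem coneProj_neg (W : Set (Fin 3 → ℝ)) : coneProj (-W) = coneProj W :=
  Set.Subset.antisymm (coneProj_neg_subset W) (by simpa using coneProj_neg_subset (-W))

theorem hull_neg (I : Finset (ℝ × ℝ)) (s : ℝ × ℝ → ℝ) : hull I (fun p => -s p) = hull I s := by
  unfold hull
  rw [← coneProj_neg]
  congr 1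
  ext v
  simp only [Set.mem_neg, Set.mem_image, neg_smul, neg_inj]

/-- Each side form, scaled by the sign of the opposite vertex and by the orientation, vanishes at
two vertices and is a square at the third; `mem_hull_functional` compares the three forms. -/
theorem coeff_of_mem_hull {s : ℝ × ℝ → ℝ} {a b c : ℝ × ℝ} {v : Fin 3 → ℝ}
    (hv : v ≠ 0) (h : Projectivization.mk ℝ v hv ∈ hull {a, b, c} s) :
    (0 ≤ s a * orient a b c * lineForm b c v ∧ 0 ≤ s b * orient a b c * lineForm c a v ∧
      0 ≤ s c * orient a b c * lineForm a b v) ∨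
    (s a * orient a b c * lineForm b c v ≤ 0 ∧ s b * orient a b c * lineForm c a v ≤ 0 ∧
      s c * orient a b c * lineForm a b v ≤ 0) := by
  have e1 : ∀ q ∈ ({a, b, c} : Finset (ℝ × ℝ)),
      0 ≤ s q * ((s a * orient a b c) • lineForm b c) (vec q) := by
    intro q hq
    simp only [Finset.mem_insert, Finset.mem_singleton] at hq
    simp only [LinearMap.smul_apply, lineForm_vec, smul_eq_mul]
    rcases hq with rfl | rfl | rfl
    · rw [orient_rotate q b c]; nlinarith [mul_self_nonneg (s q * orient q b c)]
    · simp [orient_self_outer]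
    · simp [orient_self_right]
  have e2 : ∀ q ∈ ({a, b, c} : Finset (ℝ × ℝ)),
      0 ≤ s q * ((s b * orient a b c) • lineForm c a) (vec q) := by
    intro q hq
    simp only [Finset.mem_insert, Finset.mem_singleton] at hq
    simp only [LinearMap.smul_apply, lineForm_vec, smul_eq_mul]
    rcases hq with rfl | rfl | rfl
    · simp [orient_self_right]
    · rw [← orient_rotate c a q]; nlinarith [mul_self_nonneg (s q * orient a q c)]
    · simp [orient_self_outer]
  have e3 : ∀ q ∈ ({a, b, c} : Finset (ℝ × ℝ)),
      0 ≤ s q * ((s c * orient a b c) • lineForm a b) (vec q) := by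
    intro q hq
    simp only [Finset.mem_insert, Finset.mem_singleton] at hq
    simp only [LinearMap.smul_apply, lineForm_vec, smul_eq_mul]
    rcases hq with rfl | rfl | rfl
    · simp [orient_self_outer]
    · simp [orient_self_right]
    · nlinarith [mul_self_nonneg (s q * orient a b q)]
  rcases mem_hull_functional hv h with h | h
  · exact Or.inl ⟨h _ e1, h _ e2, h _ e3⟩
  · exact Or.inr ⟨h _ e1, h _ e2, h _ e3⟩

theorem lineForm_ne_zero_of_orient {a b c : ℝ × ℝ} (h : orient a b c ≠ 0) : lineForm a b ≠ 0 := by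
  intro h0
  apply h
  rw [← lineForm_vec, h0]; rfl

/-- General position makes the three coefficients of a further point nonzero, so lying in the closed
triangle would mean lying in the open one. Thus even the boundary of an empty triangle carries only
its vertices, which later lets the hull determine its vertex set. -/
theorem mem_of_mem_hull_triangle {H : Finset (ℝ × ℝ)} (hgp : GenPos H) {s : ℝ × ℝ → ℝ}
    (hs : IsSign s) {a b c : ℝ × ℝ} (ha : a ∈ H) (hb : b ∈ H) (hc : c ∈ H) (hab : a ≠ b)
    (hac : a ≠ c) (hbc : b ≠ c) (he : EmptyTri H a b c (s a) (s b) (s c)) {p : ℝ × ℝ}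
    (hp : p ∈ H) (h : embed p ∈ hull {a, b, c} s) : p ∈ ({a, b, c} : Finset (ℝ × ℝ)) := by
  by_contra hpI
  simp only [Finset.mem_insert, Finset.mem_singleton, not_or] at hpI
  obtain ⟨hpa, hpb, hpc⟩ := hpI
  have hD := hgp a ha b hb c hc hab hac hbc
  have h1 : s a * orient p b c ≠ 0 := mul_ne_zero (hs.ne_zero _) (hgp p hp b hb c hc hpb hpc hbc)
  have h2 : s b * orient a p c ≠ 0 :=
    mul_ne_zero (hs.ne_zero _) (hgp a ha p hp c hc (Ne.symm hpa) hac hpc)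
  have h3 : s c * orient a b p ≠ 0 :=
    mul_ne_zero (hs.ne_zero _) (hgp a ha b hb p hp hab (Ne.symm hpa) (Ne.symm hpb))
  obtain ⟨he1, he2⟩ := he p hp
  have hcoef := coeff_of_mem_hull (vec_ne p) h
  simp only [lineForm_vec] at hcoef
  rw [orient_rotate p b c, ← orient_rotate c a p] at hcoef
  simp only [mul_right_comm _ (orient a b c)] at hcoef
  have pos : ∀ t : ℝ, t ≠ 0 → 0 < orient a b c → 0 ≤ t * orient a b c → 0 < t :=
    fun t ht hD h => lt_of_le_of_ne (nonneg_of_mul_nonneg_left h hD) (Ne.symm ht)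
  have neg : ∀ t : ℝ, t ≠ 0 → 0 < orient a b c → t * orient a b c ≤ 0 → t < 0 :=
    fun t ht hD h => lt_of_le_of_ne (nonpos_of_mul_nonpos_left h hD) ht
  have pos' : ∀ t : ℝ, t ≠ 0 → orient a b c < 0 → 0 ≤ t * orient a b c → t < 0 :=
    fun t ht hD h => lt_of_le_of_ne (by nlinarith) ht
  have neg' : ∀ t : ℝ, t ≠ 0 → orient a b c < 0 → t * orient a b c ≤ 0 → 0 < t :=
    fun t ht hD h => lt_of_le_of_ne (by nlinarith) (Ne.symm ht)
  rcases lt_or_gt_of_ne hD with hD | hD <;> rcases hcoef with ⟨c1, c2, c3⟩ | ⟨c1, c2, c3⟩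
  · exact he2 ⟨pos' _ h1 hD c1, pos' _ h2 hD c2, pos' _ h3 hD c3⟩
  · exact he1 ⟨neg' _ h1 hD c1, neg' _ h2 hD c2, neg' _ h3 hD c3⟩
  · exact he1 ⟨pos _ h1 hD c1, pos _ h2 hD c2, pos _ h3 hD c3⟩
  · exact he2 ⟨neg _ h1 hD c1, neg _ h2 hD c2, neg _ h3 hD c3⟩

theorem hull_triangle_mem_planarProjHoles {H : Finset (ℝ × ℝ)} (hgp : GenPos H) {s : ℝ × ℝ → ℝ}
    (hs : IsSign s) {a b c : ℝ × ℝ} (ha : a ∈ H) (hb : b ∈ H) (hc : c ∈ H) (hab : a ≠ b)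
    (hac : a ≠ c) (hbc : b ≠ c) (he : EmptyTri H a b c (s a) (s b) (s c)) :
    hull {a, b, c} s ∈ planarProjHoles 3 H := by
  have hD := hgp a ha b hb c hc hab hac hbc
  have hcard : ({a, b, c} : Finset (ℝ × ℝ)).card = 3 := Finset.card_eq_three.2
    ⟨a, b, c, hab, hac, hbc, rfl⟩
  have o1 : orient b c a = orient a b c := orient_rotate a b c
  have o2 : orient c a b = orient a b c := (orient_rotate c a b).symm
  -- The functional that takes the value `s q` at each of the three vertices; hence every signing of
  -- a nondegenerate triangle lies in an open half-space.
  have hform : ∀ q ∈ ({a, b, c} : Finset (ℝ × ℝ)),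
      0 < s q * (((s a / orient a b c) • lineForm b c + (s b / orient a b c) • lineForm c a
        + (s c / orient a b c) • lineForm a b) (vec q)) := by
    intro q hq
    simp only [Finset.mem_insert, Finset.mem_singleton] at hq
    simp only [LinearMap.add_apply, LinearMap.smul_apply, lineForm_vec, smul_eq_mul]
    rcases hq with rfl | rfl | rfl
    · rw [o1]
      simp [orient_self_right, orient_self_outer, div_mul_cancel₀ _ hD, hs.mul_self]
    · rw [o2]
      simp [orient_self_right, orient_self_outer, div_mul_cancel₀ _ hD, hs.mul_self]
    · simp [orient_self_right, orient_self_outer, div_mul_cancel₀ _ hD, hs.mul_self]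
  rw [← hcard]
  refine hull_mem_planarProjHoles hs ?_ ?_ hform ?_ ?_
  · intro q hq
    simp only [Finset.mem_insert, Finset.mem_singleton] at hq
    rcases hq with rfl | rfl | rfl <;> assumption
  · intro h0
    have := hform a (by simp)
    rw [h0] at this
    simp at this
  · intro p hp
    simp only [Finset.mem_insert, Finset.mem_singleton] at hp
    have key : ∀ u v w : ℝ × ℝ, orient u v w ≠ 0 → (∀ q ∈ ({a, b, c} : Finset (ℝ × ℝ)),
        q = u ∨ q = v ∨ q = w) → p = u → ∃ g : (Fin 3 → ℝ) →ₗ[ℝ] ℝ, g ≠ 0 ∧ g (vec p) = 0 ∧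
          ∀ q ∈ ({a, b, c} : Finset (ℝ × ℝ)), 0 ≤ s q * g (vec q) := by
      rintro u v w hne hmem rfl
      refine ⟨(s w * orient p v w) • lineForm p v, ?_, ?_, ?_⟩
      · exact smul_ne_zero (mul_ne_zero (hs.ne_zero _) hne) (lineForm_ne_zero_of_orient hne)
      · simp [lineForm_vec, orient_self_outer]
      · intro q hq
        simp only [LinearMap.smul_apply, lineForm_vec, smul_eq_mul]
        rcases hmem q hq with rfl | rfl | rfl
        · simp [orient_self_outer]
        · simp [orient_self_right]
        · nlinarith [mul_self_nonneg (s q * orient p v q)]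
    rcases hp with hp | hp | hp
    · exact key a b c hD (by simp) hp
    · exact key b c a (by rw [o1]; exact hD) (by simp) hp
    · exact key c a b (by rw [o2]; exact hD) (by simp) hp
  · intro p hp hpI hint
    exact hpI (mem_of_mem_hull_triangle hgp hs ha hb hc hab hac hbc he hp (interior_subset hint))

/-- The sum of the vertices signed by `s` lies in the common hull. Its coefficients with respect to
the signing `t` are the products of the two signs, so these products agree at all three vertices. -/
theorem sign_of_hull_eq {s t : ℝ × ℝ → ℝ} (hs : IsSign s) (ht : IsSign t) {a b c : ℝ × ℝ}
    (hD : orient a b c ≠ 0) (h : hull {a, b, c} s = hull {a, b, c} t) (hst : s a = t a) :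
    s b = t b ∧ s c = t c := by
  have hv : ∀ (p q r : ℝ × ℝ), orient p q r ≠ 0 →
      lineForm q r (s p • vec p + s q • vec q + s r • vec r) = s p * orient p q r := by
    intro p q r hne
    simp [lineForm_vec, orient_self_right, orient_self_outer, orient_rotate]
  have h1 := hv a b c hD
  have h2 := hv b c a (by rw [orient_rotate]; exact hD)
  have h3 := hv c a b (by rw [← orient_rotate c a b]; exact hD)
  rw [orient_rotate] at h2
  rw [← orient_rotate c a b] at h3
  have hv0 : s a • vec a + s b • vec b + s c • vec c ≠ 0 := by
    intro h0
    rw [h0, map_zero] at h1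
    exact mul_ne_zero (hs.ne_zero a) hD h1.symm
  have hmem : Projectivization.mk ℝ _ hv0 ∈ hull {a, b, c} s := by
    refine ⟨_, hv0, ?_, rfl⟩
    exact add_mem (add_mem (Submodule.subset_span ⟨a, by simp, rfl⟩)
      (Submodule.subset_span ⟨b, by simp, rfl⟩)) (Submodule.subset_span ⟨c, by simp, rfl⟩)
  rw [h] at hmem
  have e2 : s b • vec b + s c • vec c + s a • vec a = s a • vec a + s b • vec b + s c • vec c := by
    abel
  have e3 : s c • vec c + s a • vec a + s b • vec b = s a • vec a + s b • vec b + s c • vec c := by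
    abel
  rw [e2] at h2
  rw [e3] at h3
  have hco := coeff_of_mem_hull hv0 hmem
  rw [h1, h2, h3, hst] at hco
  have hD2 : 0 < orient a b c * orient a b c := mul_self_pos.2 hD
  rcases hs b with hb | hb <;> rcases hs c with hc | hc <;> rcases ht a with ha' | ha' <;>
    rcases ht b with hb' | hb' <;> rcases ht c with hc' | hc' <;>
    rw [hb, hc, ha', hb', hc'] at hco <;> rw [hb, hc, hb', hc'] <;>
    first
    | exact ⟨rfl, rfl⟩
    | (exfalso; rcases hco with ⟨c1, c2, c3⟩ | ⟨c1, c2, c3⟩ <;> nlinarith)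

/-- The real number `1` or `-1` encoded by a Boolean. -/
def sg (x : Bool) : ℝ := if x then 1 else -1

theorem sg_true : sg true = 1 := rfl

theorem sg_false : sg false = -1 := rfl

open scoped Classical in
/-- The index data of the empty signed triangles of the point set enumerated by `f`. -/
noncomputable def triData (f : ℕ → ℝ × ℝ) (n : ℕ) : Finset (ℕ × ℕ × ℕ × Bool × Bool) :=
  (Finset.range n ×ˢ Finset.range n ×ˢ Finset.range n ×ˢ Finset.univ ×ˢ Finset.univ).filter
    fun t => t.1 < t.2.1 ∧ t.2.1 < t.2.2.1 ∧
      EmptyTri ((Finset.range n).image f) (f t.1) (f t.2.1) (f t.2.2.1) 1 (sg t.2.2.2.1)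
        (sg t.2.2.2.2)

open scoped Classical in
/-- The sign function with given values at two points and at the rest. -/
noncomputable def triSign (a b : ℝ × ℝ) (y z : Bool) : ℝ × ℝ → ℝ := fun p =>
  if p = a then 1 else if p = b then sg y else sg z

theorem isSign_triSign (a b : ℝ × ℝ) (y z : Bool) : IsSign (triSign a b y z) := by
  intro p
  unfold triSign sg
  split_ifs <;> simp

theorem EmptyTri.neg {P : Finset (ℝ × ℝ)} {a b c : ℝ × ℝ} {x y z : ℝ}
    (h : EmptyTri P a b c x y z) : EmptyTri P a b c (-x) (-y) (-z) := by
  intro p hp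
  obtain ⟨h1, h2⟩ := h p hp
  simp only [neg_mul, Left.neg_pos_iff, Left.neg_neg_iff]
  exact ⟨h2, h1⟩

/-- The projective 3-holes correspond to the empty signed triangles. -/
theorem ncard_planarProjHoles_three {f : ℕ → ℝ × ℝ} {n : ℕ}
    (hf : ∀ i j, i < j → j < n → (f i).1 < (f j).1)
    (hgp : GenPos ((Finset.range n).image f)) :
    (planarProjHoles 3 ((Finset.range n).image f)).Finite ∧
      (planarProjHoles 3 ((Finset.range n).image f)).ncard = (triData f n).card := by
  classical
  set H := (Finset.range n).image f with hH
  let Φ : ℕ × ℕ × ℕ × Bool × Bool → Set RP2 := fun t =>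
    hull {f t.1, f t.2.1, f t.2.2.1} (triSign (f t.1) (f t.2.1) t.2.2.2.1 t.2.2.2.2)
  have hne : ∀ i j, i < j → j < n → f i ≠ f j := fun i j h hj e => by
    have := hf i j h hj; rw [e] at this; exact lt_irrefl _ this
  have hmemH : ∀ i, i < n → f i ∈ H := fun i hi =>
    Finset.mem_image_of_mem f (Finset.mem_range.2 hi)
  have hdata : ∀ t ∈ triData f n, t.1 < t.2.1 ∧ t.2.1 < t.2.2.1 ∧ t.2.2.1 < n ∧
      triSign (f t.1) (f t.2.1) t.2.2.2.1 t.2.2.2.2 (f t.1) = 1 ∧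
      triSign (f t.1) (f t.2.1) t.2.2.2.1 t.2.2.2.2 (f t.2.1) = sg t.2.2.2.1 ∧
      triSign (f t.1) (f t.2.1) t.2.2.2.1 t.2.2.2.2 (f t.2.2.1) = sg t.2.2.2.2 ∧
      EmptyTri H (f t.1) (f t.2.1) (f t.2.2.1)
        (triSign (f t.1) (f t.2.1) t.2.2.2.1 t.2.2.2.2 (f t.1))
        (triSign (f t.1) (f t.2.1) t.2.2.2.1 t.2.2.2.2 (f t.2.1))
        (triSign (f t.1) (f t.2.1) t.2.2.2.1 t.2.2.2.2 (f t.2.2.1)) := by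
    rintro ⟨i, j, k, y, z⟩ ht
    simp only [triData, Finset.mem_filter, Finset.mem_product, Finset.mem_range,
      Finset.mem_univ, and_true] at ht
    obtain ⟨⟨hi, hj, hk⟩, hij, hjk, he⟩ := ht
    have s1 : triSign (f i) (f j) y z (f i) = 1 := by simp [triSign]
    have s2 : triSign (f i) (f j) y z (f j) = sg y := by
      simp [triSign, (hne i j hij hj).symm]
    have s3 : triSign (f i) (f j) y z (f k) = sg z := by
      simp [triSign, (hne i k (hij.trans hjk) hk).symm, (hne j k hjk hk).symm]
    refine ⟨hij, hjk, hk, s1, s2, s3, ?_⟩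
    simp only [s1, s2, s3]
    exact he
  have himg : planarProjHoles 3 H = Φ '' (triData f n : Set (ℕ × ℕ × ℕ × Bool × Bool)) := by
    ext G
    constructor
    · intro hG
      obtain ⟨I, hIH, s, hs, hcard, rfl, hemp⟩ := exists_of_mem_planarProjHoles hgp hG
      obtain ⟨i, j, k, hij, hjk, hkn, rfl⟩ : ∃ i j k, i < j ∧ j < k ∧ k < n ∧
          I = {f i, f j, f k} := by
        obtain ⟨a, b, c, hab, hac, hbc, rfl⟩ := Finset.card_eq_three.1 hcard
        obtain ⟨i, hi, rfl⟩ := Finset.mem_image.1 (hIH (show a ∈ _ by simp))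
        obtain ⟨j, hj, rfl⟩ := Finset.mem_image.1 (hIH (show b ∈ _ by simp))
        obtain ⟨k, hk, rfl⟩ := Finset.mem_image.1 (hIH (show c ∈ _ by simp))
        rw [Finset.mem_range] at hi hj hk
        have n1 : i ≠ j := fun h => hab (by rw [h])
        have n2 : i ≠ k := fun h => hac (by rw [h])
        have n3 : j ≠ k := fun h => hbc (by rw [h])
        rcases lt_or_gt_of_ne n1 with h1 | h1 <;> rcases lt_or_gt_of_ne n2 with h2 | h2 <;>
          rcases lt_or_gt_of_ne n3 with h3 | h3
        · exact ⟨i, j, k, h1, h3, hk, rfl⟩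
        · exact ⟨i, k, j, h2, h3, hj, by ext; simp; tauto⟩
        · omega
        · exact ⟨k, i, j, h2, h1, hj, by ext; simp; tauto⟩
        · exact ⟨j, i, k, h1, h2, hk, by ext; simp; tauto⟩
        · omega
        · exact ⟨j, k, i, h3, h2, hi, by ext; simp; tauto⟩
        · exact ⟨k, j, i, h3, h1, hi, by ext; simp; tauto⟩
      have n1 := hne i j hij (hjk.trans hkn)
      have n2 := hne i k (hij.trans hjk) hkn
      have n3 := hne j k hjk hkn
      have he := hemp (f i) (by simp) (f j) (by simp) (f k) (by simp) n1 n2 n3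
      -- A global sign change does not alter the hull, so the leftmost vertex may be given sign 1,
      -- as in `triData`.
      have main : ∀ t : ℝ × ℝ → ℝ, IsSign t → t (f i) = 1 →
          EmptyTri H (f i) (f j) (f k) (t (f i)) (t (f j)) (t (f k)) →
          hull {f i, f j, f k} t ∈ Φ '' (triData f n : Set (ℕ × ℕ × ℕ × Bool × Bool)) := by
        intro t ht hti het
        have hsg : ∀ p, sg (decide (t p = 1)) = t p := by
          intro p
          rcases ht p with h | h
          · rw [h]; simp [sg]
          · rw [h]; simp [sg]; norm_num
        refine ⟨(i, j, k, decide (t (f j) = 1), decide (t (f k) = 1)), ?_, ?_⟩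
        · simp only [triData, Finset.coe_filter, Set.mem_ofPred_eq, Finset.mem_product,
            Finset.mem_range, Finset.mem_univ, and_true, hsg]
          rw [hti] at het
          exact ⟨⟨hij.trans (hjk.trans hkn), hjk.trans hkn, hkn⟩, hij, hjk, het⟩
        · refine hull_congr ?_
          intro p hp
          simp only [Finset.mem_insert, Finset.mem_singleton] at hp
          rcases hp with rfl | rfl | rfl
          · simp [triSign, hti]
          · simp only [triSign, n1.symm, if_false, if_true, hsg]
          · simp only [triSign, n2.symm, n3.symm, if_false, hsg]
      rcases hs (f i) with h | h
      · exact main s hs h he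
      · rw [← hull_neg]
        refine main (fun p => -s p) (fun p => ?_) (by simp [h]) he.neg
        rcases hs p with h | h <;> simp [h]
    · rintro ⟨t, ht, rfl⟩
      obtain ⟨hij, hjk, hkn, -, -, -, he⟩ := hdata t ht
      exact hull_triangle_mem_planarProjHoles hgp (isSign_triSign _ _ _ _)
        (hmemH _ (by omega)) (hmemH _ (by omega)) (hmemH _ hkn) (hne _ _ hij (by omega))
        (hne _ _ (by omega) hkn) (hne _ _ hjk hkn) he
  have hinj : Set.InjOn Φ (triData f n : Set (ℕ × ℕ × ℕ × Bool × Bool)) := by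
    -- An empty hull contains no points of the set other than its vertices, so equal hulls have
    -- nested vertex indices; the ordering of the indices then forces equality.
    have hsub : ∀ t ∈ triData f n, ∀ t' ∈ triData f n, Φ t = Φ t' →
        ∀ i ∈ ({t'.1, t'.2.1, t'.2.2.1} : Finset ℕ), i = t.1 ∨ i = t.2.1 ∨ i = t.2.2.1 := by
      intro t ht t' ht' h i hi
      obtain ⟨hij, hjk, hkn, -, -, -, he⟩ := hdata t ht
      obtain ⟨hij', hjk', hkn', -, -, -, -⟩ := hdata t' ht'
      have hin : i < n := by
        simp only [Finset.mem_insert, Finset.mem_singleton] at hi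
        omega
      have hmem : embed (f i) ∈ Φ t := by
        rw [h]
        refine embed_mem_hull (isSign_triSign _ _ _ _) ?_
        simp only [Finset.mem_insert, Finset.mem_singleton] at hi ⊢
        rcases hi with rfl | rfl | rfl <;> simp
      have := mem_of_mem_hull_triangle hgp (isSign_triSign _ _ _ _)
        (hmemH _ (by omega)) (hmemH _ (by omega)) (hmemH _ hkn) (hne _ _ hij (by omega))
        (hne _ _ (by omega) hkn) (hne _ _ hjk hkn) he (hmemH i hin) hmem
      simp only [Finset.mem_insert, Finset.mem_singleton] at this
      have inj : ∀ j, j < n → f i = f j → i = j := by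
        intro j hj e
        by_contra hne'
        rcases lt_or_gt_of_ne hne' with h' | h'
        · exact hne i j h' hj e
        · exact hne j i h' hin e.symm
      rcases this with h | h | h
      · exact Or.inl (inj _ (by omega) h)
      · exact Or.inr (Or.inl (inj _ (by omega) h))
      · exact Or.inr (Or.inr (inj _ (by omega) h))
    intro t ht t' ht' h
    have g1 := hsub t ht t' ht' h
    obtain ⟨hij, hjk, hkn, p1, p2, p3, he⟩ := hdata t ht
    obtain ⟨hij', hjk', hkn', p1', p2', p3', -⟩ := hdata t' ht'
    simp only [Finset.mem_insert, Finset.mem_singleton, forall_eq_or_imp, forall_eq] at g1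
    have q1 : t.1 = t'.1 := by omega
    have q2 : t.2.1 = t'.2.1 := by omega
    have q3 : t.2.2.1 = t'.2.2.1 := by omega
    obtain ⟨i, j, k, y, z⟩ := t
    obtain ⟨i', j', k', y', z'⟩ := t'
    simp only at q1 q2 q3 p1 p2 p3 p1' p2' p3' hij hjk hkn
    subst q1 q2 q3
    have hD := hgp (f i) (hmemH _ (by omega)) (f j) (hmemH _ (by omega)) (f k) (hmemH _ hkn)
      (hne _ _ hij (by omega)) (hne _ _ (by omega) hkn) (hne _ _ hjk hkn)
    have := sign_of_hull_eq (isSign_triSign _ _ y z) (isSign_triSign _ _ y' z') hD h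
      (by rw [p1, p1'])
    rw [p2, p2', p3, p3'] at this
    have hsg : ∀ y y' : Bool, sg y = sg y' → y = y' := by
      intro y y' h
      cases y <;> cases y' <;> simp [sg] at h ⊢ <;> norm_num at h
    rw [hsg _ _ this.1, hsg _ _ this.2]
  rw [himg]
  exact ⟨(Finset.finite_toSet _).image _, by
    rw [hinj.ncard_image, Set.ncard_coe_finset]⟩

/-! ### Deep pairs of sets and empty triangles -/

/-- With `σ = 1`: `L` lies deep below `U`; with `σ = -1`: `L` lies high above `U`. -/
def Deep (σ : ℝ) (L U : Finset (ℝ × ℝ)) : Prop :=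
  (∀ a ∈ L, ∀ b ∈ L, ∀ c ∈ U, a.1 < b.1 → 0 < σ * orient a b c) ∧
  (∀ a ∈ U, ∀ b ∈ U, ∀ c ∈ L, a.1 < b.1 → σ * orient a b c < 0)

theorem Deep.swap {σ : ℝ} {L U : Finset (ℝ × ℝ)} (h : Deep σ L U) : Deep (-σ) U L :=
  ⟨fun a ha b hb c hc hab => by linarith [h.2 a ha b hb c hc hab],
    fun a ha b hb c hc hab => by linarith [h.1 a ha b hb c hc hab]⟩

/-- No point of `X` between `a` and `b` lies above (`σ = 1`) or below (`σ = -1`) the line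
through `a` and `b`. -/
def InnerFree (σ : ℝ) (X : Finset (ℝ × ℝ)) (a b : ℝ × ℝ) : Prop :=
  ∀ p ∈ X, a.1 < p.1 → p.1 < b.1 → σ * orient a b p ≤ 0

/-- With `σ = 1`: no point of `X` to the left of `a` lies below the line through `a` and `b`,
and no point to the right of `b` lies above it; with `σ = -1`, above and below are swapped. -/
def OuterFree (σ : ℝ) (X : Finset (ℝ × ℝ)) (a b : ℝ × ℝ) : Prop :=
  ∀ p ∈ X, (p.1 < a.1 → 0 ≤ σ * orient a b p) ∧ (b.1 < p.1 → σ * orient a b p ≤ 0)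

/-- Multiplying all determinants by -1 merely exchanges the two forbidden sign patterns. This lets
one argument treat the lower and the upper part alike. -/
theorem emptyTri_scale {σ : ℝ} (hσ : σ = 1 ∨ σ = -1) (P : Finset (ℝ × ℝ)) (a b c : ℝ × ℝ)
    (x y z : ℝ) : EmptyTri P a b c x y z ↔ ∀ p ∈ P,
      ¬(0 < x * (σ * orient p b c) ∧ 0 < y * (σ * orient a p c) ∧ 0 < z * (σ * orient a b p)) ∧
      ¬(x * (σ * orient p b c) < 0 ∧ y * (σ * orient a p c) < 0 ∧
        z * (σ * orient a b p) < 0) := by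
  unfold EmptyTri
  rcases hσ with rfl | rfl
  · simp only [one_mul]
  · refine forall₂_congr fun p _ => ?_
    simp only [neg_mul, one_mul, mul_neg, Left.neg_pos_iff, Left.neg_neg_iff]
    exact and_comm

/-- For `p` in the part of `a` and `b`, depth makes the signs of the coefficients at `a` and `b`
depend only on the horizontal position of `p`; only the coefficient at `c` is left undetermined. -/
theorem lower_coeff {σ : ℝ} {L U : Finset (ℝ × ℝ)} (hd : Deep σ L U)
    (hx : Set.InjOn Prod.fst (L : Set (ℝ × ℝ))) {a b c p : ℝ × ℝ} (ha : a ∈ L) (hb : b ∈ L)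
    (hc : c ∈ U) (hp : p ∈ L) :
    (p.1 < b.1 → 0 < σ * orient p b c) ∧ (p.1 = b.1 → σ * orient p b c = 0) ∧
    (b.1 < p.1 → σ * orient p b c < 0) ∧ (p.1 < a.1 → σ * orient a p c < 0) ∧
    (p.1 = a.1 → σ * orient a p c = 0) ∧ (a.1 < p.1 → 0 < σ * orient a p c) ∧
    (p.1 = a.1 ∨ p.1 = b.1 → σ * orient a b p = 0) := by
  refine ⟨hd.1 p hp b hb c hc, fun h => ?_, fun h => ?_, fun h => ?_, fun h => ?_,
    hd.1 a ha p hp c hc, ?_⟩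
  · rw [hx hp hb h, orient_self_left, mul_zero]
  · have := hd.1 b hb p hp c hc h
    rw [orient_swap] at this; linarith
  · have := hd.1 p hp a ha c hc h
    rw [orient_swap] at this; linarith
  · rw [hx hp ha h, orient_self_left, mul_zero]
  · rintro (h | h)
    · rw [hx hp ha h, orient_self_outer, mul_zero]
    · rw [hx hp hb h, orient_self_right, mul_zero]

theorem upper_coeff {σ : ℝ} {L U : Finset (ℝ × ℝ)} (hd : Deep σ L U)
    (hx : Set.InjOn Prod.fst (U : Set (ℝ × ℝ))) {a b c p : ℝ × ℝ} (ha : a ∈ L) (hb : b ∈ L)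
    (hab : a.1 < b.1) (hc : c ∈ U) (hp : p ∈ U) :
    (p.1 < c.1 → 0 < σ * orient p b c ∧ σ * orient a p c < 0) ∧
    (p.1 = c.1 → σ * orient p b c = 0) ∧
    (c.1 < p.1 → σ * orient p b c < 0 ∧ 0 < σ * orient a p c) ∧ 0 < σ * orient a b p := by
  refine ⟨fun h => ⟨?_, ?_⟩, fun h => ?_, fun h => ⟨?_, ?_⟩, hd.1 a ha b hb p hp hab⟩
  · have := hd.2 p hp c hc b hb h
    rw [orient_swap_right] at this; linarith
  · have := hd.2 p hp c hc a ha h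
    rwa [orient_rotate] at this
  · rw [hx hp hc h, orient_self_outer, mul_zero]
  · have := hd.2 c hc p hp b hb h
    rwa [← orient_rotate] at this
  · have := hd.2 c hc p hp a ha h
    rw [orient_swap, orient_rotate] at this; linarith

/-! ### Emptiness of signed triangles for a deep pair of sets -/

section Mixed

variable {σ : ℝ} {L U : Finset (ℝ × ℝ)} {a b c : ℝ × ℝ}

/-- The coefficients at `a` and `b` agree in sign only for points of `L` strictly between `a` and
`b`. Points of `U` always have a mixed pattern, so they impose nothing. -/
theorem emptyTri_pos_pos (hσ : σ = 1 ∨ σ = -1) (hd : Deep σ L U)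
    (hL : Set.InjOn Prod.fst (L : Set (ℝ × ℝ))) (hU : Set.InjOn Prod.fst (U : Set (ℝ × ℝ)))
    (ha : a ∈ L) (hb : b ∈ L) (hab : a.1 < b.1) (hc : c ∈ U) :
    EmptyTri (L ∪ U) a b c 1 1 1 ↔ InnerFree σ L a b := by
  rw [emptyTri_scale hσ]
  simp only [one_mul]
  constructor
  · intro h p hp h1 h2
    obtain ⟨l1, -, -, -, -, l6, -⟩ := lower_coeff hd hL ha hb hc hp
    have := (h p (Finset.mem_union_left _ hp)).1
    by_contra h3
    exact this ⟨l1 h2, l6 h1, not_le.1 h3⟩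
  · intro h p hp
    rcases Finset.mem_union.1 hp with hp | hp
    · obtain ⟨l1, l2, l3, l4, l5, l6, l7⟩ := lower_coeff hd hL ha hb hc hp
      have hf := h p hp
      grind
    · obtain ⟨u1, u2, u3, u4⟩ := upper_coeff hd hU ha hb hab hc hp
      grind

theorem emptyTri_neg_neg (hσ : σ = 1 ∨ σ = -1) (hd : Deep σ L U)
    (hL : Set.InjOn Prod.fst (L : Set (ℝ × ℝ))) (hU : Set.InjOn Prod.fst (U : Set (ℝ × ℝ)))
    (ha : a ∈ L) (hb : b ∈ L) (hab : a.1 < b.1) (hc : c ∈ U) :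
    EmptyTri (L ∪ U) a b c (-1) (-1) 1 ↔ InnerFree (-σ) L a b := by
  rw [emptyTri_scale hσ]
  simp only [one_mul, neg_mul, Left.neg_pos_iff, Left.neg_neg_iff]
  constructor
  · intro h p hp h1 h2
    obtain ⟨l1, -, -, -, -, l6, -⟩ := lower_coeff hd hL ha hb hc hp
    have := (h p (Finset.mem_union_left _ hp)).2
    by_contra h3
    exact this ⟨l1 h2, l6 h1, by linarith [not_le.1 h3]⟩
  · intro h p hp
    rcases Finset.mem_union.1 hp with hp | hp
    · obtain ⟨l1, l2, l3, l4, l5, l6, l7⟩ := lower_coeff hd hL ha hb hc hp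
      have hf := h p hp
      rw [neg_mul] at hf
      grind
    · obtain ⟨u1, u2, u3, u4⟩ := upper_coeff hd hU ha hb hab hc hp
      grind

/-- Negating the sign at `a` reverses the roles: now the coefficients at `a` and `b` agree only for
points of `L` outside the strip, and there the third one decides. For points of `U` the third is
positive and the first two are positive precisely to the right of `c`, so `c` has to be rightmost.
-/
theorem emptyTri_neg_pos (hσ : σ = 1 ∨ σ = -1) (hd : Deep σ L U)
    (hL : Set.InjOn Prod.fst (L : Set (ℝ × ℝ))) (hU : Set.InjOn Prod.fst (U : Set (ℝ × ℝ)))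
    (ha : a ∈ L) (hb : b ∈ L) (hab : a.1 < b.1) (hc : c ∈ U) :
    EmptyTri (L ∪ U) a b c (-1) 1 1 ↔ (∀ p ∈ U, p.1 ≤ c.1) ∧ OuterFree σ L a b := by
  rw [emptyTri_scale hσ]
  simp only [one_mul, neg_mul, Left.neg_pos_iff, Left.neg_neg_iff]
  constructor
  · intro h
    refine ⟨fun p hp => ?_, fun p hp => ?_⟩
    · obtain ⟨u1, u2, u3, u4⟩ := upper_coeff hd hU ha hb hab hc hp
      have := h p (Finset.mem_union_right _ hp)
      grind
    · obtain ⟨l1, l2, l3, l4, l5, l6, l7⟩ := lower_coeff hd hL ha hb hc hp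
      have := h p (Finset.mem_union_left _ hp)
      grind
  · rintro ⟨h1, h2⟩ p hp
    rcases Finset.mem_union.1 hp with hp | hp
    · obtain ⟨l1, l2, l3, l4, l5, l6, l7⟩ := lower_coeff hd hL ha hb hc hp
      have hf := h2 p hp
      grind
    · obtain ⟨u1, u2, u3, u4⟩ := upper_coeff hd hU ha hb hab hc hp
      have := h1 p hp
      grind

theorem emptyTri_pos_neg (hσ : σ = 1 ∨ σ = -1) (hd : Deep σ L U)
    (hL : Set.InjOn Prod.fst (L : Set (ℝ × ℝ))) (hU : Set.InjOn Prod.fst (U : Set (ℝ × ℝ)))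
    (ha : a ∈ L) (hb : b ∈ L) (hab : a.1 < b.1) (hc : c ∈ U) :
    EmptyTri (L ∪ U) a b c 1 (-1) 1 ↔ (∀ p ∈ U, c.1 ≤ p.1) ∧ OuterFree (-σ) L a b := by
  rw [emptyTri_scale hσ]
  simp only [one_mul, neg_mul, Left.neg_pos_iff, Left.neg_neg_iff]
  constructor
  · intro h
    refine ⟨fun p hp => ?_, fun p hp => ?_⟩
    · obtain ⟨u1, u2, u3, u4⟩ := upper_coeff hd hU ha hb hab hc hp
      have := h p (Finset.mem_union_right _ hp)
      grind
    · obtain ⟨l1, l2, l3, l4, l5, l6, l7⟩ := lower_coeff hd hL ha hb hc hp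
      have := h p (Finset.mem_union_left _ hp)
      rw [neg_mul]
      grind
  · rintro ⟨h1, h2⟩ p hp
    rcases Finset.mem_union.1 hp with hp | hp
    · obtain ⟨l1, l2, l3, l4, l5, l6, l7⟩ := lower_coeff hd hL ha hb hc hp
      have hf := h2 p hp
      rw [neg_mul] at hf
      grind
    · obtain ⟨u1, u2, u3, u4⟩ := upper_coeff hd hU ha hb hab hc hp
      have := h1 p hp
      grind

/-- Points of the other part only lie in the triangle with the middle point negated. -/
theorem emptyTri_inner (hσ : σ = 1 ∨ σ = -1) (hd : Deep σ L U) (hne : U.Nonempty)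
    (ha : a ∈ L) (hb : b ∈ L) (hc : c ∈ L) (hab : a.1 < b.1) (hbc : b.1 < c.1) {x y z : ℝ}
    (hx : x = 1 ∨ x = -1) (hy : y = 1 ∨ y = -1) (hz : z = 1 ∨ z = -1) :
    EmptyTri (L ∪ U) a b c x y z ↔ EmptyTri L a b c x y z ∧ ¬(y = -x ∧ z = x) := by
  -- Every point of `U` has the coefficient pattern plus, minus, plus, which lies in the triangle
  -- with the middle vertex negated and in no other signing.
  have key : ∀ p ∈ U, 0 < σ * orient p b c ∧ σ * orient a p c < 0 ∧ 0 < σ * orient a b p := by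
    intro p hp
    refine ⟨?_, ?_, hd.1 a ha b hb p hp hab⟩
    · have := hd.1 b hb c hc p hp hbc
      rwa [orient_rotate] at this
    · have := hd.1 a ha c hc p hp (hab.trans hbc)
      rw [orient_swap_right] at this; linarith
  rw [emptyTri_scale hσ, emptyTri_scale hσ]
  constructor
  · intro h
    refine ⟨fun p hp => h p (Finset.mem_union_left _ hp), ?_⟩
    rintro ⟨rfl, rfl⟩
    obtain ⟨p, hp⟩ := hne
    obtain ⟨k1, k2, k3⟩ := key p hp
    have := h p (Finset.mem_union_right _ hp)
    rcases hx with rfl | rfl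
    · simp only [one_mul, neg_mul, Left.neg_pos_iff, Left.neg_neg_iff] at this
      exact this.1 ⟨k1, k2, k3⟩
    · simp only [one_mul, neg_mul, neg_neg, Left.neg_pos_iff, Left.neg_neg_iff] at this
      exact this.2 ⟨k1, k2, k3⟩
  · rintro ⟨h1, h2⟩ p hp
    rcases Finset.mem_union.1 hp with hp | hp
    · exact h1 p hp
    · obtain ⟨k1, k2, k3⟩ := key p hp
      have n1 : ¬ ((1 : ℝ) = -1) := by norm_num
      have n2 : ¬ ((-1 : ℝ) = 1) := by norm_num
      rcases hx with rfl | rfl <;> rcases hy with rfl | rfl <;> rcases hz with rfl | rfl <;>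
        simp only [one_mul, neg_mul, neg_neg, Left.neg_pos_iff, Left.neg_neg_iff] at h2 ⊢ <;>
        grind

end Mixed

theorem EmptyTri.mono {P Q : Finset (ℝ × ℝ)} (hQ : Q ⊆ P) {a b c : ℝ × ℝ} {x y z : ℝ}
    (h : EmptyTri P a b c x y z) : EmptyTri Q a b c x y z := fun p hp => h p (hQ hp)

theorem EmptyTri.rotate {P : Finset (ℝ × ℝ)} {a b c : ℝ × ℝ} {x y z : ℝ}
    (h : EmptyTri P a b c x y z) : EmptyTri P b c a y z x := by
  intro p hp
  obtain ⟨h1, h2⟩ := h p hp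
  rw [show orient p c a = orient a p c from orient_rotate a p c,
    show orient b p a = orient a b p from orient_rotate a b p,
    show orient b c p = orient p b c from orient_rotate p b c]
  exact ⟨fun h => h1 ⟨h.2.2, h.1, h.2.1⟩, fun h => h2 ⟨h.2.2, h.1, h.2.1⟩⟩

theorem EmptyTri.swap {P : Finset (ℝ × ℝ)} {a b c : ℝ × ℝ} {x y z : ℝ}
    (h : EmptyTri P a b c x y z) : EmptyTri P b a c y x z := by
  intro p hp
  obtain ⟨h1, h2⟩ := h p hp
  rw [show orient p a c = -orient a p c from orient_swap a p c,
    show orient b p c = -orient p b c from orient_swap p b c,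
    show orient b a p = -orient a b p from orient_swap a b p]
  simp only [mul_neg, Left.neg_pos_iff, Left.neg_neg_iff]
  exact ⟨fun h => h2 ⟨h.2.1, h.1, h.2.2⟩, fun h => h1 ⟨h.2.1, h.1, h.2.2⟩⟩

/-! ### The structure of Horton sets -/

theorem lineAt_lt_iff {q r p : ℝ × ℝ} (h : q.1 < r.1) :
    lineAt q r p.1 < p.2 ↔ 0 < orient q r p := by
  have h' : 0 < r.1 - q.1 := sub_pos.2 h
  have e : orient q r p = (p.2 - lineAt q r p.1) * (r.1 - q.1) := by
    unfold orient lineAt; field_simp; ring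
  rw [e, mul_pos_iff_of_pos_right h', sub_pos]

theorem lt_lineAt_iff {q r p : ℝ × ℝ} (h : q.1 < r.1) :
    p.2 < lineAt q r p.1 ↔ orient q r p < 0 := by
  have h' : 0 < r.1 - q.1 := sub_pos.2 h
  have e : orient q r p = (p.2 - lineAt q r p.1) * (r.1 - q.1) := by
    unfold orient lineAt; field_simp; ring
  rw [e, mul_neg_iff]
  constructor
  · intro h; right; exact ⟨by linarith, h'⟩
  · rintro (h | h) <;> linarith [h.1, h.2]

theorem DeepBelow.deep {X Y : Finset (ℝ × ℝ)} (h : DeepBelow X Y) : Deep 1 X Y := by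
  refine ⟨fun a ha b hb c hc hab => ?_, fun a ha b hb c hc hab => ?_⟩
  · rw [one_mul, ← lineAt_lt_iff hab]
    exact h.2 c hc a ha b hb (fun e => by rw [e] at hab; exact lt_irrefl _ hab)
  · rw [one_mul, ← lt_lineAt_iff hab]
    exact h.1 c hc a ha b hb (fun e => by rw [e] at hab; exact lt_irrefl _ hab)

/-- `f` lists points from left to right, up to index `n`. -/
def Sorted (f : ℕ → ℝ × ℝ) (n : ℕ) : Prop := ∀ i j, i < j → j < n → (f i).1 < (f j).1

/-- The first `n` points listed by `f`. -/
noncomputable def pts (f : ℕ → ℝ × ℝ) (n : ℕ) : Finset (ℝ × ℝ) := (Finset.range n).image f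

theorem mem_pts {f : ℕ → ℝ × ℝ} {n : ℕ} {p : ℝ × ℝ} : p ∈ pts f n ↔ ∃ i < n, f i = p := by
  simp [pts]

theorem apply_mem_pts {f : ℕ → ℝ × ℝ} {n i : ℕ} (hi : i < n) : f i ∈ pts f n :=
  mem_pts.2 ⟨i, hi, rfl⟩

theorem Sorted.lt_iff {f : ℕ → ℝ × ℝ} {n : ℕ} (hf : Sorted f n) {i j : ℕ} (hi : i < n)
    (hj : j < n) : (f i).1 < (f j).1 ↔ i < j := by
  constructor
  · intro h
    by_contra h'
    rcases (not_lt.1 h').lt_or_eq with h'' | rfl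
    · exact lt_asymm h (hf j i h'' hi)
    · exact lt_irrefl _ h
  · intro h; exact hf i j h hj

theorem Sorted.le_iff {f : ℕ → ℝ × ℝ} {n : ℕ} (hf : Sorted f n) {i j : ℕ} (hi : i < n)
    (hj : j < n) : (f i).1 ≤ (f j).1 ↔ i ≤ j := by
  rw [← not_lt, hf.lt_iff hj hi, not_lt]

theorem Sorted.inj {f : ℕ → ℝ × ℝ} {n : ℕ} (hf : Sorted f n) {i j : ℕ} (hi : i < n)
    (hj : j < n) (h : (f i).1 = (f j).1) : i = j :=
  le_antisymm ((hf.le_iff hi hj).1 h.le) ((hf.le_iff hj hi).1 h.ge)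

theorem Sorted.injOn_pts {f : ℕ → ℝ × ℝ} {n : ℕ} (hf : Sorted f n) :
    Set.InjOn Prod.fst (pts f n : Set (ℝ × ℝ)) := by
  intro p hp q hq h
  obtain ⟨i, hi, rfl⟩ := mem_pts.1 hp
  obtain ⟨j, hj, rfl⟩ := mem_pts.1 hq
  rw [hf.inj hi hj h]

theorem Sorted.card_pts {f : ℕ → ℝ × ℝ} {n : ℕ} (hf : Sorted f n) : (pts f n).card = n := by
  rw [pts, Finset.card_image_of_injOn, Finset.card_range]
  intro i hi j hj h
  simp only [Finset.coe_range, Set.mem_Iio] at hi hj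
  exact hf.inj hi hj (by rw [h])

theorem exists_sorted (X : Finset (ℝ × ℝ)) (hx : Set.InjOn Prod.fst (X : Set (ℝ × ℝ))) :
    ∃ f : ℕ → ℝ × ℝ, Sorted f X.card ∧ pts f X.card = X := by
  have hcard : (X.image Prod.fst).card = X.card := Finset.card_image_of_injOn hx
  let e := (X.image Prod.fst).orderEmbOfFin hcard
  have hex : ∀ i : ℕ, ∃ p : ℝ × ℝ, ∀ hi : i < X.card, p ∈ X ∧ p.1 = e ⟨i, hi⟩ := by
    intro i
    by_cases hi : i < X.card
    · obtain ⟨p, hp, h⟩ := Finset.mem_image.1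
        ((X.image Prod.fst).orderEmbOfFin_mem hcard ⟨i, hi⟩)
      exact ⟨p, fun _ => ⟨hp, h⟩⟩
    · exact ⟨0, fun h => absurd h hi⟩
  choose f hf using hex
  have hs : Sorted f X.card := by
    intro i j hij hj
    rw [(hf i (hij.trans hj)).2, (hf j hj).2]
    exact e.strictMono hij
  refine ⟨f, hs, Finset.eq_of_subset_of_card_le ?_ ?_⟩
  · intro p hp
    obtain ⟨i, hi, rfl⟩ := mem_pts.1 hp
    exact (hf i hi).1
  · rw [hs.card_pts]

theorem leftCount_pts {f : ℕ → ℝ × ℝ} {n : ℕ} (hf : Sorted f n) {i : ℕ} (hi : i < n) :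
    leftCount (pts f n) (f i) = i := by
  have hs : Sorted f i := fun j k hjk hk => hf j k hjk (hk.trans hi)
  have : (pts f n).filter (fun q => q.1 < (f i).1) = pts f i := by
    ext p
    simp only [Finset.mem_filter, mem_pts]
    constructor
    · rintro ⟨⟨j, hj, rfl⟩, h⟩
      exact ⟨j, (hf.lt_iff hj hi).1 h, rfl⟩
    · rintro ⟨j, hj, rfl⟩
      exact ⟨⟨j, hj.trans hi, rfl⟩, (hf.lt_iff (hj.trans hi) hi).2 hj⟩
  have h := congrArg Finset.card this
  rw [hs.card_pts] at h
  unfold leftCount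
  convert h

theorem oddPart_pts {f : ℕ → ℝ × ℝ} {n : ℕ} (hf : Sorted f n) :
    oddPart (pts f n) = pts (fun i => f (2 * i)) ((n + 1) / 2) := by
  ext p
  simp only [oddPart, Finset.mem_filter, mem_pts]
  constructor
  · rintro ⟨⟨j, hj, rfl⟩, h⟩
    rw [leftCount_pts hf hj] at h
    obtain ⟨k, hk⟩ := h
    exact ⟨k, by omega, by congr 1; omega⟩
  · rintro ⟨j, hj, rfl⟩
    have hj' : 2 * j < n := by omega
    refine ⟨⟨2 * j, hj', rfl⟩, ?_⟩
    rw [leftCount_pts hf hj']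
    exact ⟨j, rfl⟩

theorem evenPart_pts {f : ℕ → ℝ × ℝ} {n : ℕ} (hf : Sorted f n) :
    evenPart (pts f n) = pts (fun i => f (2 * i + 1)) (n / 2) := by
  ext p
  simp only [evenPart, Finset.mem_filter, mem_pts]
  constructor
  · rintro ⟨⟨j, hj, rfl⟩, h⟩
    rw [leftCount_pts hf hj] at h
    obtain ⟨k, hk⟩ := h
    exact ⟨k - 1, by omega, by congr 1; omega⟩
  · rintro ⟨j, hj, rfl⟩
    have hj' : 2 * j + 1 < n := by omega
    refine ⟨⟨2 * j + 1, hj', rfl⟩, ?_⟩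
    rw [leftCount_pts hf hj']
    exact ⟨j + 1, by omega⟩

theorem Sorted.even {f : ℕ → ℝ × ℝ} {n : ℕ} (hf : Sorted f n) :
    Sorted (fun i => f (2 * i)) ((n + 1) / 2) := fun i j hij hj =>
  hf _ _ (by omega) (by omega)

theorem Sorted.odd {f : ℕ → ℝ × ℝ} {n : ℕ} (hf : Sorted f n) :
    Sorted (fun i => f (2 * i + 1)) (n / 2) := fun i j hij hj =>
  hf _ _ (by omega) (by omega)

theorem IsHorton.injOn {H : Finset (ℝ × ℝ)} (h : IsHorton H) :
    Set.InjOn Prod.fst (H : Set (ℝ × ℝ)) := by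
  cases h with
  | small _ h =>
    intro p hp q hq _
    exact Finset.card_le_one.1 h p hp q hq
  | step _ _ hx => exact hx

/-- One of the two parts of a Horton set lies deep below the other. -/
theorem IsHorton.deep_pts {f : ℕ → ℝ × ℝ} {n : ℕ} (hf : Sorted f n) (hn : 2 ≤ n)
    (h : IsHorton (pts f n)) :
    IsHorton (pts (fun i => f (2 * i)) ((n + 1) / 2)) ∧
    IsHorton (pts (fun i => f (2 * i + 1)) (n / 2)) ∧
    (Deep 1 (pts (fun i => f (2 * i)) ((n + 1) / 2)) (pts (fun i => f (2 * i + 1)) (n / 2)) ∨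
      Deep 1 (pts (fun i => f (2 * i + 1)) (n / 2)) (pts (fun i => f (2 * i)) ((n + 1) / 2))) := by
  cases h with
  | small _ h => rw [hf.card_pts] at h; omega
  | step _ _ _ h₀ h₁ hd =>
    rw [oddPart_pts hf] at h₀ hd
    rw [evenPart_pts hf] at h₁ hd
    exact ⟨h₀, h₁, hd.imp DeepBelow.deep DeepBelow.deep⟩

/-- A division of `X` into two alternating parts, one deep below the other. -/
structure IsSplit (σ : ℝ) (X L U : Finset (ℝ × ℝ)) : Prop where
  union : L ∪ U = X
  disj : Disjoint L U
  deep : Deep σ L U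
  altL : ∀ x ∈ L, ∀ y ∈ X, ∀ p ∈ X, (x.1 < p.1 → p.1 < y.1 → ∃ u ∈ U, x.1 < u.1 ∧ u.1 < y.1) ∧
    (y.1 < p.1 → p.1 < x.1 → ∃ u ∈ U, y.1 < u.1 ∧ u.1 < x.1)
  altU : ∀ x ∈ U, ∀ y ∈ X, ∀ p ∈ X, (x.1 < p.1 → p.1 < y.1 → ∃ u ∈ L, x.1 < u.1 ∧ u.1 < y.1) ∧
    (y.1 < p.1 → p.1 < x.1 → ∃ u ∈ L, y.1 < u.1 ∧ u.1 < x.1)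
  cardL : L.card ≤ (X.card + 1) / 2
  cardU : U.card ≤ (X.card + 1) / 2

theorem IsSplit.swap {σ : ℝ} {X L U : Finset (ℝ × ℝ)} (h : IsSplit σ X L U) :
    IsSplit (-σ) X U L :=
  ⟨by rw [Finset.union_comm]; exact h.union, h.disj.symm, h.deep.swap, h.altU, h.altL, h.cardU,
    h.cardL⟩

theorem isSplit_pts {f : ℕ → ℝ × ℝ} {n : ℕ} (hf : Sorted f n) {σ : ℝ}
    (hd : Deep σ (pts (fun i => f (2 * i)) ((n + 1) / 2)) (pts (fun i => f (2 * i + 1)) (n / 2))) :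
    IsSplit σ (pts f n) (pts (fun i => f (2 * i)) ((n + 1) / 2))
      (pts (fun i => f (2 * i + 1)) (n / 2)) where
  union := by
    ext p
    simp only [Finset.mem_union, mem_pts]
    constructor
    · rintro (⟨i, hi, rfl⟩ | ⟨i, hi, rfl⟩)
      · exact ⟨2 * i, by omega, rfl⟩
      · exact ⟨2 * i + 1, by omega, rfl⟩
    · rintro ⟨i, hi, rfl⟩
      rcases Nat.even_or_odd' i with ⟨k, rfl | rfl⟩
      · exact Or.inl ⟨k, by omega, rfl⟩
      · exact Or.inr ⟨k, by omega, rfl⟩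
  disj := by
    rw [Finset.disjoint_left]
    intro p hp hq
    obtain ⟨i, hi, rfl⟩ := mem_pts.1 hp
    obtain ⟨j, hj, h⟩ := mem_pts.1 hq
    have := hf.inj (i := 2 * j + 1) (j := 2 * i) (by omega) (by omega) (by simp only [h])
    omega
  deep := hd
  altL := by
    intro x hx y hy p hp
    obtain ⟨i, hi, rfl⟩ := mem_pts.1 hx
    obtain ⟨j, hj, rfl⟩ := mem_pts.1 hy
    obtain ⟨k, hk, rfl⟩ := mem_pts.1 hp
    have hi' : 2 * i < n := by omega
    constructor
    · intro h1 h2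
      have h1 := (hf.lt_iff hi' hk).1 h1
      have h2 := (hf.lt_iff hk hj).1 h2
      exact ⟨_, mem_pts.2 ⟨i, by omega, rfl⟩, hf _ _ (by omega) (by omega),
        hf _ _ (by omega) (by omega)⟩
    · intro h1 h2
      have h1 := (hf.lt_iff hj hk).1 h1
      have h2 := (hf.lt_iff hk hi').1 h2
      exact ⟨_, mem_pts.2 ⟨i - 1, by omega, rfl⟩, hf _ _ (by omega) (by omega),
        hf _ _ (by omega) (by omega)⟩
  altU := by
    intro x hx y hy p hp
    obtain ⟨i, hi, rfl⟩ := mem_pts.1 hx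
    obtain ⟨j, hj, rfl⟩ := mem_pts.1 hy
    obtain ⟨k, hk, rfl⟩ := mem_pts.1 hp
    have hi' : 2 * i + 1 < n := by omega
    constructor
    · intro h1 h2
      have h1 := (hf.lt_iff hi' hk).1 h1
      have h2 := (hf.lt_iff hk hj).1 h2
      exact ⟨_, mem_pts.2 ⟨i + 1, by omega, rfl⟩, hf _ _ (by omega) (by omega),
        hf _ _ (by omega) (by omega)⟩
    · intro h1 h2
      have h1 := (hf.lt_iff hj hk).1 h1
      have h2 := (hf.lt_iff hk hi').1 h2
      exact ⟨_, mem_pts.2 ⟨i, by omega, rfl⟩, hf _ _ (by omega) (by omega),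
        hf _ _ (by omega) (by omega)⟩
  cardL := by rw [hf.even.card_pts, hf.card_pts]
  cardU := by rw [hf.odd.card_pts, hf.card_pts]; omega

/-- Induction over Horton sets, along the division into lower and upper part. -/
theorem IsHorton.split_induction {motive : Finset (ℝ × ℝ) → Prop}
    (small : ∀ X : Finset (ℝ × ℝ), X.card ≤ 1 → motive X)
    (step : ∀ X L U : Finset (ℝ × ℝ), 2 ≤ X.card → IsHorton X → IsHorton L → IsHorton U →
      IsSplit 1 X L U → motive L → motive U → motive X)
    {H : Finset (ℝ × ℝ)} (h : IsHorton H) : motive H := by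
  induction h with
  | small H h => exact small H h
  | step H h hx h₀ h₁ hd ih₀ ih₁ =>
    obtain ⟨f, hf, hH⟩ := exists_sorted H hx
    have hH' : IsHorton H := IsHorton.step H h hx h₀ h₁ hd
    have e₀ : oddPart H = pts (fun i => f (2 * i)) ((H.card + 1) / 2) := by
      rw [← oddPart_pts hf, hH]
    have e₁ : evenPart H = pts (fun i => f (2 * i + 1)) (H.card / 2) := by
      rw [← evenPart_pts hf, hH]
    rcases hd with hd | hd
    · refine step H _ _ h hH' h₀ h₁ ?_ ih₀ ih₁
      have := hd.deep
      rw [e₀, e₁] at this ⊢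
      have := isSplit_pts hf this
      rwa [hH] at this
    · refine step H _ _ h hH' h₁ h₀ ?_ ih₁ ih₀
      -- `isSplit_pts` lists the points of even 0-based index first, so when these form the upper
      -- part the split is built with `σ = -1` and swapped back.
      have := hd.deep.swap
      rw [e₀, e₁] at this
      have := (isSplit_pts hf this).swap
      rw [hH, neg_neg] at this
      rwa [e₀, e₁]

theorem orient_ne_zero_of_deep {σ : ℝ} {L U : Finset (ℝ × ℝ)} (hd : Deep σ L U)
    (hx : Set.InjOn Prod.fst (L : Set (ℝ × ℝ))) {a b c : ℝ × ℝ} (ha : a ∈ L) (hb : b ∈ L)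
    (hc : c ∈ U) (hab : a ≠ b) : orient a b c ≠ 0 := by
  have h : a.1 ≠ b.1 := fun h => hab (hx ha hb h)
  intro h0
  rcases lt_or_gt_of_ne h with h | h
  · have := hd.1 a ha b hb c hc h
    rw [h0, mul_zero] at this; exact lt_irrefl _ this
  · have := hd.1 b hb a ha c hc h
    rw [orient_swap, h0, neg_zero, mul_zero] at this; exact lt_irrefl _ this

/-- Horton sets are in general position. -/
theorem IsHorton.genPos {H : Finset (ℝ × ℝ)} (h : IsHorton H) : GenPos H := by
  refine h.split_induction (motive := GenPos) ?_ ?_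
  · intro X hX a ha b hb c hc hab
    exact absurd (Finset.card_le_one.1 hX a ha b hb) hab
  · intro X L U _ _ hL hU hs ihL ihU a ha b hb c hc hab hac hbc
    rw [← hs.union, Finset.mem_union] at ha hb hc
    have kL := fun {a b c : ℝ × ℝ} => orient_ne_zero_of_deep (a := a) (b := b) (c := c)
      hs.deep hL.injOn
    have kU := fun {a b c : ℝ × ℝ} => orient_ne_zero_of_deep (a := a) (b := b) (c := c)
      hs.deep.swap hU.injOn
    rcases ha with ha | ha <;> rcases hb with hb | hb <;> rcases hc with hc | hc
    · exact ihL a ha b hb c hc hab hac hbc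
    · exact kL ha hb hc hab
    · rw [orient_rotate c a b]; exact kL hc ha hb hac.symm
    · rw [← orient_rotate a b c]; exact kU hb hc ha hbc
    · rw [← orient_rotate a b c]; exact kL hb hc ha hbc
    · rw [orient_rotate c a b]; exact kU hc ha hb hac.symm
    · exact kU ha hb hc hab
    · exact ihU a ha b hb c hc hab hac hbc

/-! ### The quadratic upper bound -/

open scoped Classical in
/-- The subsets of `X` such that no point of `X` lies above (`σ = 1`) or below (`σ = -1`) a
segment between two points of the subset. -/
noncomputable def cliques (σ : ℝ) (X : Finset (ℝ × ℝ)) : Finset (Finset (ℝ × ℝ)) :=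
  X.powerset.filter fun Q => ∀ a ∈ Q, ∀ b ∈ Q, a.1 < b.1 → InnerFree σ X a b

theorem mem_cliques {σ : ℝ} {X Q : Finset (ℝ × ℝ)} : Q ∈ cliques σ X ↔
    Q ⊆ X ∧ ∀ a ∈ Q, ∀ b ∈ Q, a.1 < b.1 → InnerFree σ X a b := by
  simp [cliques]

open scoped Classical in
/-- The point `x` of `X` together with its neighbours in the left-to-right order. -/
noncomputable def neighbors (X : Finset (ℝ × ℝ)) (x : ℝ × ℝ) : Finset (ℝ × ℝ) :=
  X.filter fun y => ∀ p ∈ X, ¬(x.1 < p.1 ∧ p.1 < y.1) ∧ ¬(y.1 < p.1 ∧ p.1 < x.1)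

theorem mem_neighbors {X : Finset (ℝ × ℝ)} {x y : ℝ × ℝ} : y ∈ neighbors X x ↔
    y ∈ X ∧ ∀ p ∈ X, ¬(x.1 < p.1 ∧ p.1 < y.1) ∧ ¬(y.1 < p.1 ∧ p.1 < x.1) := by
  simp [neighbors]

theorem card_neighbors_le {X : Finset (ℝ × ℝ)} (hx : Set.InjOn Prod.fst (X : Set (ℝ × ℝ)))
    {x : ℝ × ℝ} (hxX : x ∈ X) : (neighbors X x).card ≤ 3 := by
  have hsub : neighbors X x ⊆ ({x} ∪ (neighbors X x).filter (fun y => x.1 < y.1)) ∪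
      (neighbors X x).filter (fun y => y.1 < x.1) := by
    intro y hy
    simp only [Finset.mem_union, Finset.mem_filter, Finset.mem_singleton]
    rcases lt_trichotomy x.1 y.1 with h | h | h
    · exact Or.inl (Or.inr ⟨hy, h⟩)
    · exact Or.inl (Or.inl (hx (mem_neighbors.1 hy).1 hxX h.symm))
    · exact Or.inr ⟨hy, h⟩
  have h1 : ((neighbors X x).filter (fun y => x.1 < y.1)).card ≤ 1 := by
    refine Finset.card_le_one.2 fun y hy z hz => ?_
    rw [Finset.mem_filter, mem_neighbors] at hy hz
    refine hx hy.1.1 hz.1.1 (le_antisymm ?_ ?_)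
    · by_contra h; exact (hy.1.2 z hz.1.1).1 ⟨hz.2, not_le.1 h⟩
    · by_contra h; exact (hz.1.2 y hy.1.1).1 ⟨hy.2, not_le.1 h⟩
  have h2 : ((neighbors X x).filter (fun y => y.1 < x.1)).card ≤ 1 := by
    refine Finset.card_le_one.2 fun y hy z hz => ?_
    rw [Finset.mem_filter, mem_neighbors] at hy hz
    refine hx hy.1.1 hz.1.1 (le_antisymm ?_ ?_)
    · by_contra h; exact (hz.1.2 y hy.1.1).2 ⟨not_le.1 h, hy.2⟩
    · by_contra h; exact (hy.1.2 z hz.1.1).2 ⟨not_le.1 h, hz.2⟩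
  have h3 := Finset.card_le_card hsub
  have h4 := Finset.card_union_le ({x} ∪ (neighbors X x).filter (fun y => x.1 < y.1))
    ((neighbors X x).filter (fun y => y.1 < x.1))
  have h5 := Finset.card_union_le {x} ((neighbors X x).filter (fun y => x.1 < y.1))
  rw [Finset.card_singleton] at h5
  omega

/-- Between `x` in `L` and a point that is not its neighbour there is a point of `U`, and depth puts
it on the forbidden side of the segment, whichever part the other end point belongs to. -/
theorem subset_neighbors_of_mem_cliques {σ : ℝ} {X L U Q : Finset (ℝ × ℝ)}
    (hs : IsSplit σ X L U) (hQ : Q ∈ cliques σ X) {x : ℝ × ℝ} (hxL : x ∈ L) (hxQ : x ∈ Q) :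
    Q ⊆ neighbors X x := by
  rw [mem_cliques] at hQ
  intro y hy
  refine mem_neighbors.2 ⟨hQ.1 hy, fun p hp => ⟨?_, ?_⟩⟩
  · rintro ⟨h1, h2⟩
    obtain ⟨u, hu, hxu, huy⟩ := (hs.altL x hxL y (hQ.1 hy) p hp).1 h1 h2
    have hf := hQ.2 x hxQ y hy (h1.trans h2) u (hs.union ▸ Finset.mem_union_right _ hu) hxu huy
    rcases Finset.mem_union.1 (hs.union.symm ▸ hQ.1 hy : y ∈ L ∪ U) with hyL | hyU
    · linarith [hs.deep.1 x hxL y hyL u hu (h1.trans h2)]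
    · have := hs.deep.2 u hu y hyU x hxL huy
      rw [orient_swap, orient_rotate] at this
      linarith
  · rintro ⟨h1, h2⟩
    obtain ⟨u, hu, hyu, hux⟩ := (hs.altL x hxL y (hQ.1 hy) p hp).2 h1 h2
    have hf := hQ.2 y hy x hxQ (h1.trans h2) u (hs.union ▸ Finset.mem_union_right _ hu) hyu hux
    rcases Finset.mem_union.1 (hs.union.symm ▸ hQ.1 hy : y ∈ L ∪ U) with hyL | hyU
    · linarith [hs.deep.1 y hyL x hxL u hu (h1.trans h2)]
    · have := hs.deep.2 y hyU u hu x hxL hyu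
      rw [orient_swap_right] at this
      linarith

/-- A clique either avoids `L`, and is a clique of `U`, or is a subset of the at most three points
in the neighbourhood of one of its points in `L`. -/
theorem card_cliques_split {σ : ℝ} {X L U : Finset (ℝ × ℝ)}
    (hx : Set.InjOn Prod.fst (X : Set (ℝ × ℝ))) (hs : IsSplit σ X L U) :
    (cliques σ X).card ≤ (cliques σ U).card + L.card * 8 := by
  have hsub : cliques σ X ⊆ cliques σ U ∪ L.biUnion fun x => (neighbors X x).powerset := by
    intro Q hQ
    rw [Finset.mem_union, Finset.mem_biUnion]
    by_cases h : ∃ x ∈ L, x ∈ Q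
    · obtain ⟨x, hxL, hxQ⟩ := h
      exact Or.inr ⟨x, hxL, Finset.mem_powerset.2 (subset_neighbors_of_mem_cliques hs hQ hxL hxQ)⟩
    · left
      have hQ' := mem_cliques.1 hQ
      refine mem_cliques.2 ⟨fun y hy => ?_, fun a ha b hb hab p hp => ?_⟩
      · rcases Finset.mem_union.1 (hs.union.symm ▸ hQ'.1 hy : y ∈ L ∪ U) with h' | h'
        · exact absurd ⟨y, h', hy⟩ h
        · exact h'
      · exact hQ'.2 a ha b hb hab p (hs.union ▸ Finset.mem_union_right _ hp)
  refine (Finset.card_le_card hsub).trans ((Finset.card_union_le _ _).trans ?_)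
  refine Nat.add_le_add_left (Finset.card_biUnion_le_card_mul _ _ _ fun x hxL => ?_) _
  rw [Finset.card_powerset]
  calc 2 ^ (neighbors X x).card ≤ 2 ^ 3 := Nat.pow_le_pow_right (by norm_num)
        (card_neighbors_le hx (hs.union ▸ Finset.mem_union_left _ hxL))
    _ = 8 := by norm_num

/-- For each sign the recursion passes to only one part, of about half the size, at linear cost; the
geometric sum is linear. -/
theorem IsHorton.card_cliques_le {H : Finset (ℝ × ℝ)} (h : IsHorton H) :
    (cliques 1 H).card ≤ 32 * H.card + 2 ∧ (cliques (-1) H).card ≤ 32 * H.card + 2 := by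
  refine h.split_induction (motive := fun H => (cliques 1 H).card ≤ 32 * H.card + 2 ∧
    (cliques (-1) H).card ≤ 32 * H.card + 2) ?_ ?_
  · intro X hX
    have key : ∀ σ, (cliques σ X).card ≤ 32 * X.card + 2 := fun σ => by
      have h1 : (cliques σ X).card ≤ X.powerset.card :=
        Finset.card_le_card fun Q hQ => Finset.mem_powerset.2 (mem_cliques.1 hQ).1
      rw [Finset.card_powerset] at h1
      have h2 : 2 ^ X.card ≤ 2 ^ 1 := Nat.pow_le_pow_right (by norm_num) hX
      omega
    exact ⟨key _, key _⟩
  · intro X L U hX hXH _ _ hs ihL ihU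
    have h1 := card_cliques_split hXH.injOn hs
    have h2 := card_cliques_split hXH.injOn hs.swap
    have h3 := hs.cardL
    have h4 := hs.cardU
    constructor <;> omega

/-! ### Signed sets with only empty triangles -/

/-- The sign function that is `1` exactly on `A`. -/
noncomputable def memSign (A : Finset (ℝ × ℝ)) (p : ℝ × ℝ) : ℝ := if p ∈ A then 1 else -1

theorem memSign_of_mem {A : Finset (ℝ × ℝ)} {p : ℝ × ℝ} (h : p ∈ A) : memSign A p = 1 :=
  if_pos h

theorem memSign_of_notMem {A : Finset (ℝ × ℝ)} {p : ℝ × ℝ} (h : p ∉ A) : memSign A p = -1 :=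
  if_neg h

open scoped Classical in
/-- The pairs of positive and negative parts of signed subsets of `X` all of whose triangles are
empty. -/
noncomputable def signedSets (X : Finset (ℝ × ℝ)) : Finset (Finset (ℝ × ℝ) × Finset (ℝ × ℝ)) :=
  (X.powerset ×ˢ X.powerset).filter fun t => Disjoint t.1 t.2 ∧ 3 ≤ (t.1 ∪ t.2).card ∧
    ∀ a ∈ t.1 ∪ t.2, ∀ b ∈ t.1 ∪ t.2, ∀ c ∈ t.1 ∪ t.2, a ≠ b → a ≠ c → b ≠ c →
      EmptyTri X a b c (memSign t.1 a) (memSign t.1 b) (memSign t.1 c)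

theorem mem_signedSets {X A B : Finset (ℝ × ℝ)} : (A, B) ∈ signedSets X ↔
    (A ⊆ X ∧ B ⊆ X) ∧ Disjoint A B ∧ 3 ≤ (A ∪ B).card ∧
    ∀ a ∈ A ∪ B, ∀ b ∈ A ∪ B, ∀ c ∈ A ∪ B, a ≠ b → a ≠ c → b ≠ c →
      EmptyTri X a b c (memSign A a) (memSign A b) (memSign A c) := by
  simp only [signedSets, Finset.mem_filter, Finset.mem_product, Finset.mem_powerset]

/-- A hole is determined by the positive and the negative part of a signing. The bound on
`signedSets` therefore works for all `k` at once. -/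
theorem planarProjHoles_subset {k : ℕ} (hk : 3 ≤ k) {H : Finset (ℝ × ℝ)} (hgp : GenPos H) :
    planarProjHoles k H ⊆ (fun t : Finset (ℝ × ℝ) × Finset (ℝ × ℝ) =>
      hull (t.1 ∪ t.2) (memSign t.1)) '' (signedSets H : Set _) := by
  classical
  intro G hG
  obtain ⟨I, hIH, s, hs, hcard, rfl, hemp⟩ := exists_of_mem_planarProjHoles hgp hG
  have hun : I.filter (fun p => s p = 1) ∪ I.filter (fun p => ¬s p = 1) = I :=
    Finset.filter_union_filter_not_eq _ _
  have hsign : ∀ p ∈ I, memSign (I.filter (fun p => s p = 1)) p = s p := by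
    intro p hp
    by_cases h : s p = 1
    · rw [memSign_of_mem (Finset.mem_filter.2 ⟨hp, h⟩), h]
    · rw [memSign_of_notMem (fun h' => h (Finset.mem_filter.1 h').2), (hs p).resolve_left h]
  refine ⟨(I.filter (fun p => s p = 1), I.filter (fun p => ¬s p = 1)), ?_, ?_⟩
  · rw [Finset.mem_coe, mem_signedSets, hun, hcard]
    refine ⟨⟨(Finset.filter_subset _ _).trans hIH, (Finset.filter_subset _ _).trans hIH⟩,
      Finset.disjoint_filter_filter_not _ _ _, hk, ?_⟩
    intro a ha b hb c hc hab hac hbc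
    rw [hsign a ha, hsign b hb, hsign c hc]
    exact hemp a ha b hb c hc hab hac hbc
  · simp only [hun]
    exact hull_congr hsign

/-- Two points of `L` of equal sign form with `c` a triangle of the type in `emptyTri_pos_pos` or
`emptyTri_neg_neg`. Which of the two depends only on the sign of `c` relative to theirs, hence is
the same for all pairs of one sign class. -/
theorem inter_mem_cliques {σ : ℝ} (hσ : σ = 1 ∨ σ = -1) {X L U A B : Finset (ℝ × ℝ)}
    (hx : Set.InjOn Prod.fst (X : Set (ℝ × ℝ))) (hs : IsSplit σ X L U)
    (hAB : (A, B) ∈ signedSets X) {c : ℝ × ℝ} (hc : c ∈ A ∪ B) (hcU : c ∈ U) :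
    A ∩ L ∈ cliques 1 L ∪ cliques (-1) L ∧ B ∩ L ∈ cliques 1 L ∪ cliques (-1) L := by
  obtain ⟨-, hdis, -, hemp⟩ := mem_signedSets.1 hAB
  have hLX : L ⊆ X := hs.union ▸ Finset.subset_union_left
  have hUX : U ⊆ X := hs.union ▸ Finset.subset_union_right
  have hL := hx.mono (Finset.coe_subset.2 hLX)
  have hU := hx.mono (Finset.coe_subset.2 hUX)
  have hnA : ∀ p ∈ B, p ∉ A := fun p hp hp' => Finset.disjoint_left.1 hdis hp' hp
  have hcL : ∀ p ∈ L, p ≠ c := fun p hp h => Finset.disjoint_left.1 hs.disj hp (h ▸ hcU)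
  have key : ∀ Q : Finset (ℝ × ℝ), ∀ τ : ℝ, (τ = 1 ∨ τ = -1) → Q ⊆ L → Q ⊆ A ∪ B →
      (∀ p ∈ Q, memSign A p = τ) → Q ∈ cliques 1 L ∪ cliques (-1) L := by
    intro Q τ hτ hQL hQ hsg
    have hemp' : ∀ a ∈ Q, ∀ b ∈ Q, a.1 < b.1 → EmptyTri (L ∪ U) a b c τ τ (memSign A c) := by
      intro a ha b hb hab
      have := hemp a (hQ ha) b (hQ hb) c hc (fun e => by rw [e] at hab; exact lt_irrefl _ hab)
        (hcL a (hQL ha)) (hcL b (hQL hb))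
      rwa [hsg a ha, hsg b hb, ← hs.union] at this
    have hsc : memSign A c = τ ∨ memSign A c = -τ := by
      unfold memSign
      rcases hτ with rfl | rfl <;> split_ifs <;> simp
    have hcl : Q ∈ cliques σ L ∨ Q ∈ cliques (-σ) L := by
      rcases hsc with h | h
      · left
        refine mem_cliques.2 ⟨hQL, fun a ha b hb hab => ?_⟩
        have he := hemp' a ha b hb hab
        rw [h] at he
        rcases hτ with rfl | rfl
        · exact (emptyTri_pos_pos hσ hs.deep hL hU (hQL ha) (hQL hb) hab hcU).1 he
        · have := he.neg
          rw [neg_neg] at this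
          exact (emptyTri_pos_pos hσ hs.deep hL hU (hQL ha) (hQL hb) hab hcU).1 this
      · right
        refine mem_cliques.2 ⟨hQL, fun a ha b hb hab => ?_⟩
        have he := hemp' a ha b hb hab
        rw [h] at he
        rcases hτ with rfl | rfl
        · have := he.neg
          rw [neg_neg] at this
          exact (emptyTri_neg_neg hσ hs.deep hL hU (hQL ha) (hQL hb) hab hcU).1 this
        · rw [neg_neg] at he
          exact (emptyTri_neg_neg hσ hs.deep hL hU (hQL ha) (hQL hb) hab hcU).1 he
    rw [Finset.mem_union]
    rcases hσ with rfl | rfl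
    · exact hcl
    · rw [neg_neg] at hcl; exact hcl.symm
  constructor
  · refine key _ 1 (Or.inl rfl) Finset.inter_subset_right
      (Finset.inter_subset_left.trans Finset.subset_union_left) fun p hp => ?_
    exact memSign_of_mem (Finset.mem_inter.1 hp).1
  · refine key _ (-1) (Or.inr rfl) Finset.inter_subset_right
      (Finset.inter_subset_left.trans Finset.subset_union_right) fun p hp => ?_
    exact memSign_of_notMem (hnA p (Finset.mem_inter.1 hp).1)

open scoped Classical in
/-- The leftmost and the rightmost point of `U`. -/
noncomputable def extremes (U : Finset (ℝ × ℝ)) : Finset (ℝ × ℝ) :=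
  U.filter fun c => (∀ p ∈ U, p.1 ≤ c.1) ∨ (∀ p ∈ U, c.1 ≤ p.1)

theorem card_extremes_le {U : Finset (ℝ × ℝ)} (hx : Set.InjOn Prod.fst (U : Set (ℝ × ℝ))) :
    (extremes U).card ≤ 2 := by
  classical
  have hsub : extremes U ⊆ U.filter (fun c => ∀ p ∈ U, p.1 ≤ c.1) ∪
      U.filter (fun c => ∀ p ∈ U, c.1 ≤ p.1) := by
    intro c hc
    rw [extremes, Finset.mem_filter] at hc
    rw [Finset.mem_union, Finset.mem_filter, Finset.mem_filter]
    exact hc.2.imp (fun h => ⟨hc.1, h⟩) (fun h => ⟨hc.1, h⟩)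
  have h1 : (U.filter (fun c => ∀ p ∈ U, p.1 ≤ c.1)).card ≤ 1 := by
    refine Finset.card_le_one.2 fun a ha b hb => ?_
    rw [Finset.mem_filter] at ha hb
    exact hx ha.1 hb.1 (le_antisymm (hb.2 a ha.1) (ha.2 b hb.1))
  have h2 : (U.filter (fun c => ∀ p ∈ U, c.1 ≤ p.1)).card ≤ 1 := by
    refine Finset.card_le_one.2 fun a ha b hb => ?_
    rw [Finset.mem_filter] at ha hb
    exact hx ha.1 hb.1 (le_antisymm (ha.2 b hb.1) (hb.2 a ha.1))
  have h3 := (Finset.card_le_card hsub).trans (Finset.card_union_le _ _)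
  omega

/-- Two points of `L` of opposite signs together with `c` fall under `emptyTri_neg_pos` or
`emptyTri_pos_neg`, both of which force `c` to be extreme in `U`. -/
theorem inter_eq_empty_of_notMem_extremes {σ : ℝ} (hσ : σ = 1 ∨ σ = -1)
    {X L U A B : Finset (ℝ × ℝ)} (hx : Set.InjOn Prod.fst (X : Set (ℝ × ℝ)))
    (hs : IsSplit σ X L U) (hAB : (A, B) ∈ signedSets X) {c : ℝ × ℝ} (hc : c ∈ A ∪ B)
    (hcU : c ∈ U) (hce : c ∉ extremes U) : A ∩ L = ∅ ∨ B ∩ L = ∅ := by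
  by_contra hcon
  rw [not_or] at hcon
  obtain ⟨a, ha⟩ := Finset.nonempty_iff_ne_empty.2 hcon.1
  obtain ⟨b, hb⟩ := Finset.nonempty_iff_ne_empty.2 hcon.2
  rw [Finset.mem_inter] at ha hb
  obtain ⟨-, hdis, -, hemp⟩ := mem_signedSets.1 hAB
  have hLX : L ⊆ X := hs.union ▸ Finset.subset_union_left
  have hUX : U ⊆ X := hs.union ▸ Finset.subset_union_right
  have hL := hx.mono (Finset.coe_subset.2 hLX)
  have hU := hx.mono (Finset.coe_subset.2 hUX)
  have hcL : ∀ p ∈ L, p ≠ c := fun p hp h => Finset.disjoint_left.1 hs.disj hp (h ▸ hcU)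
  have hab : a ≠ b := fun h => Finset.disjoint_left.1 hdis ha.1 (h ▸ hb.1)
  have hbA : b ∉ A := fun h => Finset.disjoint_left.1 hdis h hb.1
  have hce' : ¬((∀ p ∈ U, p.1 ≤ c.1) ∨ (∀ p ∈ U, c.1 ≤ p.1)) := fun h =>
    hce (by rw [extremes, Finset.mem_filter]; exact ⟨hcU, h⟩)
  have he := hemp a (Finset.mem_union_left _ ha.1) b (Finset.mem_union_right _ hb.1) c hc hab
    (hcL a ha.2) (hcL b hb.2)
  rw [memSign_of_mem ha.1, memSign_of_notMem hbA, ← hs.union] at he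
  have he1 : EmptyTri (L ∪ U) a b c 1 (-1) 1 ∨ EmptyTri (L ∪ U) a b c (-1) 1 1 := by
    by_cases hcA : c ∈ A
    · rw [memSign_of_mem hcA] at he; exact Or.inl he
    · rw [memSign_of_notMem hcA] at he
      have := he.neg
      rw [neg_neg] at this
      exact Or.inr this
  rcases lt_or_gt_of_ne (fun h => hab (hL ha.2 hb.2 h) : a.1 ≠ b.1) with hlt | hlt
  · rcases he1 with he1 | he1
    · exact hce' (Or.inr ((emptyTri_pos_neg hσ hs.deep hL hU ha.2 hb.2 hlt hcU).1 he1).1)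
    · exact hce' (Or.inl ((emptyTri_neg_pos hσ hs.deep hL hU ha.2 hb.2 hlt hcU).1 he1).1)
  · rcases he1 with he1 | he1
    · exact hce' (Or.inl ((emptyTri_neg_pos hσ hs.deep hL hU hb.2 ha.2 hlt hcU).1 he1.swap).1)
    · exact hce' (Or.inr ((emptyTri_pos_neg hσ hs.deep hL hU hb.2 ha.2 hlt hcU).1 he1.swap).1)

theorem mem_signedSets_of_subset {X Y A B : Finset (ℝ × ℝ)} (hYX : Y ⊆ X)
    (hAB : (A, B) ∈ signedSets X) (h : A ∪ B ⊆ Y) : (A, B) ∈ signedSets Y := by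
  obtain ⟨-, hdis, hcard, hemp⟩ := mem_signedSets.1 hAB
  exact mem_signedSets.2 ⟨⟨Finset.subset_union_left.trans h, Finset.subset_union_right.trans h⟩,
    hdis, hcard, fun a ha b hb c hc hab hac hbc => (hemp a ha b hb c hc hab hac hbc).mono hYX⟩

theorem card_signedSets_split {X L U : Finset (ℝ × ℝ)} (hX : IsHorton X) (hL : IsHorton L)
    (hU : IsHorton U) (hs : IsSplit 1 X L U) (hn : 1 ≤ X.card) :
    (signedSets X).card ≤ (signedSets L).card + (signedSets U).card + 166464 * X.card ^ 2 := by
  classical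
  have hLX : L ⊆ X := hs.union ▸ Finset.subset_union_left
  have hUX : U ⊆ X := hs.union ▸ Finset.subset_union_right
  let KL := cliques 1 L ∪ cliques (-1) L
  let KU := cliques 1 U ∪ cliques (-1) U
  have hKL : KL.card ≤ 68 * X.card := by
    have h1 : KL.card ≤ _ := Finset.card_union_le _ _
    have h2 := hL.card_cliques_le
    have h3 := Finset.card_le_card hLX
    omega
  have hKU : KU.card ≤ 68 * X.card := by
    have h1 : KU.card ≤ _ := Finset.card_union_le _ _
    have h2 := hU.card_cliques_le
    have h3 := Finset.card_le_card hUX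
    omega
  let EL := (extremes L).powerset
  let EU := (extremes U).powerset
  have hEL : EL.card ≤ 4 := by
    rw [Finset.card_powerset]
    calc 2 ^ (extremes L).card ≤ 2 ^ 2 :=
          Nat.pow_le_pow_right (by norm_num) (card_extremes_le hL.injOn)
      _ = 4 := by norm_num
  have hEU : EU.card ≤ 4 := by
    rw [Finset.card_powerset]
    calc 2 ^ (extremes U).card ≤ 2 ^ 2 :=
          Nat.pow_le_pow_right (by norm_num) (card_extremes_le hU.injOn)
      _ = 4 := by norm_num
  -- Codes for sets meeting both parts: in `T1` only one sign occurs in each part; in `T2` and `T3`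
  -- only extreme points of `U`, respectively `L`, are used. Their sizes are at most 4, 16 and 16
  -- times `(68 n) ^ 2`, where `n` is the size of `X`, and `36 * 68 ^ 2 = 166464`.
  let T1 := (({∅} ×ˢ KL) ∪ (KL ×ˢ {∅})) ×ˢ (({∅} ×ˢ KU) ∪ (KU ×ˢ {∅}))
  let T2 := (KL ×ˢ KL) ×ˢ (EU ×ˢ EU)
  let T3 := (EL ×ˢ EL) ×ˢ (KU ×ˢ KU)
  have hT1 : T1.card ≤ (2 * (68 * X.card)) * (2 * (68 * X.card)) := by
    rw [Finset.card_product]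
    refine Nat.mul_le_mul ?_ ?_ <;>
    · refine (Finset.card_union_le _ _).trans ?_
      rw [Finset.card_product, Finset.card_product, Finset.card_singleton]
      omega
  have hT2 : T2.card ≤ ((68 * X.card) * (68 * X.card)) * (4 * 4) := by
    rw [Finset.card_product, Finset.card_product, Finset.card_product]
    exact Nat.mul_le_mul (Nat.mul_le_mul hKL hKL) (Nat.mul_le_mul hEU hEU)
  have hT3 : T3.card ≤ (4 * 4) * ((68 * X.card) * (68 * X.card)) := by
    rw [Finset.card_product, Finset.card_product, Finset.card_product]
    exact Nat.mul_le_mul (Nat.mul_le_mul hEL hEL) (Nat.mul_le_mul hKU hKU)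
  let φ : Finset (ℝ × ℝ) × Finset (ℝ × ℝ) →
      (Finset (ℝ × ℝ) × Finset (ℝ × ℝ)) × (Finset (ℝ × ℝ) × Finset (ℝ × ℝ)) :=
    fun t => ((t.1 ∩ L, t.2 ∩ L), (t.1 ∩ U, t.2 ∩ U))
  let M := (signedSets X).filter fun t => ¬t.1 ∪ t.2 ⊆ L ∧ ¬t.1 ∪ t.2 ⊆ U
  have hcover : signedSets X ⊆ (signedSets L ∪ signedSets U) ∪ M := by
    rintro ⟨A, B⟩ h
    simp only [Finset.mem_union]
    by_cases h1 : A ∪ B ⊆ L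
    · exact Or.inl (Or.inl (mem_signedSets_of_subset hLX h h1))
    by_cases h2 : A ∪ B ⊆ U
    · exact Or.inl (Or.inr (mem_signedSets_of_subset hUX h h2))
    exact Or.inr (Finset.mem_filter.2 ⟨h, h1, h2⟩)
  have hM : M.card ≤ ((T1 ∪ T2) ∪ T3).card := by
    refine Finset.card_le_card_of_injOn φ ?_ ?_
    · rintro ⟨A, B⟩ h
      obtain ⟨h, h1, h2⟩ := Finset.mem_filter.1 h
      have hsub : A ∪ B ⊆ L ∪ U := by
        rw [hs.union]
        exact Finset.union_subset (mem_signedSets.1 h).1.1 (mem_signedSets.1 h).1.2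
      obtain ⟨c, hc, hcU⟩ : ∃ c ∈ A ∪ B, c ∈ U := by
        obtain ⟨c, hc, hcL⟩ := Finset.not_subset.1 h1
        exact ⟨c, hc, (Finset.mem_union.1 (hsub hc)).resolve_left hcL⟩
      obtain ⟨d, hd, hdL⟩ : ∃ d ∈ A ∪ B, d ∈ L := by
        obtain ⟨d, hd, hdU⟩ := Finset.not_subset.1 h2
        exact ⟨d, hd, (Finset.mem_union.1 (hsub hd)).resolve_right hdU⟩
      have kL : A ∩ L ∈ KL ∧ B ∩ L ∈ KL :=
        inter_mem_cliques (Or.inl rfl) hX.injOn hs h hc hcU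
      have kU : A ∩ U ∈ KU ∧ B ∩ U ∈ KU :=
        inter_mem_cliques (Or.inr rfl) hX.injOn hs.swap h hd hdL
      rw [Finset.mem_coe, Finset.mem_union, Finset.mem_union]
      by_cases e1 : ∀ c ∈ A ∪ B, c ∈ U → c ∈ extremes U
      · refine Or.inl (Or.inr (Finset.mem_product.2 ⟨Finset.mem_product.2 kL,
          Finset.mem_product.2 ⟨Finset.mem_powerset.2 ?_, Finset.mem_powerset.2 ?_⟩⟩)) <;>
        · intro p hp
          have hp := Finset.mem_inter.1 hp
          exact e1 p (by rw [Finset.mem_union]; tauto) hp.2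
      by_cases e2 : ∀ c ∈ A ∪ B, c ∈ L → c ∈ extremes L
      · refine Or.inr (Finset.mem_product.2 ⟨Finset.mem_product.2 ⟨Finset.mem_powerset.2 ?_,
          Finset.mem_powerset.2 ?_⟩, Finset.mem_product.2 kU⟩) <;>
        · intro p hp
          have hp := Finset.mem_inter.1 hp
          exact e2 p (by rw [Finset.mem_union]; tauto) hp.2
      push Not at e1 e2
      obtain ⟨c', hc', hc'U, hc'e⟩ := e1
      obtain ⟨d', hd', hd'L, hd'e⟩ := e2
      have i1 := inter_eq_empty_of_notMem_extremes (Or.inl rfl) hX.injOn hs h hc' hc'U hc'e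
      have i2 := inter_eq_empty_of_notMem_extremes (Or.inr rfl) hX.injOn hs.swap h hd' hd'L hd'e
      refine Or.inl (Or.inl (Finset.mem_product.2 ⟨?_, ?_⟩))
      · rw [Finset.mem_union, Finset.mem_product, Finset.mem_product, Finset.mem_singleton,
          Finset.mem_singleton]
        exact i1.imp (fun e => ⟨e, kL.2⟩) (fun e => ⟨kL.1, e⟩)
      · rw [Finset.mem_union, Finset.mem_product, Finset.mem_product, Finset.mem_singleton,
          Finset.mem_singleton]
        exact i2.imp (fun e => ⟨e, kU.2⟩) (fun e => ⟨kU.1, e⟩)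
    · rintro ⟨A, B⟩ h ⟨A', B'⟩ h' he
      have hA := (mem_signedSets.1 (Finset.mem_filter.1 h).1).1
      have hA' := (mem_signedSets.1 (Finset.mem_filter.1 h').1).1
      simp only [φ, Prod.mk.injEq] at he
      obtain ⟨⟨e1, e2⟩, e3, e4⟩ := he
      have key : ∀ A A' : Finset (ℝ × ℝ), A ⊆ X → A' ⊆ X → A ∩ L = A' ∩ L → A ∩ U = A' ∩ U →
          A = A' := by
        intro A A' hA hA' eL eU
        rw [← Finset.inter_eq_left.2 hA, ← Finset.inter_eq_left.2 hA', ← hs.union,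
          Finset.inter_union_distrib_left, Finset.inter_union_distrib_left, eL, eU]
      rw [key A A' hA.1 hA'.1 e1 e3, key B B' hA.2 hA'.2 e2 e4]
  have hT : ((T1 ∪ T2) ∪ T3).card ≤ 166464 * X.card ^ 2 := by
    refine (Finset.card_union_le _ _).trans ?_
    have := Finset.card_union_le T1 T2
    nlinarith
  have h1 := (Finset.card_le_card hcover).trans (Finset.card_union_le _ _)
  have h2 := Finset.card_union_le (signedSets L) (signedSets U)
  omega

/-- The two parts are balanced, so their squared sizes add up to about half of the square of the
whole; three times the cost of a single level, `3 * 166464 = 499392`, absorbs the recursion. -/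
theorem IsHorton.card_signedSets_le {H : Finset (ℝ × ℝ)} (h : IsHorton H) :
    (signedSets H).card ≤ 499392 * H.card ^ 2 := by
  refine h.split_induction (motive := fun H => (signedSets H).card ≤ 499392 * H.card ^ 2) ?_ ?_
  · intro X hX
    have : signedSets X = ∅ := by
      rw [Finset.eq_empty_iff_forall_notMem]
      rintro ⟨A, B⟩ h
      obtain ⟨⟨hA, hB⟩, -, h3, -⟩ := mem_signedSets.1 h
      have := Finset.card_le_card (Finset.union_subset hA hB)
      omega
    rw [this]; simp
  · intro X L U hX hXH hL hU hs ihL ihU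
    have h1 := card_signedSets_split hXH hL hU hs (by omega)
    have h2 : L.card + U.card = X.card := by
      rw [← Finset.card_union_of_disjoint hs.disj, hs.union]
    have h3 := hs.cardL
    have h4 := hs.cardU
    have h5 : 2 * (L.card ^ 2 + U.card ^ 2) ≤ X.card ^ 2 + 1 := by
      rw [← h2] at h3 h4 ⊢
      have : L.card = U.card ∨ L.card = U.card + 1 ∨ U.card = L.card + 1 := by omega
      rcases this with e | e | e <;> rw [e] <;> nlinarith
    have h6 : 2 * 2 ≤ X.card ^ 2 := by rw [sq]; exact Nat.mul_le_mul hX hX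
    omega

theorem IsHorton.ncard_planarProjHoles_le {H : Finset (ℝ × ℝ)} (h : IsHorton H) {k : ℕ}
    (hk : 3 ≤ k) : (planarProjHoles k H).Finite ∧
      ((planarProjHoles k H).ncard : ℝ) ≤ 499392 * (H.card : ℝ) ^ 2 := by
  have hsub := planarProjHoles_subset hk h.genPos
  have hfin := (signedSets H).finite_toSet.image fun t : Finset (ℝ × ℝ) × Finset (ℝ × ℝ) =>
      hull (t.1 ∪ t.2) (memSign t.1)
  refine ⟨hfin.subset hsub, ?_⟩
  have h1 := Set.ncard_le_ncard hsub hfin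
  have h2 := Set.ncard_image_le (signedSets H).finite_toSet
    (f := fun t : Finset (ℝ × ℝ) × Finset (ℝ × ℝ) => hull (t.1 ∪ t.2) (memSign t.1))
  rw [Set.ncard_coe_finset] at h2
  exact_mod_cast h1.trans (h2.trans h.card_signedSets_le)

/-! ### The quadratic lower bound -/

/-- Seven points of `H = (L' ∪ U') ∪ U` spanning a projective 7-hole in which exactly the points
of `L'` are negated. -/
structure SevenConfig (L' U' U : Finset (ℝ × ℝ)) (a₁ a₂ a₃ b₁ b₂ b₃ c : ℝ × ℝ) : Prop where
  inj : Set.InjOn Prod.fst ((L' ∪ U' ∪ U : Finset (ℝ × ℝ)) : Set (ℝ × ℝ))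
  disj : Disjoint L' U'
  disjU : Disjoint (L' ∪ U') U
  deep : Deep 1 (L' ∪ U') U
  deep' : Deep 1 L' U'
  ha₁ : a₁ ∈ L'
  ha₂ : a₂ ∈ L'
  ha₃ : a₃ ∈ L'
  hb₁ : b₁ ∈ U'
  hb₂ : b₂ ∈ U'
  hb₃ : b₃ ∈ U'
  hc : c ∈ U
  a₁₂ : a₁.1 < a₂.1
  a₂₃ : a₂.1 < a₃.1
  ab : a₃.1 < b₁.1
  b₁₂ : b₁.1 < b₂.1
  b₂₃ : b₂.1 < b₃.1
  cap : orient a₁ a₂ a₃ < 0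
  cup : 0 < orient b₁ b₂ b₃
  consecA : ∀ p ∈ L', a₁.1 < p.1 → p.1 < a₃.1 → p = a₂
  consecB : ∀ p ∈ U', b₁.1 < p.1 → p.1 < b₃.1 → p = b₂
  right : ∀ p ∈ U, p.1 ≤ c.1

namespace SevenConfig

variable {L' U' U : Finset (ℝ × ℝ)} {a₁ a₂ a₃ b₁ b₂ b₃ c : ℝ × ℝ}

/-- The sign function of the 7-hole. -/
noncomputable def sign (L' : Finset (ℝ × ℝ)) (p : ℝ × ℝ) : ℝ := if p ∈ L' then -1 else 1

theorem isSign_sign (L' : Finset (ℝ × ℝ)) : IsSign (sign L') := fun p => by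
  unfold sign; split_ifs <;> simp

/-- The set of the seven points. -/
def sevenSet (a₁ a₂ a₃ b₁ b₂ b₃ c : ℝ × ℝ) : Set (ℝ × ℝ) := {a₁, a₂, a₃, b₁, b₂, b₃, c}

theorem forall_seven {P : ℝ × ℝ → Prop} (h1 : P a₁) (h2 : P a₂) (h3 : P a₃) (h4 : P b₁)
    (h5 : P b₂) (h6 : P b₃) (h7 : P c) : ∀ p ∈ sevenSet a₁ a₂ a₃ b₁ b₂ b₃ c, P p := by
  intro p hp
  simp only [sevenSet, Set.mem_insert_iff, Set.mem_singleton_iff] at hp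
  rcases hp with rfl | rfl | rfl | rfl | rfl | rfl | rfl <;> assumption

theorem signs (h : SevenConfig L' U' U a₁ a₂ a₃ b₁ b₂ b₃ c) :
    sign L' a₁ = -1 ∧ sign L' a₂ = -1 ∧ sign L' a₃ = -1 ∧ sign L' b₁ = 1 ∧
    sign L' b₂ = 1 ∧ sign L' b₃ = 1 ∧ sign L' c = 1 := by
  have hU : ∀ p ∈ U', p ∉ L' := fun p hp hp' => Finset.disjoint_left.1 h.disj hp' hp
  have hc : c ∉ L' := fun hp => Finset.disjoint_left.1 h.disjU (Finset.mem_union_left _ hp) h.hc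
  exact ⟨if_pos h.ha₁, if_pos h.ha₂, if_pos h.ha₃, if_neg (hU _ h.hb₁), if_neg (hU _ h.hb₂),
    if_neg (hU _ h.hb₃), if_neg hc⟩

/-- The forms belong to the sides of the 7-gon with cyclic order `a₁, a₂, a₃, c, b₁, b₂, b₃`. The
sides `b₁b₂` and `ca₃` share no vertex, so the sum of their forms is strictly positive on the signed
points and provides the half-space. -/
theorem facets (h : SevenConfig L' U' U a₁ a₂ a₃ b₁ b₂ b₃ c) : (∀ p ∈ sevenSet a₁ a₂ a₃ b₁ b₂ b₃ c,
      0 ≤ sign L' p * lineForm a₁ a₂ (vec p) ∧ 0 ≤ sign L' p * lineForm a₂ a₃ (vec p) ∧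
      0 ≤ sign L' p * lineForm b₁ b₂ (vec p) ∧ 0 ≤ sign L' p * lineForm b₂ b₃ (vec p) ∧
      0 ≤ sign L' p * lineForm a₁ b₃ (vec p) ∧ 0 ≤ sign L' p * lineForm c a₃ (vec p) ∧
      0 ≤ sign L' p * lineForm c b₁ (vec p)) ∧
    (∀ p ∈ sevenSet a₁ a₂ a₃ b₁ b₂ b₃ c,
      0 < sign L' p * (lineForm b₁ b₂ + lineForm c a₃) (vec p)) := by
  obtain ⟨s1, s2, s3, s4, s5, s6, s7⟩ := h.signs
  have mA : ∀ {p}, p ∈ L' → p ∈ L' ∪ U' := fun hp => Finset.mem_union_left _ hp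
  have mB : ∀ {p}, p ∈ U' → p ∈ L' ∪ U' := fun hp => Finset.mem_union_right _ hp
  have x1 := h.a₁₂
  have x2 := h.a₂₃
  have x3 := h.ab
  have x4 := h.b₁₂
  have x5 := h.b₂₃
  have hcap := h.cap
  have hcup := h.cup
  have hLC : ∀ p ∈ L' ∪ U', ∀ q ∈ L' ∪ U', p.1 < q.1 → 0 < orient p q c := fun p hp q hq hpq => by
    simpa using h.deep.1 p hp q hq c h.hc hpq
  have hA : ∀ p ∈ L', ∀ q ∈ L', ∀ r ∈ U', p.1 < q.1 → 0 < orient p q r := fun p hp q hq r hr hpq =>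
    by simpa using h.deep'.1 p hp q hq r hr hpq
  have hB : ∀ p ∈ U', ∀ q ∈ U', ∀ r ∈ L', p.1 < q.1 → orient p q r < 0 := fun p hp q hq r hr hpq =>
    by simpa using h.deep'.2 p hp q hq r hr hpq
  have hP : ∀ p ∈ L' ∪ U', ∀ q ∈ L' ∪ U', p.1 < q.1 → 0 < orient c p q := fun p hp q hq hpq => by
    rw [← orient_rotate c p q]; exact hLC p hp q hq hpq
  have hN : ∀ p ∈ L' ∪ U', ∀ q ∈ L' ∪ U', q.1 < p.1 → orient c p q < 0 := fun p hp q hq hpq => by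
    rw [orient_swap_right]; linarith [hP q hq p hp hpq]
  have o1 : orient a₂ a₃ a₁ < 0 := by rw [orient_rotate a₁ a₂ a₃]; exact hcap
  have o2 : 0 < orient b₂ b₃ b₁ := by rw [orient_rotate b₁ b₂ b₃]; exact hcup
  have o3 : orient a₁ b₃ a₂ < 0 := by
    rw [orient_swap_right]; linarith [hA a₁ h.ha₁ a₂ h.ha₂ b₃ h.hb₃ x1]
  have o4 : orient a₁ b₃ a₃ < 0 := by
    rw [orient_swap_right]; linarith [hA a₁ h.ha₁ a₃ h.ha₃ b₃ h.hb₃ (by linarith)]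
  have o5 : 0 < orient a₁ b₃ b₁ := by
    rw [orient_swap_right, ← orient_rotate a₁ b₁ b₃]
    linarith [hB b₁ h.hb₁ b₃ h.hb₃ a₁ h.ha₁ (by linarith)]
  have o6 : 0 < orient a₁ b₃ b₂ := by
    rw [orient_swap_right, ← orient_rotate a₁ b₂ b₃]
    linarith [hB b₂ h.hb₂ b₃ h.hb₃ a₁ h.ha₁ (by linarith)]
  have g11 := hA a₁ h.ha₁ a₂ h.ha₂ b₁ h.hb₁ x1
  have g12 := hA a₁ h.ha₁ a₂ h.ha₂ b₂ h.hb₂ x1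
  have g13 := hA a₁ h.ha₁ a₂ h.ha₂ b₃ h.hb₃ x1
  have g14 := hLC a₁ (mA h.ha₁) a₂ (mA h.ha₂) x1
  have g21 := hA a₂ h.ha₂ a₃ h.ha₃ b₁ h.hb₁ x2
  have g22 := hA a₂ h.ha₂ a₃ h.ha₃ b₂ h.hb₂ x2
  have g23 := hA a₂ h.ha₂ a₃ h.ha₃ b₃ h.hb₃ x2
  have g24 := hLC a₂ (mA h.ha₂) a₃ (mA h.ha₃) x2
  have g31 := hB b₁ h.hb₁ b₂ h.hb₂ a₁ h.ha₁ x4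
  have g32 := hB b₁ h.hb₁ b₂ h.hb₂ a₂ h.ha₂ x4
  have g33 := hB b₁ h.hb₁ b₂ h.hb₂ a₃ h.ha₃ x4
  have g34 := hLC b₁ (mB h.hb₁) b₂ (mB h.hb₂) x4
  have g41 := hB b₂ h.hb₂ b₃ h.hb₃ a₁ h.ha₁ x5
  have g42 := hB b₂ h.hb₂ b₃ h.hb₃ a₂ h.ha₂ x5
  have g43 := hB b₂ h.hb₂ b₃ h.hb₃ a₃ h.ha₃ x5
  have g44 := hLC b₂ (mB h.hb₂) b₃ (mB h.hb₃) x5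
  have g54 := hLC a₁ (mA h.ha₁) b₃ (mB h.hb₃) (by linarith)
  have g61 := hN a₃ (mA h.ha₃) a₁ (mA h.ha₁) (by linarith)
  have g62 := hN a₃ (mA h.ha₃) a₂ (mA h.ha₂) (by linarith)
  have g63 := hP a₃ (mA h.ha₃) b₁ (mB h.hb₁) (by linarith)
  have g64 := hP a₃ (mA h.ha₃) b₂ (mB h.hb₂) (by linarith)
  have g65 := hP a₃ (mA h.ha₃) b₃ (mB h.hb₃) (by linarith)
  have g71 := hN b₁ (mB h.hb₁) a₁ (mA h.ha₁) (by linarith)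
  have g72 := hN b₁ (mB h.hb₁) a₂ (mA h.ha₂) (by linarith)
  have g73 := hN b₁ (mB h.hb₁) a₃ (mA h.ha₃) (by linarith)
  have g74 := hP b₁ (mB h.hb₁) b₂ (mB h.hb₂) (by linarith)
  have g75 := hP b₁ (mB h.hb₁) b₃ (mB h.hb₃) (by linarith)
  simp only [LinearMap.add_apply, lineForm_vec]
  constructor
  · apply forall_seven
    · simp only [s1, orient_self_outer]; refine ⟨?_, ?_, ?_, ?_, ?_, ?_, ?_⟩ <;> linarith
    · simp only [s2, orient_self_outer, orient_self_right]
      refine ⟨?_, ?_, ?_, ?_, ?_, ?_, ?_⟩ <;> linarith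
    · simp only [s3, orient_self_right]; refine ⟨?_, ?_, ?_, ?_, ?_, ?_, ?_⟩ <;> linarith
    · simp only [s4, orient_self_outer, orient_self_right]
      refine ⟨?_, ?_, ?_, ?_, ?_, ?_, ?_⟩ <;> linarith
    · simp only [s5, orient_self_outer, orient_self_right]
      refine ⟨?_, ?_, ?_, ?_, ?_, ?_, ?_⟩ <;> linarith
    · simp only [s6, orient_self_right]; refine ⟨?_, ?_, ?_, ?_, ?_, ?_, ?_⟩ <;> linarith
    · simp only [s7, orient_self_outer]; refine ⟨?_, ?_, ?_, ?_, ?_, ?_, ?_⟩ <;> linarith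
  · apply forall_seven
    · rw [s1]; linarith
    · rw [s2]; linarith
    · rw [s3, orient_self_right]; linarith
    · rw [s4, orient_self_outer]; linarith
    · rw [s5, orient_self_right]; linarith
    · rw [s6]; linarith
    · rw [s7, orient_self_outer]; linarith

/-- For each other point of the set, its position exhibits one side form that is negative there and
another that is positive, so neither sign of its lift belongs to the cone. Consecutiveness of the
cap and of the cup excludes the only positions without such a pair. -/
theorem mem_sevenSet_of_mem_hull (h : SevenConfig L' U' U a₁ a₂ a₃ b₁ b₂ b₃ c) {I : Finset (ℝ × ℝ)}
    (hI : (I : Set (ℝ × ℝ)) ⊆ sevenSet a₁ a₂ a₃ b₁ b₂ b₃ c) {p : ℝ × ℝ} (hp : p ∈ L' ∪ U' ∪ U)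
    (hmem : embed p ∈ hull I (sign L')) : p ∈ sevenSet a₁ a₂ a₃ b₁ b₂ b₃ c := by
  by_contra hp7
  obtain ⟨hfac, -⟩ := h.facets
  have key : ∀ f g : (Fin 3 → ℝ) →ₗ[ℝ] ℝ,
      (∀ q ∈ sevenSet a₁ a₂ a₃ b₁ b₂ b₃ c, 0 ≤ sign L' q * f (vec q)) →
      (∀ q ∈ sevenSet a₁ a₂ a₃ b₁ b₂ b₃ c, 0 ≤ sign L' q * g (vec q)) →
      f (vec p) < 0 → 0 < g (vec p) → False := by
    intro f g hf hg hfp hgp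
    rcases mem_hull_functional (vec_ne p) hmem with h' | h'
    · linarith [h' f fun q hq => hf q (hI hq)]
    · linarith [h' g fun q hq => hg q (hI hq)]
  simp only [sevenSet, Set.mem_insert_iff, Set.mem_singleton_iff, not_or] at hp7
  obtain ⟨n1, n2, n3, n4, n5, n6, n7⟩ := hp7
  have mA : ∀ {p}, p ∈ L' → p ∈ L' ∪ U' := fun hp => Finset.mem_union_left _ hp
  have mB : ∀ {p}, p ∈ U' → p ∈ L' ∪ U' := fun hp => Finset.mem_union_right _ hp
  have hinj : ∀ {q}, q ∈ L' ∪ U' → p ≠ q → p.1 ≠ q.1 := fun hq hne e =>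
    hne (h.inj hp (Finset.mem_union_left _ hq) e)
  have x1 := h.a₁₂
  have x2 := h.a₂₃
  have x3 := h.ab
  have x4 := h.b₁₂
  have x5 := h.b₂₃
  rcases Finset.mem_union.1 hp with hp | hpU
  · have hP : ∀ q ∈ L' ∪ U', q.1 < p.1 → 0 < lineForm c q (vec p) := fun q hq hpq => by
      rw [lineForm_vec, ← orient_rotate c q p]
      simpa using h.deep.1 q hq p hp c h.hc hpq
    have hN : ∀ q ∈ L' ∪ U', p.1 < q.1 → lineForm c q (vec p) < 0 := fun q hq hpq => by
      have := h.deep.1 p hp q hq c h.hc hpq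
      rw [lineForm_vec, orient_swap_right, ← orient_rotate c p q]
      linarith
    rcases lt_or_gt_of_ne (hinj (mA h.ha₃) n3) with hlt | hgt
    · have c6 := hN a₃ (mA h.ha₃) hlt
      rcases Finset.mem_union.1 hp with hpL | hpU
      · rcases lt_or_gt_of_ne (hinj (mA h.ha₁) n1) with h1 | h1
        · refine key _ _ (fun q hq => (hfac q hq).2.2.2.2.2.1)
            (fun q hq => (hfac q hq).2.2.2.2.1) c6 ?_
          rw [lineForm_vec, orient_rotate p a₁ b₃]
          simpa using h.deep'.1 p hpL a₁ h.ha₁ b₃ h.hb₃ h1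
        · exact n2 (h.consecA p hpL h1 hlt)
      · refine key _ _ (fun q hq => (hfac q hq).2.2.2.2.2.1)
          (fun q hq => (hfac q hq).1) c6 ?_
        rw [lineForm_vec]
        simpa using h.deep'.1 a₁ h.ha₁ a₂ h.ha₂ p hpU x1
    · have c6 := hP a₃ (mA h.ha₃) hgt
      rcases lt_or_gt_of_ne (hinj (mB h.hb₁) n4) with hlt' | hgt'
      · exact key _ _ (fun q hq => (hfac q hq).2.2.2.2.2.2)
          (fun q hq => (hfac q hq).2.2.2.2.2.1) (hN b₁ (mB h.hb₁) hlt') c6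
      · rcases Finset.mem_union.1 hp with hpL | hpU
        · refine key _ _ (fun q hq => (hfac q hq).2.2.1)
            (fun q hq => (hfac q hq).2.2.2.2.2.1) ?_ c6
          rw [lineForm_vec]
          simpa using h.deep'.2 b₁ h.hb₁ b₂ h.hb₂ p hpL x4
        · rcases lt_or_gt_of_ne (hinj (mB h.hb₃) n6) with h1 | h1
          · exact n5 (h.consecB p hpU hgt' h1)
          · refine key _ _ (fun q hq => (hfac q hq).2.2.2.2.1)
              (fun q hq => (hfac q hq).2.2.2.2.2.1) ?_ c6
            rw [lineForm_vec, ← orient_rotate a₁ b₃ p]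
            simpa using h.deep'.2 b₃ h.hb₃ p hpU a₁ h.ha₁ h1
  · refine key (lineForm c a₃) (lineForm a₁ a₂) (fun q hq => (hfac q hq).2.2.2.2.2.1)
      (fun q hq => (hfac q hq).1) ?_ ?_
    · have hne : p.1 ≠ c.1 := fun e => n7 (h.inj hp (Finset.mem_union_right _ h.hc) e)
      have hlt := lt_of_le_of_ne (h.right p hpU) hne
      have := h.deep.2 p hpU c h.hc a₃ (mA h.ha₃) hlt
      rw [lineForm_vec, orient_rotate p c a₃]
      simpa using this
    · rw [lineForm_vec]
      simpa using h.deep.1 a₁ (mA h.ha₁) a₂ (mA h.ha₂) p hpU x1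

/-- The supporting forms of the 7-gon also support the hull of any subset, and the seven points
themselves lie on these lines. Hence one configuration yields holes of all sizes up to seven. -/
theorem hull_mem (h : SevenConfig L' U' U a₁ a₂ a₃ b₁ b₂ b₃ c) {I : Finset (ℝ × ℝ)}
    (hI : (I : Set (ℝ × ℝ)) ⊆ sevenSet a₁ a₂ a₃ b₁ b₂ b₃ c) (hne : I.Nonempty) :
    hull I (sign L') ∈ planarProjHoles I.card (L' ∪ U' ∪ U) := by
  obtain ⟨hfac, hpos⟩ := h.facets
  have hs := isSign_sign L'
  have hnz : ∀ p q : ℝ × ℝ, p.1 ≠ q.1 → lineForm p q ≠ 0 := by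
    intro p q hpq h0
    have := congrArg (fun g => g ![0, 1, 0]) h0
    simp [lineForm_apply, sub_eq_zero] at this
    exact hpq this.symm
  have mA : ∀ {p}, p ∈ L' → p ∈ L' ∪ U' ∪ U := fun hp =>
    Finset.mem_union_left _ (Finset.mem_union_left _ hp)
  have mB : ∀ {p}, p ∈ U' → p ∈ L' ∪ U' ∪ U := fun hp =>
    Finset.mem_union_left _ (Finset.mem_union_right _ hp)
  have mC : ∀ {p}, p ∈ U → p ∈ L' ∪ U' ∪ U := fun hp => Finset.mem_union_right _ hp
  have hca : c.1 ≠ a₃.1 := fun e => by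
    have := h.inj (mC h.hc) (mA h.ha₃) e
    exact Finset.disjoint_left.1 h.disjU (Finset.mem_union_left _ h.ha₃) (this ▸ h.hc)
  have hface : ∀ p ∈ sevenSet a₁ a₂ a₃ b₁ b₂ b₃ c, ∃ g : (Fin 3 → ℝ) →ₗ[ℝ] ℝ, g ≠ 0 ∧
      g (vec p) = 0 ∧ ∀ q ∈ I, 0 ≤ sign L' q * g (vec q) := by
    apply forall_seven
    · exact ⟨_, hnz a₁ a₂ h.a₁₂.ne, by rw [lineForm_vec, orient_self_outer],
        fun q hq => (hfac q (hI hq)).1⟩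
    · exact ⟨_, hnz a₁ a₂ h.a₁₂.ne, by rw [lineForm_vec, orient_self_right],
        fun q hq => (hfac q (hI hq)).1⟩
    · exact ⟨_, hnz a₂ a₃ h.a₂₃.ne, by rw [lineForm_vec, orient_self_right],
        fun q hq => (hfac q (hI hq)).2.1⟩
    · exact ⟨_, hnz b₁ b₂ h.b₁₂.ne, by rw [lineForm_vec, orient_self_outer],
        fun q hq => (hfac q (hI hq)).2.2.1⟩
    · exact ⟨_, hnz b₁ b₂ h.b₁₂.ne, by rw [lineForm_vec, orient_self_right],
        fun q hq => (hfac q (hI hq)).2.2.1⟩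
    · exact ⟨_, hnz b₂ b₃ h.b₂₃.ne, by rw [lineForm_vec, orient_self_right],
        fun q hq => (hfac q (hI hq)).2.2.2.1⟩
    · exact ⟨_, hnz c a₃ hca, by rw [lineForm_vec, orient_self_outer],
        fun q hq => (hfac q (hI hq)).2.2.2.2.2.1⟩
  have hmemH : ∀ p ∈ sevenSet a₁ a₂ a₃ b₁ b₂ b₃ c, p ∈ L' ∪ U' ∪ U :=
    forall_seven (mA h.ha₁) (mA h.ha₂) (mA h.ha₃) (mB h.hb₁) (mB h.hb₂) (mB h.hb₃) (mC h.hc)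
  refine hull_mem_planarProjHoles hs (fun p hp => hmemH p (hI hp)) ?_
    (fun q hq => hpos q (hI hq)) (fun p hp => hface p (hI hp)) ?_
  · intro h0
    obtain ⟨q, hq⟩ := hne
    have := hpos q (hI hq)
    rw [h0] at this
    simp at this
  · intro p hp _ hint
    have hp7 := h.mem_sevenSet_of_mem_hull hI hp (interior_subset hint)
    obtain ⟨g, hg0, hgp, hg⟩ := hface p hp7
    exact embed_not_mem_interior_hull hs (fun q hq => hpos q (hI hq)) hg hg0 (hpos p hp7) hgp hint

theorem nodup (h : SevenConfig L' U' U a₁ a₂ a₃ b₁ b₂ b₃ c) :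
    [a₁, b₁, c, a₂, a₃, b₂, b₃].Nodup := by
  have hc : ∀ p ∈ L' ∪ U', p ≠ c := fun p hp e => Finset.disjoint_left.1 h.disjU hp (e ▸ h.hc)
  have mA : ∀ {p}, p ∈ L' → p ≠ c := fun hp => hc _ (Finset.mem_union_left _ hp)
  have mB : ∀ {p}, p ∈ U' → p ≠ c := fun hp => hc _ (Finset.mem_union_right _ hp)
  have hlt : ∀ {p q : ℝ × ℝ}, p.1 < q.1 → p ≠ q := fun hpq e => by
    rw [e] at hpq; exact lt_irrefl _ hpq
  have x1 := h.a₁₂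
  have x2 := h.a₂₃
  have x3 := h.ab
  have x4 := h.b₁₂
  have x5 := h.b₂₃
  simp only [List.nodup_cons, List.mem_cons, List.not_mem_nil, or_false, not_or]
  exact ⟨⟨hlt (by linarith), mA h.ha₁, hlt (by linarith), hlt (by linarith), hlt (by linarith),
    hlt (by linarith)⟩, ⟨mB h.hb₁, (hlt (by linarith)).symm, (hlt (by linarith)).symm,
    hlt (by linarith), hlt (by linarith)⟩, ⟨(mA h.ha₂).symm, (mA h.ha₃).symm, (mB h.hb₂).symm,
    (mB h.hb₃).symm⟩, ⟨hlt (by linarith), hlt (by linarith), hlt (by linarith)⟩,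
    ⟨hlt (by linarith), hlt (by linarith)⟩, hlt (by linarith), not_false, List.nodup_nil⟩

end SevenConfig

/-- The division of an enumerated Horton set into lower and upper part. -/
theorem IsHorton.exists_lower_upper {f : ℕ → ℝ × ℝ} {n : ℕ} (hf : Sorted f n) (hn : 2 ≤ n)
    (h : IsHorton (pts f n)) : ∃ ρ ρ' n₀ n₁ : ℕ, ρ + ρ' = 1 ∧ n ≤ 2 * n₀ + ρ ∧ n ≤ 2 * n₁ + ρ' ∧
      2 * n₀ + ρ ≤ n + 1 ∧ 2 * n₁ + ρ' ≤ n + 1 ∧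
      IsHorton (pts (fun i => f (2 * i + ρ)) n₀) ∧ IsHorton (pts (fun i => f (2 * i + ρ')) n₁) ∧
      Deep 1 (pts (fun i => f (2 * i + ρ)) n₀) (pts (fun i => f (2 * i + ρ')) n₁) ∧
      pts (fun i => f (2 * i + ρ)) n₀ ∪ pts (fun i => f (2 * i + ρ')) n₁ = pts f n ∧
      Disjoint (pts (fun i => f (2 * i + ρ)) n₀) (pts (fun i => f (2 * i + ρ')) n₁) := by
  obtain ⟨h₀, h₁, hd | hd⟩ := h.deep_pts hf hn
  · have hs := isSplit_pts hf hd
    exact ⟨0, 1, (n + 1) / 2, n / 2, rfl, by omega, by omega, by omega, by omega, h₀, h₁, hd,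
      hs.union, hs.disj⟩
  · have hs := (isSplit_pts hf hd.swap).swap
    exact ⟨1, 0, n / 2, (n + 1) / 2, rfl, by omega, by omega, by omega, by omega, h₁, h₀, hd,
      hs.union, hs.disj⟩

theorem Sorted.sub {f : ℕ → ℝ × ℝ} {n ρ m : ℕ} (hf : Sorted f n)
    (hm : 2 * m + ρ ≤ n + 1) : Sorted (fun i => f (2 * i + ρ)) m := fun i j hij hj =>
  hf _ _ (by omega) (by omega)

theorem IsHorton.le_ncard_planarProjHoles {H : Finset (ℝ × ℝ)} (hH : IsHorton H) {k : ℕ}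
    (hk : 3 ≤ k) (hk7 : k ≤ 7) (hn : 256 ≤ H.card) :
    1 / 4096 * (H.card : ℝ) ^ 2 ≤ ((planarProjHoles k H).ncard : ℝ) := by
  obtain ⟨e, he, hHe⟩ := exists_sorted H hH.injOn
  obtain ⟨n, hn'⟩ : ∃ n, n = H.card := ⟨_, rfl⟩
  rw [← hn'] at he hHe hn ⊢
  subst hHe
  obtain ⟨τ, τ', m, u, hτ, hm1, hu1, hm2, hu2, hL, hU, hd, hun, hdis⟩ :=
    hH.exists_lower_upper he (by omega)
  have hsU := he.sub hu2
  have hf := he.sub hm2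
  set f := fun i => e (2 * i + τ) with hfdef
  set U := pts (fun i => e (2 * i + τ')) u with hUdef
  obtain ⟨ρ, ρ', m₀, m₁, hρ, h01, h11, h02, h12, hL', hU', hd', hun', hdis'⟩ :=
    hL.exists_lower_upper hf (by omega)
  have hg := hf.sub h02
  have hh := hf.sub h12
  obtain ⟨δ, δ', r₀, r₁, hδ, r01, r11, r02, r12, -, -, hdA, -, -⟩ :=
    hL'.exists_lower_upper hg (by omega)
  obtain ⟨ε, ε', t₀, t₁, hε, t01, t11, t02, t12, -, -, hdB, -, -⟩ :=
    hU'.exists_lower_upper hh (by omega)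
  set L' := pts (fun i => f (2 * i + ρ)) m₀ with hL'def
  set U' := pts (fun i => f (2 * i + ρ')) m₁ with hU'def
  let c := e (2 * (u - 1) + τ')
  -- The shift `1 + δ'` puts the outer points of the triple in the lower part of `L'` and the middle
  -- one in its upper part, giving a cap; the shift `1 + ε` in `B` gives a cup in `U'`. Steps of 4
  -- keep the triples disjoint.
  let A : ℕ → ℕ → ℝ × ℝ := fun i s => f (2 * (4 * i + 1 + δ' + s) + ρ)
  let B : ℕ → ℕ → ℝ × ℝ := fun j s => f (2 * (4 * j + 1 + ε + s) + ρ')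
  have hconf : ∀ i j, i < j → 8 * j + 10 ≤ m →
      SevenConfig L' U' U (A i 0) (A i 1) (A i 2) (B j 0) (B j 1) (B j 2) c := by
    intro i j hij hj
    have memA : ∀ s, s ≤ 2 → A i s ∈ L' := fun s hs =>
      mem_pts.2 ⟨4 * i + 1 + δ' + s, by omega, rfl⟩
    have memB : ∀ s, s ≤ 2 → B j s ∈ U' := fun s hs =>
      mem_pts.2 ⟨4 * j + 1 + ε + s, by omega, rfl⟩
    have lowA : ∀ s, s = 0 ∨ s = 2 → A i s ∈ pts (fun q => f (2 * (2 * q + δ) + ρ)) r₀ := by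
      intro s hs
      refine mem_pts.2 ⟨2 * i + δ' + s / 2, by omega, ?_⟩
      show f _ = f _
      congr 1; omega
    have upA : A i 1 ∈ pts (fun q => f (2 * (2 * q + δ') + ρ)) r₁ := by
      refine mem_pts.2 ⟨2 * i + 1, by omega, ?_⟩
      show f _ = f _
      congr 1; omega
    have upB : ∀ s, s = 0 ∨ s = 2 → B j s ∈ pts (fun q => f (2 * (2 * q + ε') + ρ')) t₁ := by
      intro s hs
      refine mem_pts.2 ⟨2 * j + ε + s / 2, by omega, ?_⟩
      show f _ = f _
      congr 1; omega
    have lowB : B j 1 ∈ pts (fun q => f (2 * (2 * q + ε) + ρ')) t₀ := by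
      refine mem_pts.2 ⟨2 * j + 1, by omega, ?_⟩
      show f _ = f _
      congr 1; omega
    refine ⟨?_, hdis', ?_, ?_, hd', memA 0 (by omega), memA 1 (by omega), memA 2 (by omega),
      memB 0 (by omega), memB 1 (by omega), memB 2 (by omega), ?_, ?_, ?_, ?_, ?_, ?_, ?_, ?_, ?_,
      ?_, ?_⟩
    · rw [hun', hun]; exact he.injOn_pts
    · rw [hun']; exact hdis
    · rw [hun']; exact hd
    · exact mem_pts.2 ⟨u - 1, by omega, rfl⟩
    · exact hf _ _ (by omega) (by omega)
    · exact hf _ _ (by omega) (by omega)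
    · exact hf _ _ (by omega) (by omega)
    · exact hf _ _ (by omega) (by omega)
    · exact hf _ _ (by omega) (by omega)
    · have := hdA.1 _ (lowA 0 (by simp)) _ (lowA 2 (by simp)) _ upA
        (hf _ _ (by omega) (by omega))
      rw [orient_swap_right] at this
      linarith
    · have := hdB.2 _ (upB 0 (by simp)) _ (upB 2 (by simp)) _ lowB
        (hf _ _ (by omega) (by omega))
      rw [orient_swap_right] at this
      linarith
    · intro p hp h1 h2
      obtain ⟨q, hq, rfl⟩ := mem_pts.1 hp
      have h1 := (hg.lt_iff (i := 4 * i + 1 + δ' + 0) (by omega) hq).1 h1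
      have h2 := (hg.lt_iff (j := 4 * i + 1 + δ' + 2) hq (by omega)).1 h2
      show f _ = f _
      congr 1; omega
    · intro p hp h1 h2
      obtain ⟨q, hq, rfl⟩ := mem_pts.1 hp
      have h1 := (hh.lt_iff (i := 4 * j + 1 + ε + 0) (by omega) hq).1 h1
      have h2 := (hh.lt_iff (j := 4 * j + 1 + ε + 2) hq (by omega)).1 h2
      show f _ = f _
      congr 1; omega
    · intro p hp
      obtain ⟨q, hq, rfl⟩ := mem_pts.1 hp
      exact (hsU.le_iff hq (by omega)).2 (by omega)
  -- With `A i 0` and `B j 0` listed first, they survive truncation to any `k ≥ 3`, and they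
  -- identify `i` and `j`.
  let I : ℕ → ℕ → Finset (ℝ × ℝ) := fun i j =>
    (([A i 0, B j 0, c, A i 1, A i 2, B j 1, B j 2] : List (ℝ × ℝ)).take k).toFinset
  have hI7 : ∀ i j, (I i j : Set (ℝ × ℝ)) ⊆
      SevenConfig.sevenSet (A i 0) (A i 1) (A i 2) (B j 0) (B j 1) (B j 2) c := by
    intro i j p hp
    have := List.mem_of_mem_take (List.mem_toFinset.1 hp)
    simp only [List.mem_cons, List.not_mem_nil, or_false] at this
    simp only [SevenConfig.sevenSet, Set.mem_insert_iff, Set.mem_singleton_iff]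
    tauto
  have hA0 : ∀ i j, A i 0 ∈ I i j := by
    intro i j
    rw [List.mem_toFinset]
    interval_cases k <;> simp
  have hB0 : ∀ i j, B j 0 ∈ I i j := by
    intro i j
    rw [List.mem_toFinset]
    interval_cases k <;> simp
  -- Caps take the first `q` blocks and cups the next `q`, so each cap is to the left of each cup.
  -- The last cup fits because `16 * q + 2 ≤ m`.
  obtain ⟨q, hq⟩ : ∃ q, q = (m - 2) / 16 := ⟨_, rfl⟩
  have hholes : ∀ t ∈ Finset.range q ×ˢ Finset.range q,
      hull (I t.1 (q + t.2)) (SevenConfig.sign L') ∈ planarProjHoles k (pts e n) := by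
    rintro ⟨i, j⟩ ht
    simp only [Finset.mem_product, Finset.mem_range] at ht
    have hc := hconf i (q + j) (by omega) (by omega)
    have := hc.hull_mem (hI7 i (q + j)) ⟨_, hA0 _ _⟩
    have hcard : (I i (q + j)).card = k := by
      rw [List.toFinset_card_of_nodup (hc.nodup.sublist (List.take_sublist _ _)),
        List.length_take]
      simp [hk7]
    rw [hcard, hun', hun] at this
    exact this
  have hinj : Set.InjOn (fun t : ℕ × ℕ => hull (I t.1 (q + t.2)) (SevenConfig.sign L'))
      (Finset.range q ×ˢ Finset.range q : Finset (ℕ × ℕ)) := by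
    rintro ⟨i, j⟩ ht ⟨i', j'⟩ ht' heq
    simp only [Finset.coe_product, Set.mem_prod, Finset.coe_range, Set.mem_Iio] at ht ht'
    have hc := hconf i (q + j) (by omega) (by omega)
    have hc' := hconf i' (q + j') (by omega) (by omega)
    simp only at heq
    have hf' : ∀ s t, s < m → t < m → f s = f t → s = t := fun s t hs ht h =>
      hf.inj hs ht (by rw [h])
    have hmem : ∀ p ∈ I i' (q + j'), p ∈ pts f m →
        p ∈ SevenConfig.sevenSet (A i 0) (A i 1) (A i 2) (B (q + j) 0) (B (q + j) 1)
          (B (q + j) 2) c ∧ p ≠ c := by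
      intro p hp hpm
      refine ⟨hc.mem_sevenSet_of_mem_hull (hI7 _ _) ?_ ?_, ?_⟩
      · rw [hun', hun, ← hun]
        exact Finset.mem_union_left _ hpm
      · rw [heq]
        exact embed_mem_hull (SevenConfig.isSign_sign _) hp
      · rintro rfl
        exact Finset.disjoint_left.1 hdis hpm hc.hc
    have hA := hmem _ (hA0 i' (q + j')) (apply_mem_pts (by omega))
    have hB := hmem _ (hB0 i' (q + j')) (apply_mem_pts (by omega))
    simp only [SevenConfig.sevenSet, Set.mem_insert_iff, Set.mem_singleton_iff] at hA hB
    have hA' : i' = i := by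
      obtain ⟨h | h | h | h | h | h | h, hne⟩ := hA
      any_goals have := hf' _ _ (by omega) (by omega) h; omega
      exact absurd h hne
    have hB' : j' = j := by
      obtain ⟨h | h | h | h | h | h | h, hne⟩ := hB
      any_goals have := hf' _ _ (by omega) (by omega) h; omega
      exact absurd h hne
    rw [hA', hB']
  have hfin := (hH.ncard_planarProjHoles_le hk).1
  have hle : q * q ≤ (planarProjHoles k (pts e n)).ncard := by
    have h1 : ((fun t : ℕ × ℕ => hull (I t.1 (q + t.2)) (SevenConfig.sign L')) ''
        (Finset.range q ×ˢ Finset.range q : Finset (ℕ × ℕ))).ncard = q * q := by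
      rw [hinj.ncard_image, Set.ncard_coe_finset, Finset.card_product, Finset.card_range]
    rw [← h1]
    refine Set.ncard_le_ncard ?_ hfin
    rintro _ ⟨t, ht, rfl⟩
    exact hholes t ht
  have hq' : n ≤ 64 * q := by omega
  have hq'' : (n : ℝ) ≤ 64 * q := by exact_mod_cast hq'
  have hle' : (q : ℝ) * q ≤ ((planarProjHoles k (pts e n)).ncard : ℝ) := by exact_mod_cast hle
  have h0 : (0 : ℝ) ≤ n := Nat.cast_nonneg n
  nlinarith

/-! ### Sums over pairs and triples of indices -/

open scoped Classical in
/-- The indicator of a proposition. -/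
noncomputable def ind (P : Prop) : ℤ := if P then 1 else 0

theorem ind_of_true {P : Prop} (h : P) : ind P = 1 := if_pos h

theorem ind_of_false {P : Prop} (h : ¬P) : ind P = 0 := if_neg h

theorem ind_congr {P Q : Prop} (h : P ↔ Q) : ind P = ind Q := by rw [propext h]

/-- The sum of `F i j` over `i < j < n`. -/
def pairSum (F : ℕ → ℕ → ℤ) (n : ℕ) : ℤ :=
  ∑ i ∈ Finset.range n, ∑ j ∈ Finset.range n, if i < j then F i j else 0

/-- The sum of `F i j k` over `i < j < k < n`. -/
def triSum (F : ℕ → ℕ → ℕ → ℤ) (n : ℕ) : ℤ :=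
  ∑ i ∈ Finset.range n, ∑ j ∈ Finset.range n, ∑ k ∈ Finset.range n,
    if i < j ∧ j < k then F i j k else 0

theorem sum_range_two_mul (F : ℕ → ℤ) (m : ℕ) :
    ∑ i ∈ Finset.range (2 * m), F i =
      ∑ i ∈ Finset.range m, F (2 * i) + ∑ i ∈ Finset.range m, F (2 * i + 1) := by
  induction m with
  | zero => simp
  | succ m ih =>
    rw [show 2 * (m + 1) = 2 * m + 1 + 1 by ring, Finset.sum_range_succ, Finset.sum_range_succ, ih,
      Finset.sum_range_succ, Finset.sum_range_succ]
    ring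

theorem pairSum_congr {F G : ℕ → ℕ → ℤ} {n : ℕ} (h : ∀ i j, i < j → j < n → F i j = G i j) :
    pairSum F n = pairSum G n := by
  refine Finset.sum_congr rfl fun i _ => Finset.sum_congr rfl fun j hj => ?_
  split_ifs with hij
  · exact h i j hij (Finset.mem_range.1 hj)
  · rfl

theorem triSum_congr {F G : ℕ → ℕ → ℕ → ℤ} {n : ℕ}
    (h : ∀ i j k, i < j → j < k → k < n → F i j k = G i j k) : triSum F n = triSum G n := by
  refine Finset.sum_congr rfl fun i _ => Finset.sum_congr rfl fun j _ =>
    Finset.sum_congr rfl fun k hk => ?_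
  split_ifs with hij
  · exact h i j k hij.1 hij.2 (Finset.mem_range.1 hk)
  · rfl

theorem pairSum_add (F G : ℕ → ℕ → ℤ) (n : ℕ) :
    pairSum (fun i j => F i j + G i j) n = pairSum F n + pairSum G n := by
  simp only [pairSum, ← Finset.sum_add_distrib]
  refine Finset.sum_congr rfl fun i _ => Finset.sum_congr rfl fun j _ => ?_
  split_ifs <;> simp

theorem pairSum_mul (c : ℤ) (F : ℕ → ℕ → ℤ) (n : ℕ) :
    pairSum (fun i j => c * F i j) n = c * pairSum F n := by
  simp only [pairSum, Finset.mul_sum]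
  refine Finset.sum_congr rfl fun i _ => Finset.sum_congr rfl fun j _ => ?_
  split_ifs <;> simp

theorem triSum_sub (F G : ℕ → ℕ → ℕ → ℤ) (n : ℕ) :
    triSum (fun i j k => F i j k - G i j k) n = triSum F n - triSum G n := by
  simp only [triSum, ← Finset.sum_sub_distrib]
  refine Finset.sum_congr rfl fun i _ => Finset.sum_congr rfl fun j _ =>
    Finset.sum_congr rfl fun k _ => ?_
  split_ifs <;> simp

theorem triSum_zero (n : ℕ) : triSum (fun _ _ _ => 0) n = 0 := by simp [triSum]

theorem pairSum_two_mul (F : ℕ → ℕ → ℤ) (m : ℕ) :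
    pairSum F (2 * m) = pairSum (fun i j => F (2 * i) (2 * j)) m +
      pairSum (fun i j => F (2 * i + 1) (2 * j + 1)) m +
      (∑ i ∈ Finset.range m, ∑ j ∈ Finset.range m, if i ≤ j then F (2 * i) (2 * j + 1) else 0) +
      ∑ i ∈ Finset.range m, ∑ j ∈ Finset.range m, if i < j then F (2 * i + 1) (2 * j) else 0 := by
  unfold pairSum
  simp only [sum_range_two_mul, Finset.sum_add_distrib]
  have e1 : ∀ i j : ℕ, 2 * i < 2 * j ↔ i < j := by omega
  have e2 : ∀ i j : ℕ, 2 * i < 2 * j + 1 ↔ i ≤ j := by omega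
  have e3 : ∀ i j : ℕ, 2 * i + 1 < 2 * j ↔ i < j := by omega
  have e4 : ∀ i j : ℕ, 2 * i + 1 < 2 * j + 1 ↔ i < j := by omega
  simp only [e1, e2, e3, e4]
  ring

/-- Triples are sorted by parity. A mixed triple is grouped under its two indices of equal parity,
and the three branches give the position of the remaining index among them. -/
theorem triSum_two_mul (F : ℕ → ℕ → ℕ → ℤ) (m : ℕ) :
    triSum F (2 * m) = triSum (fun i j k => F (2 * i) (2 * j) (2 * k)) m +
      triSum (fun i j k => F (2 * i + 1) (2 * j + 1) (2 * k + 1)) m +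
      pairSum (fun i j => ∑ k ∈ Finset.range m,
        if j ≤ k then F (2 * i) (2 * j) (2 * k + 1) else
        if i ≤ k then F (2 * i) (2 * k + 1) (2 * j) else F (2 * k + 1) (2 * i) (2 * j)) m +
      pairSum (fun i j => ∑ k ∈ Finset.range m,
        if j < k then F (2 * i + 1) (2 * j + 1) (2 * k) else
        if i < k then F (2 * i + 1) (2 * k) (2 * j + 1) else
          F (2 * k) (2 * i + 1) (2 * j + 1)) m := by
  have e1 : ∀ i j : ℕ, 2 * i < 2 * j ↔ i < j := by omega
  have e2 : ∀ i j : ℕ, 2 * i < 2 * j + 1 ↔ i ≤ j := by omega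
  have e3 : ∀ i j : ℕ, 2 * i + 1 < 2 * j ↔ i < j := by omega
  have e4 : ∀ i j : ℕ, 2 * i + 1 < 2 * j + 1 ↔ i < j := by omega
  have p1 : pairSum (fun i j => ∑ k ∈ Finset.range m,
        if j ≤ k then F (2 * i) (2 * j) (2 * k + 1) else
        if i ≤ k then F (2 * i) (2 * k + 1) (2 * j) else F (2 * k + 1) (2 * i) (2 * j)) m =
      (∑ i ∈ Finset.range m, ∑ j ∈ Finset.range m, ∑ k ∈ Finset.range m,
        if i < j ∧ j ≤ k then F (2 * i) (2 * j) (2 * k + 1) else 0) +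
      (∑ i ∈ Finset.range m, ∑ k ∈ Finset.range m, ∑ j ∈ Finset.range m,
        if i ≤ k ∧ k < j then F (2 * i) (2 * k + 1) (2 * j) else 0) +
      ∑ k ∈ Finset.range m, ∑ i ∈ Finset.range m, ∑ j ∈ Finset.range m,
        if k < i ∧ i < j then F (2 * k + 1) (2 * i) (2 * j) else 0 := by
    have s2 : (∑ i ∈ Finset.range m, ∑ k ∈ Finset.range m, ∑ j ∈ Finset.range m,
        if i ≤ k ∧ k < j then F (2 * i) (2 * k + 1) (2 * j) else 0) =
        ∑ i ∈ Finset.range m, ∑ j ∈ Finset.range m, ∑ k ∈ Finset.range m,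
        if i ≤ k ∧ k < j then F (2 * i) (2 * k + 1) (2 * j) else 0 :=
      Finset.sum_congr rfl fun i _ => Finset.sum_comm
    have s3 : (∑ k ∈ Finset.range m, ∑ i ∈ Finset.range m, ∑ j ∈ Finset.range m,
        if k < i ∧ i < j then F (2 * k + 1) (2 * i) (2 * j) else 0) =
        ∑ i ∈ Finset.range m, ∑ j ∈ Finset.range m, ∑ k ∈ Finset.range m,
        if k < i ∧ i < j then F (2 * k + 1) (2 * i) (2 * j) else 0 := by
      rw [Finset.sum_comm]
      exact Finset.sum_congr rfl fun i _ => Finset.sum_comm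
    rw [s2, s3]
    simp only [pairSum, ← Finset.sum_add_distrib]
    refine Finset.sum_congr rfl fun i _ => Finset.sum_congr rfl fun j _ => ?_
    split_ifs with hij
    · refine Finset.sum_congr rfl fun k _ => ?_
      split_ifs <;> omega
    · symm
      refine Finset.sum_eq_zero fun k _ => ?_
      rw [if_neg (by omega), if_neg (by omega), if_neg (by omega)]
      rfl
  have p2 : pairSum (fun i j => ∑ k ∈ Finset.range m,
        if j < k then F (2 * i + 1) (2 * j + 1) (2 * k) else
        if i < k then F (2 * i + 1) (2 * k) (2 * j + 1) else
          F (2 * k) (2 * i + 1) (2 * j + 1)) m =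
      (∑ i ∈ Finset.range m, ∑ j ∈ Finset.range m, ∑ k ∈ Finset.range m,
        if i < j ∧ j < k then F (2 * i + 1) (2 * j + 1) (2 * k) else 0) +
      (∑ i ∈ Finset.range m, ∑ k ∈ Finset.range m, ∑ j ∈ Finset.range m,
        if i < k ∧ k ≤ j then F (2 * i + 1) (2 * k) (2 * j + 1) else 0) +
      ∑ k ∈ Finset.range m, ∑ i ∈ Finset.range m, ∑ j ∈ Finset.range m,
        if k ≤ i ∧ i < j then F (2 * k) (2 * i + 1) (2 * j + 1) else 0 := by
    have s2 : (∑ i ∈ Finset.range m, ∑ k ∈ Finset.range m, ∑ j ∈ Finset.range m,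
        if i < k ∧ k ≤ j then F (2 * i + 1) (2 * k) (2 * j + 1) else 0) =
        ∑ i ∈ Finset.range m, ∑ j ∈ Finset.range m, ∑ k ∈ Finset.range m,
        if i < k ∧ k ≤ j then F (2 * i + 1) (2 * k) (2 * j + 1) else 0 :=
      Finset.sum_congr rfl fun i _ => Finset.sum_comm
    have s3 : (∑ k ∈ Finset.range m, ∑ i ∈ Finset.range m, ∑ j ∈ Finset.range m,
        if k ≤ i ∧ i < j then F (2 * k) (2 * i + 1) (2 * j + 1) else 0) =
        ∑ i ∈ Finset.range m, ∑ j ∈ Finset.range m, ∑ k ∈ Finset.range m,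
        if k ≤ i ∧ i < j then F (2 * k) (2 * i + 1) (2 * j + 1) else 0 := by
      rw [Finset.sum_comm]
      exact Finset.sum_congr rfl fun i _ => Finset.sum_comm
    rw [s2, s3]
    simp only [pairSum, ← Finset.sum_add_distrib]
    refine Finset.sum_congr rfl fun i _ => Finset.sum_congr rfl fun j _ => ?_
    split_ifs with hij
    · refine Finset.sum_congr rfl fun k _ => ?_
      split_ifs <;> omega
    · symm
      refine Finset.sum_eq_zero fun k _ => ?_
      rw [if_neg (by omega), if_neg (by omega), if_neg (by omega)]
      rfl
  rw [p1, p2]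
  unfold triSum
  simp only [sum_range_two_mul, Finset.sum_add_distrib, e1, e2, e3, e4]
  ring

/-! ### Perfect Horton sets and their pair counts -/

/-- `f` lists, from left to right, a perfect Horton set with `2 ^ z` points. -/
def Perfect : ℕ → (ℕ → ℝ × ℝ) → Prop
  | 0, _ => True
  | z + 1, f => Sorted f (2 * 2 ^ z) ∧ Perfect z (fun i => f (2 * i)) ∧
      Perfect z (fun i => f (2 * i + 1)) ∧
      Deep 1 (pts (fun i => f (2 * i)) (2 ^ z)) (pts (fun i => f (2 * i + 1)) (2 ^ z))

/-- The points with even index lie deep below the points with odd index. -/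
structure Interlaced (f : ℕ → ℝ × ℝ) (m : ℕ) : Prop where
  eeo : ∀ i j k, i < j → j < m → k < m → 0 < orient (f (2 * i)) (f (2 * j)) (f (2 * k + 1))
  ooe : ∀ i j k, i < j → j < m → k < m → orient (f (2 * i + 1)) (f (2 * j + 1)) (f (2 * k)) < 0

theorem Perfect.interlaced {z : ℕ} {f : ℕ → ℝ × ℝ} (h : Perfect (z + 1) f) :
    Interlaced f (2 ^ z) := by
  obtain ⟨hs, -, -, hd⟩ := h
  constructor
  · intro i j k hij hj hk
    have := hd.1 _ (apply_mem_pts (hij.trans hj)) _ (apply_mem_pts hj) _ (apply_mem_pts hk)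
      (hs _ _ (by omega) (by omega))
    simpa using this
  · intro i j k hij hj hk
    have := hd.2 _ (apply_mem_pts (hij.trans hj)) _ (apply_mem_pts hj) _ (apply_mem_pts hk)
      (hs _ _ (by omega) (by omega))
    simpa using this

namespace Interlaced

variable {f : ℕ → ℝ × ℝ} {m i j p : ℕ}

/-- Here and in the following lemmas: the line through an even and an odd point is so steep that the
side of any other point is determined by its horizontal position relative to the point of its own
parity. -/
theorem eoe_lt (h : Interlaced f m) (hi : i < m) (hj : j < m) (hpi : p < i) :
    0 < orient (f (2 * i)) (f (2 * j + 1)) (f (2 * p)) := by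
  rw [orient_rotate (f (2 * p))]; exact h.eeo p i j hpi hi hj

theorem eoe_gt (h : Interlaced f m) (hp : p < m) (hj : j < m) (hpi : i < p) :
    orient (f (2 * i)) (f (2 * j + 1)) (f (2 * p)) < 0 := by
  rw [orient_swap_right]; linarith [h.eeo i p j hpi hp hj]

theorem eoo_lt (h : Interlaced f m) (hi : i < m) (hj : j < m) (hpj : p < j) :
    0 < orient (f (2 * i)) (f (2 * j + 1)) (f (2 * p + 1)) := by
  rw [orient_swap_right, ← orient_rotate]; linarith [h.ooe p j i hpj hj hi]

theorem eoo_gt (h : Interlaced f m) (hi : i < m) (hp : p < m) (hpj : j < p) :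
    orient (f (2 * i)) (f (2 * j + 1)) (f (2 * p + 1)) < 0 := by
  rw [← orient_rotate]; exact h.ooe j p i hpj hp hi

theorem oee_lt (h : Interlaced f m) (hi : i < m) (hj : j < m) (hpj : p < j) :
    orient (f (2 * i + 1)) (f (2 * j)) (f (2 * p)) < 0 := by
  rw [orient_swap_right, ← orient_rotate]; linarith [h.eeo p j i hpj hj hi]

theorem oee_gt (h : Interlaced f m) (hi : i < m) (hp : p < m) (hpj : j < p) :
    0 < orient (f (2 * i + 1)) (f (2 * j)) (f (2 * p)) := by
  rw [← orient_rotate]; exact h.eeo j p i hpj hp hi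

theorem oeo_lt (h : Interlaced f m) (hi : i < m) (hj : j < m) (hpi : p < i) :
    orient (f (2 * i + 1)) (f (2 * j)) (f (2 * p + 1)) < 0 := by
  rw [orient_rotate (f (2 * p + 1))]; exact h.ooe p i j hpi hi hj

theorem oeo_gt (h : Interlaced f m) (hp : p < m) (hj : j < m) (hpi : i < p) :
    0 < orient (f (2 * i + 1)) (f (2 * j)) (f (2 * p + 1)) := by
  rw [orient_swap_right]; linarith [h.ooe i p j hpi hp hj]

end Interlaced

/-- The index form of `InnerFree`. -/
def Inner (σ : ℝ) (f : ℕ → ℝ × ℝ) (i j : ℕ) : Prop :=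
  ∀ p, i < p → p < j → σ * orient (f i) (f j) (f p) ≤ 0

/-- The index form of `OuterFree`. -/
def Outer (σ : ℝ) (f : ℕ → ℝ × ℝ) (n i j : ℕ) : Prop :=
  ∀ p < n, (p < i → 0 ≤ σ * orient (f i) (f j) (f p)) ∧
    (j < p → σ * orient (f i) (f j) (f p) ≤ 0)

theorem innerFree_pts {σ : ℝ} {f : ℕ → ℝ × ℝ} {n i j : ℕ} (hf : Sorted f n) (hij : i < j)
    (hj : j < n) : InnerFree σ (pts f n) (f i) (f j) ↔ Inner σ f i j := by
  constructor
  · intro h p hip hpj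
    exact h _ (apply_mem_pts (hpj.trans hj)) (hf _ _ hip (hpj.trans hj)) (hf _ _ hpj hj)
  · intro h p hp h1 h2
    obtain ⟨q, hq, rfl⟩ := mem_pts.1 hp
    exact h q ((hf.lt_iff (hij.trans hj) hq).1 h1) ((hf.lt_iff hq hj).1 h2)

theorem outerFree_pts {σ : ℝ} {f : ℕ → ℝ × ℝ} {n i j : ℕ} (hf : Sorted f n) (hij : i < j)
    (hj : j < n) : OuterFree σ (pts f n) (f i) (f j) ↔ Outer σ f n i j := by
  constructor
  · intro h p hp
    have := h _ (apply_mem_pts hp)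
    exact ⟨fun h' => this.1 (hf _ _ h' (hij.trans hj)), fun h' => this.2 (hf _ _ h' hp)⟩
  · intro h p hp
    obtain ⟨q, hq, rfl⟩ := mem_pts.1 hp
    exact ⟨fun h' => (h q hq).1 ((hf.lt_iff hq (hij.trans hj)).1 h'),
      fun h' => (h q hq).2 ((hf.lt_iff hj hq).1 h')⟩

/-! ### Parity cases for the inner condition -/

section InnerCases

variable {f : ℕ → ℝ × ℝ} {m i j : ℕ}

theorem inner_one_even_even (h : Interlaced f m) (hij : i < j) (hj : j < m) :
    ¬Inner 1 f (2 * i) (2 * j) := fun hI => by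
  have := hI (2 * i + 1) (by omega) (by omega)
  linarith [h.eeo i j i hij hj (hij.trans hj)]

/-- Even points lie below every line through two odd points, so only the upper part matters and the
condition recurses. Two even points always have a violating odd point between them, and mixed pairs
survive only if adjacent. -/
theorem inner_one_odd_odd (h : Interlaced f m) (hij : i < j) (hj : j < m) :
    Inner 1 f (2 * i + 1) (2 * j + 1) ↔ Inner 1 (fun i => f (2 * i + 1)) i j := by
  constructor
  · intro hI p h1 h2
    exact hI (2 * p + 1) (by omega) (by omega)
  · intro hI p h1 h2
    rcases Nat.even_or_odd' p with ⟨q, rfl | rfl⟩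
    · linarith [h.ooe i j q hij hj (by omega)]
    · exact hI q (by omega) (by omega)

theorem inner_one_even_odd (h : Interlaced f m) (hij : i ≤ j) (hj : j < m) :
    Inner 1 f (2 * i) (2 * j + 1) ↔ i = j := by
  constructor
  · intro hI
    by_contra hne
    have := hI (2 * i + 1) (by omega) (by omega)
    linarith [h.eoo_lt (i := i) (j := j) (p := i) (by omega) hj (by omega)]
  · rintro rfl p h1 h2
    omega

theorem inner_one_odd_even (h : Interlaced f m) (hij : i < j) (hj : j < m) :
    Inner 1 f (2 * i + 1) (2 * j) ↔ j = i + 1 := by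
  constructor
  · intro hI
    by_contra hne
    have := hI (2 * (j - 1) + 1) (by omega) (by omega)
    linarith [h.oeo_gt (i := i) (j := j) (p := j - 1) (by omega) hj (by omega)]
  · rintro rfl p h1 h2
    omega

theorem inner_neg_odd_odd (h : Interlaced f m) (hij : i < j) (hj : j < m) :
    ¬Inner (-1) f (2 * i + 1) (2 * j + 1) := fun hI => by
  have := hI (2 * (i + 1)) (by omega) (by omega)
  linarith [h.ooe i j (i + 1) hij hj (by omega)]

theorem inner_neg_even_even (h : Interlaced f m) (hij : i < j) (hj : j < m) :
    Inner (-1) f (2 * i) (2 * j) ↔ Inner (-1) (fun i => f (2 * i)) i j := by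
  constructor
  · intro hI p h1 h2
    exact hI (2 * p) (by omega) (by omega)
  · intro hI p h1 h2
    rcases Nat.even_or_odd' p with ⟨q, rfl | rfl⟩
    · exact hI q (by omega) (by omega)
    · linarith [h.eeo i j q hij hj (by omega)]

theorem inner_neg_even_odd (h : Interlaced f m) (hij : i ≤ j) (hj : j < m) :
    Inner (-1) f (2 * i) (2 * j + 1) ↔ i = j := by
  constructor
  · intro hI
    by_contra hne
    have := hI (2 * j) (by omega) (by omega)
    linarith [h.eoe_gt (i := i) (j := j) (p := j) hj hj (by omega)]
  · rintro rfl p h1 h2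
    omega

theorem inner_neg_odd_even (h : Interlaced f m) (hij : i < j) (hj : j < m) :
    Inner (-1) f (2 * i + 1) (2 * j) ↔ j = i + 1 := by
  constructor
  · intro hI
    by_contra hne
    have := hI (2 * (i + 1)) (by omega) (by omega)
    linarith [h.oee_lt (i := i) (j := j) (p := i + 1) (by omega) hj (by omega)]
  · rintro rfl p h1 h2
    omega

end InnerCases

theorem sum_adjacent_even_odd (m : ℕ) (F : ℕ → ℕ → ℤ) (c : ℤ)
    (hF : ∀ i j, i ≤ j → j < m → F i j = c * ind (i = j)) :
    (∑ i ∈ Finset.range m, ∑ j ∈ Finset.range m, if i ≤ j then F i j else 0) = c * m := by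
  have : ∀ i ∈ Finset.range m, (∑ j ∈ Finset.range m, if i ≤ j then F i j else 0) = c := by
    intro i hi
    rw [Finset.sum_eq_single i]
    · rw [if_pos le_rfl, hF i i le_rfl (Finset.mem_range.1 hi), ind_of_true rfl, mul_one]
    · intro j hj hne
      split_ifs with h
      · rw [hF i j h (Finset.mem_range.1 hj), ind_of_false (Ne.symm hne), mul_zero]
      · rfl
    · intro h; exact absurd hi h
  rw [Finset.sum_congr rfl this, Finset.sum_const, Finset.card_range, nsmul_eq_mul, mul_comm]

theorem sum_adjacent_odd_even (m : ℕ) (hm : 1 ≤ m) (F : ℕ → ℕ → ℤ) (c : ℤ)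
    (hF : ∀ i j, i < j → j < m → F i j = c * ind (j = i + 1)) :
    (∑ i ∈ Finset.range m, ∑ j ∈ Finset.range m, if i < j then F i j else 0) = c * (m - 1) := by
  obtain ⟨n, rfl⟩ : ∃ n, m = n + 1 := ⟨m - 1, by omega⟩
  have h1 : ∀ i ∈ Finset.range n,
      (∑ j ∈ Finset.range (n + 1), if i < j then F i j else 0) = c := by
    intro i hi
    have hi := Finset.mem_range.1 hi
    rw [Finset.sum_eq_single (i + 1)]
    · rw [if_pos (by omega), hF i (i + 1) (by omega) (by omega), ind_of_true rfl, mul_one]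
    · intro j hj hne
      split_ifs with h
      · rw [hF i j h (Finset.mem_range.1 hj), ind_of_false hne, mul_zero]
      · rfl
    · intro h; exact absurd (Finset.mem_range.2 (by omega)) h
  have h2 : (∑ j ∈ Finset.range (n + 1), if n < j then F n j else 0) = 0 := by
    refine Finset.sum_eq_zero fun j hj => if_neg ?_
    have := Finset.mem_range.1 hj
    omega
  rw [Finset.sum_range_succ, h2, Finset.sum_congr rfl h1, Finset.sum_const, Finset.card_range,
    nsmul_eq_mul]
  push_cast
  ring

/-- The number of pairs satisfying `Inner σ`, weighted by an affine function of the distance. -/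
noncomputable def innerCount (s t : ℤ) (σ : ℝ) (f : ℕ → ℝ × ℝ) (n : ℕ) : ℤ :=
  pairSum (fun i j => (s + t * (j - i)) * ind (Inner σ f i j)) n

/-- Distances inside a part double in the whole set, which replaces `t` by `2 * t`; the other
contribution comes from the `2 * m - 1` adjacent pairs, of distance 1. The affine weight is what
makes this recursion close. -/
theorem innerCount_one_two_mul (s t : ℤ) {f : ℕ → ℝ × ℝ} {m : ℕ} (hm : 1 ≤ m)
    (h : Interlaced f m) : innerCount s t 1 f (2 * m) =
      innerCount s (2 * t) 1 (fun i => f (2 * i + 1)) m + (s + t) * (2 * m - 1) := by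
  unfold innerCount
  rw [pairSum_two_mul,
    sum_adjacent_even_odd m _ (s + t) (fun i j hij hj => by
      rw [ind_congr (inner_one_even_odd h hij hj)]
      by_cases e : i = j
      · subst e; push_cast; ring
      · rw [ind_of_false e]; ring),
    sum_adjacent_odd_even m hm _ (s + t) (fun i j hij hj => by
      rw [ind_congr (inner_one_odd_even h hij hj)]
      by_cases e : j = i + 1
      · subst e; push_cast; ring
      · rw [ind_of_false e]; ring)]
  have e1 : pairSum (fun i j => (s + t * (((2 * j : ℕ) : ℤ) - ((2 * i : ℕ) : ℤ))) *
      ind (Inner 1 f (2 * i) (2 * j))) m = 0 := by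
    rw [pairSum_congr (G := fun _ _ => 0 * 0) (fun i j hij hj => by
      rw [ind_of_false (inner_one_even_even h hij hj)]; ring), pairSum_mul]
    ring
  have e2 : pairSum (fun i j => (s + t * (((2 * j + 1 : ℕ) : ℤ) - ((2 * i + 1 : ℕ) : ℤ))) *
      ind (Inner 1 f (2 * i + 1) (2 * j + 1))) m =
      pairSum (fun i j => (s + 2 * t * (j - i)) * ind (Inner 1 (fun i => f (2 * i + 1)) i j)) m :=
    pairSum_congr fun i j hij hj => by
      rw [ind_congr (inner_one_odd_odd h hij hj)]; push_cast; ring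
  rw [e1, e2]
  ring

theorem innerCount_neg_two_mul (s t : ℤ) {f : ℕ → ℝ × ℝ} {m : ℕ} (hm : 1 ≤ m)
    (h : Interlaced f m) : innerCount s t (-1) f (2 * m) =
      innerCount s (2 * t) (-1) (fun i => f (2 * i)) m + (s + t) * (2 * m - 1) := by
  unfold innerCount
  rw [pairSum_two_mul,
    sum_adjacent_even_odd m _ (s + t) (fun i j hij hj => by
      rw [ind_congr (inner_neg_even_odd h hij hj)]
      by_cases e : i = j
      · subst e; push_cast; ring
      · rw [ind_of_false e]; ring),
    sum_adjacent_odd_even m hm _ (s + t) (fun i j hij hj => by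
      rw [ind_congr (inner_neg_odd_even h hij hj)]
      by_cases e : j = i + 1
      · subst e; push_cast; ring
      · rw [ind_of_false e]; ring)]
  have e1 : pairSum (fun i j => (s + t * (((2 * j + 1 : ℕ) : ℤ) - ((2 * i + 1 : ℕ) : ℤ))) *
      ind (Inner (-1) f (2 * i + 1) (2 * j + 1))) m = 0 := by
    rw [pairSum_congr (G := fun _ _ => 0 * 0) (fun i j hij hj => by
      rw [ind_of_false (inner_neg_odd_odd h hij hj)]; ring), pairSum_mul]
    ring
  have e2 : pairSum (fun i j => (s + t * (((2 * j : ℕ) : ℤ) - ((2 * i : ℕ) : ℤ))) *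
      ind (Inner (-1) f (2 * i) (2 * j))) m =
      pairSum (fun i j => (s + 2 * t * (j - i)) * ind (Inner (-1) (fun i => f (2 * i)) i j)) m :=
    pairSum_congr fun i j hij hj => by
      rw [ind_congr (inner_neg_even_even h hij hj)]; push_cast; ring
  rw [e1, e2]
  ring

theorem Perfect.innerCount_eq {z : ℕ} {f : ℕ → ℝ × ℝ} (h : Perfect z f) {σ : ℝ}
    (hσ : σ = 1 ∨ σ = -1) (s t : ℤ) : innerCount s t σ f (2 ^ z) =
      s * (2 * 2 ^ z - 2 - z) + t * (z * 2 ^ z - 2 ^ z + 1) := by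
  induction z generalizing f s t with
  | zero => simp [innerCount, pairSum]
  | succ z ih =>
    have hI := h.interlaced
    obtain ⟨-, h0, h1, -⟩ := h
    rw [show (2 : ℕ) ^ (z + 1) = 2 * 2 ^ z by ring]
    rcases hσ with rfl | rfl
    · rw [innerCount_one_two_mul s t Nat.one_le_two_pow hI, ih h1]
      push_cast; ring
    · rw [innerCount_neg_two_mul s t Nat.one_le_two_pow hI, ih h0]
      push_cast; ring

/-! ### Outer pair counts -/

/-- All points to the right of `j` lie weakly above the line through the points `0` and `j`. -/
def RightOf (f : ℕ → ℝ × ℝ) (n j : ℕ) : Prop :=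
  0 < j ∧ ∀ p, j < p → p < n → 0 ≤ orient (f 0) (f j) (f p)

/-- All points to the left of `i` lie weakly below the line through the points `i` and
`n - 1`. -/
def LeftOf (f : ℕ → ℝ × ℝ) (n i : ℕ) : Prop :=
  i < n - 1 ∧ ∀ p, p < i → orient (f i) (f (n - 1)) (f p) ≤ 0

section OuterCases

variable {f : ℕ → ℝ × ℝ} {m i j : ℕ}

theorem outer_one_even_even (h : Interlaced f m) (hij : i < j) (hj : j < m) :
    ¬Outer 1 f (2 * m) (2 * i) (2 * j) := fun hO => by
  have := (hO (2 * (m - 1) + 1) (by omega)).2 (by omega)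
  linarith [h.eeo i j (m - 1) hij hj (by omega)]

theorem outer_one_odd_odd (h : Interlaced f m) (hij : i < j) (hj : j < m) :
    ¬Outer 1 f (2 * m) (2 * i + 1) (2 * j + 1) := fun hO => by
  have := (hO (2 * 0) (by omega)).1 (by omega)
  linarith [h.ooe i j 0 hij hj (by omega)]

/-- The steep line from an even point to an odd point on its right leaves everything to the left
above it and everything to the right below it. For a pair from odd to even the two sides are
exchanged, as in `outer_neg_odd_even`. -/
theorem outer_one_even_odd (h : Interlaced f m) (hij : i ≤ j) (hj : j < m) :
    Outer 1 f (2 * m) (2 * i) (2 * j + 1) := by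
  intro p hp
  rcases Nat.even_or_odd' p with ⟨q, rfl | rfl⟩
  · refine ⟨fun h' => ?_, fun h' => ?_⟩
    · linarith [h.eoe_lt (i := i) (j := j) (p := q) (by omega) hj (by omega)]
    · linarith [h.eoe_gt (i := i) (j := j) (p := q) (by omega) hj (by omega)]
  · refine ⟨fun h' => ?_, fun h' => ?_⟩
    · linarith [h.eoo_lt (i := i) (j := j) (p := q) (by omega) hj (by omega)]
    · linarith [h.eoo_gt (i := i) (j := j) (p := q) (by omega) (by omega) (by omega)]

theorem outer_one_odd_even (h : Interlaced f m) (hij : i < j) (hj : j < m) :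
    ¬Outer 1 f (2 * m) (2 * i + 1) (2 * j) := fun hO => by
  have := (hO (2 * 0) (by omega)).1 (by omega)
  linarith [h.oee_lt (i := i) (j := j) (p := 0) (by omega) hj (by omega)]

/-- Every odd point is above the line. This is harmless to the right of `2 * j`, but it forbids odd
points to the left of `2 * i`, so `i = 0`; the even points on the right then give the condition
within the lower part. -/
theorem outer_neg_even_even (h : Interlaced f m) (hij : i < j) (hj : j < m) :
    Outer (-1) f (2 * m) (2 * i) (2 * j) ↔ i = 0 ∧ RightOf (fun i => f (2 * i)) m j := by
  constructor
  · intro hO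
    have hi : i = 0 := by
      by_contra hi
      have := (hO (2 * 0 + 1) (by omega)).1 (by omega)
      linarith [h.eeo i j 0 hij hj (by omega)]
    subst hi
    refine ⟨rfl, by omega, fun p h1 h2 => ?_⟩
    have := (hO (2 * p) (by omega)).2 (by omega)
    linarith
  · rintro ⟨rfl, -, hR⟩ p hp
    refine ⟨fun h' => by omega, fun h' => ?_⟩
    rcases Nat.even_or_odd' p with ⟨q, rfl | rfl⟩
    · linarith [hR q (by omega) (by omega)]
    · linarith [h.eeo 0 j q hij hj (by omega)]

theorem outer_neg_odd_odd (h : Interlaced f m) (hij : i < j) (hj : j < m) :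
    Outer (-1) f (2 * m) (2 * i + 1) (2 * j + 1) ↔
      j = m - 1 ∧ LeftOf (fun i => f (2 * i + 1)) m i := by
  constructor
  · intro hO
    have hj' : j = m - 1 := by
      by_contra hi
      have := (hO (2 * (m - 1)) (by omega)).2 (by omega)
      linarith [h.ooe i j (m - 1) hij hj (by omega)]
    subst hj'
    refine ⟨rfl, by omega, fun p h1 => ?_⟩
    have := (hO (2 * p + 1) (by omega)).1 (by omega)
    linarith
  · rintro ⟨rfl, -, hR⟩ p hp
    refine ⟨fun h' => ?_, fun h' => by omega⟩
    rcases Nat.even_or_odd' p with ⟨q, rfl | rfl⟩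
    · linarith [h.ooe i (m - 1) q hij hj (by omega)]
    · linarith [hR q (by omega)]

theorem outer_neg_even_odd (h : Interlaced f m) (hij : i ≤ j) (hj : j < m) :
    Outer (-1) f (2 * m) (2 * i) (2 * j + 1) ↔ i = 0 ∧ j = m - 1 := by
  constructor
  · intro hO
    constructor
    · by_contra hi
      have := (hO (2 * 0) (by omega)).1 (by omega)
      linarith [h.eoe_lt (i := i) (j := j) (p := 0) (by omega) hj (by omega)]
    · by_contra hi
      have := (hO (2 * (m - 1)) (by omega)).2 (by omega)
      linarith [h.eoe_gt (i := i) (j := j) (p := m - 1) (by omega) hj (by omega)]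
  · rintro ⟨rfl, rfl⟩ p hp
    exact ⟨fun h' => by omega, fun h' => by omega⟩

theorem outer_neg_odd_even (h : Interlaced f m) (hij : i < j) (hj : j < m) :
    Outer (-1) f (2 * m) (2 * i + 1) (2 * j) := by
  intro p hp
  rcases Nat.even_or_odd' p with ⟨q, rfl | rfl⟩
  · refine ⟨fun h' => ?_, fun h' => ?_⟩
    · linarith [h.oee_lt (i := i) (j := j) (p := q) (by omega) hj (by omega)]
    · linarith [h.oee_gt (i := i) (j := j) (p := q) (by omega) (by omega) (by omega)]
  · refine ⟨fun h' => ?_, fun h' => ?_⟩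
    · linarith [h.oeo_lt (i := i) (j := j) (p := q) (by omega) hj (by omega)]
    · linarith [h.oeo_gt (i := i) (j := j) (p := q) (by omega) hj (by omega)]

theorem rightOf_even (h : Interlaced f m) (hj : j < m) :
    RightOf f (2 * m) (2 * j) ↔ RightOf (fun i => f (2 * i)) m j := by
  constructor
  · rintro ⟨h0, hR⟩
    exact ⟨by omega, fun p h1 h2 => hR (2 * p) (by omega) (by omega)⟩
  · rintro ⟨h0, hR⟩
    refine ⟨by omega, fun p h1 h2 => ?_⟩
    rcases Nat.even_or_odd' p with ⟨q, rfl | rfl⟩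
    · exact hR q (by omega) (by omega)
    · exact (h.eeo 0 j q h0 hj (by omega)).le

theorem rightOf_odd (h : Interlaced f m) (hj : j < m) :
    RightOf f (2 * m) (2 * j + 1) ↔ j = m - 1 := by
  constructor
  · rintro ⟨-, hR⟩
    by_contra hne
    have := hR (2 * (m - 1)) (by omega) (by omega)
    linarith [h.eoe_gt (i := 0) (j := j) (p := m - 1) (by omega) hj (by omega)]
  · rintro rfl
    exact ⟨by omega, fun p h1 h2 => by omega⟩

theorem leftOf_odd (h : Interlaced f m) (hi : i < m) :
    LeftOf f (2 * m) (2 * i + 1) ↔ LeftOf (fun i => f (2 * i + 1)) m i := by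
  have e : 2 * m - 1 = 2 * (m - 1) + 1 := by omega
  unfold LeftOf
  rw [e]
  constructor
  · rintro ⟨h0, hR⟩
    exact ⟨by omega, fun p h1 => hR (2 * p + 1) (by omega)⟩
  · rintro ⟨h0, hR⟩
    refine ⟨by omega, fun p h1 => ?_⟩
    rcases Nat.even_or_odd' p with ⟨q, rfl | rfl⟩
    · exact (h.ooe i (m - 1) q h0 (by omega) (by omega)).le
    · exact hR q (by omega)

theorem leftOf_even (h : Interlaced f m) (hi : i < m) :
    LeftOf f (2 * m) (2 * i) ↔ i = 0 := by
  have e : 2 * m - 1 = 2 * (m - 1) + 1 := by omega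
  unfold LeftOf
  rw [e]
  constructor
  · rintro ⟨-, hR⟩
    by_contra hne
    have := hR (2 * 0) (by omega)
    linarith [h.eoe_lt (i := i) (j := m - 1) (p := 0) hi (by omega) (by omega)]
  · rintro rfl
    exact ⟨by omega, fun p h1 => by omega⟩

end OuterCases

theorem sum_ind_eq {m a : ℕ} (ha : a < m) : ∑ i ∈ Finset.range m, ind (i = a) = 1 := by
  rw [Finset.sum_eq_single a]
  · exact ind_of_true rfl
  · intro b _ hb; exact ind_of_false hb
  · intro h; exact absurd (Finset.mem_range.2 ha) h

/-- Each level contributes one new index, the last odd one; the even indices reproduce the count for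
the lower part. -/
theorem Perfect.sum_rightOf {z : ℕ} {f : ℕ → ℝ × ℝ} (h : Perfect z f) :
    ∑ j ∈ Finset.range (2 ^ z), ind (RightOf f (2 ^ z) j) = z := by
  induction z generalizing f with
  | zero => simpa using ind_of_false fun h : RightOf f 1 0 => lt_irrefl _ h.1
  | succ z ih =>
    have hI := h.interlaced
    obtain ⟨-, h0, h1, -⟩ := h
    have hm : 1 ≤ 2 ^ z := Nat.one_le_two_pow
    rw [show (2 : ℕ) ^ (z + 1) = 2 * 2 ^ z by ring, sum_range_two_mul,
      Finset.sum_congr rfl fun j hj => ind_congr (rightOf_even hI (Finset.mem_range.1 hj)), ih h0,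
      Finset.sum_congr rfl fun j hj => ind_congr (rightOf_odd hI (Finset.mem_range.1 hj)),
      sum_ind_eq (by omega)]
    push_cast; ring

theorem Perfect.sum_leftOf {z : ℕ} {f : ℕ → ℝ × ℝ} (h : Perfect z f) :
    ∑ j ∈ Finset.range (2 ^ z), ind (LeftOf f (2 ^ z) j) = z := by
  induction z generalizing f with
  | zero => simpa using ind_of_false fun h : LeftOf f 1 0 => absurd h.1 (by simp)
  | succ z ih =>
    have hI := h.interlaced
    obtain ⟨-, h0, h1, -⟩ := h
    have hm : 1 ≤ 2 ^ z := Nat.one_le_two_pow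
    rw [show (2 : ℕ) ^ (z + 1) = 2 * 2 ^ z by ring, sum_range_two_mul,
      Finset.sum_congr rfl fun j hj => ind_congr (leftOf_even hI (Finset.mem_range.1 hj)),
      Finset.sum_congr rfl fun j hj => ind_congr (leftOf_odd hI (Finset.mem_range.1 hj)), ih h1,
      sum_ind_eq (by omega)]
    push_cast; ring

/-- The number of pairs satisfying `Outer σ`. -/
noncomputable def outerCount (σ : ℝ) (f : ℕ → ℝ × ℝ) (n : ℕ) : ℤ :=
  pairSum (fun i j => ind (Outer σ f n i j)) n

theorem sum_le_add_sum_lt (m : ℕ) :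
    (∑ i ∈ Finset.range m, ∑ j ∈ Finset.range m, if i ≤ j then (1 : ℤ) else 0) +
      (∑ i ∈ Finset.range m, ∑ j ∈ Finset.range m, if i < j then (1 : ℤ) else 0) = (m : ℤ) ^ 2 := by
  rw [Finset.sum_comm (γ := ℕ) (f := fun i j => if i < j then (1 : ℤ) else 0)]
  simp only [← Finset.sum_add_distrib]
  have : ∀ i j : ℕ, ((if i ≤ j then (1 : ℤ) else 0) + if j < i then (1 : ℤ) else 0) = 1 := by
    intro i j
    split_ifs <;> first | rfl | omega
  simp only [this, Finset.sum_const, Finset.card_range, nsmul_eq_mul, mul_one]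
  ring

theorem outerCount_one_two_mul {f : ℕ → ℝ × ℝ} {m : ℕ} (h : Interlaced f m) :
    outerCount 1 f (2 * m) =
      ∑ i ∈ Finset.range m, ∑ j ∈ Finset.range m, if i ≤ j then (1 : ℤ) else 0 := by
  unfold outerCount
  rw [pairSum_two_mul]
  have e1 : pairSum (fun i j => ind (Outer 1 f (2 * m) (2 * i) (2 * j))) m = 0 := by
    rw [pairSum_congr (G := fun _ _ => 0 * 0) fun i j hij hj => by
      rw [ind_of_false (outer_one_even_even h hij hj)]; ring, pairSum_mul, zero_mul]
  have e2 : pairSum (fun i j => ind (Outer 1 f (2 * m) (2 * i + 1) (2 * j + 1))) m = 0 := by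
    rw [pairSum_congr (G := fun _ _ => 0 * 0) fun i j hij hj => by
      rw [ind_of_false (outer_one_odd_odd h hij hj)]; ring, pairSum_mul, zero_mul]
  have e3 : (∑ i ∈ Finset.range m, ∑ j ∈ Finset.range m,
      if i < j then ind (Outer 1 f (2 * m) (2 * i + 1) (2 * j)) else 0) = 0 := by
    refine Finset.sum_eq_zero fun i _ => Finset.sum_eq_zero fun j hj => ?_
    split_ifs with hij
    · exact ind_of_false (outer_one_odd_even h hij (Finset.mem_range.1 hj))
    · rfl
  rw [e1, e2, e3]
  simp only [zero_add, add_zero]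
  refine Finset.sum_congr rfl fun i _ => Finset.sum_congr rfl fun j hj => ?_
  split_ifs with hij
  · exact ind_of_true (outer_one_even_odd h hij (Finset.mem_range.1 hj))
  · rfl

theorem outerCount_neg_two_mul {f : ℕ → ℝ × ℝ} {m : ℕ} (hm : 1 ≤ m) (h : Interlaced f m) :
    outerCount (-1) f (2 * m) =
      ∑ j ∈ Finset.range m, ind (RightOf (fun i => f (2 * i)) m j) +
      ∑ i ∈ Finset.range m, ind (LeftOf (fun i => f (2 * i + 1)) m i) + 1 +
      ∑ i ∈ Finset.range m, ∑ j ∈ Finset.range m, if i < j then (1 : ℤ) else 0 := by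
  unfold outerCount
  rw [pairSum_two_mul]
  have e1 : pairSum (fun i j => ind (Outer (-1) f (2 * m) (2 * i) (2 * j))) m =
      ∑ j ∈ Finset.range m, ind (RightOf (fun i => f (2 * i)) m j) := by
    unfold pairSum
    rw [Finset.sum_eq_single 0]
    · refine Finset.sum_congr rfl fun j hj => ?_
      split_ifs with h0
      · refine ind_congr ?_
        rw [outer_neg_even_even h h0 (Finset.mem_range.1 hj)]
        simp
      · exact (ind_of_false fun h' => h0 h'.1).symm
    · intro i _ hi
      refine Finset.sum_eq_zero fun j hj => ?_
      split_ifs with h0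
      · refine ind_of_false ?_
        rw [outer_neg_even_even h h0 (Finset.mem_range.1 hj)]
        exact fun h' => hi h'.1
      · rfl
    · intro h'; exact absurd (Finset.mem_range.2 hm) h'
  have e2 : pairSum (fun i j => ind (Outer (-1) f (2 * m) (2 * i + 1) (2 * j + 1))) m =
      ∑ i ∈ Finset.range m, ind (LeftOf (fun i => f (2 * i + 1)) m i) := by
    unfold pairSum
    refine Finset.sum_congr rfl fun i hi => ?_
    rw [Finset.sum_eq_single (m - 1)]
    · split_ifs with h0
      · refine ind_congr ?_
        rw [outer_neg_odd_odd h h0 (by omega)]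
        simp
      · exact (ind_of_false fun h' => h0 h'.1).symm
    · intro j hj hne
      split_ifs with h0
      · refine ind_of_false ?_
        rw [outer_neg_odd_odd h h0 (Finset.mem_range.1 hj)]
        exact fun h' => hne h'.1
      · rfl
    · intro h'; exact absurd (Finset.mem_range.2 (by omega)) h'
  have e3 : (∑ i ∈ Finset.range m, ∑ j ∈ Finset.range m,
      if i ≤ j then ind (Outer (-1) f (2 * m) (2 * i) (2 * j + 1)) else 0) = 1 := by
    rw [Finset.sum_eq_single 0, Finset.sum_eq_single (m - 1)]
    · rw [if_pos (by omega)]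
      exact ind_of_true ((outer_neg_even_odd h (by omega) (by omega)).2 ⟨rfl, rfl⟩)
    · intro j hj hne
      rw [if_pos (by omega)]
      refine ind_of_false ?_
      rw [outer_neg_even_odd h (by omega) (Finset.mem_range.1 hj)]
      exact fun h' => hne h'.2
    · intro h'; exact absurd (Finset.mem_range.2 (by omega)) h'
    · intro i _ hi
      refine Finset.sum_eq_zero fun j hj => ?_
      split_ifs with h0
      · refine ind_of_false ?_
        rw [outer_neg_even_odd h h0 (Finset.mem_range.1 hj)]
        exact fun h' => hi h'.1
      · rfl
    · intro h'; exact absurd (Finset.mem_range.2 hm) h'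
  rw [e1, e2, e3]
  congr 1
  refine Finset.sum_congr rfl fun i _ => Finset.sum_congr rfl fun j hj => ?_
  split_ifs with hij
  · exact ind_of_true (outer_neg_odd_even h hij (Finset.mem_range.1 hj))
  · rfl

/-- All mixed pairs count for exactly one of the two signs, which gives the square. The rest is `z`
from each of `RightOf` and `LeftOf`, and 1 for the pair of the first and last point, which counts
for both signs. -/
theorem Perfect.outerCount_add {z : ℕ} {f : ℕ → ℝ × ℝ} (h : Perfect (z + 1) f) :
    outerCount 1 f (2 ^ (z + 1)) + outerCount (-1) f (2 ^ (z + 1)) =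
      (2 ^ z) ^ 2 + 2 * z + 1 := by
  have hI := h.interlaced
  obtain ⟨-, h0, h1, -⟩ := h
  have e := sum_le_add_sum_lt (2 ^ z)
  rw [show (2 : ℕ) ^ (z + 1) = 2 * 2 ^ z by ring, outerCount_one_two_mul hI,
    outerCount_neg_two_mul Nat.one_le_two_pow hI, h0.sum_rightOf, h1.sum_leftOf]
  push_cast at e
  linarith

/-! ### Counting empty triangles -/

/-- The number of the four projective triangles spanned by `a`, `b`, `c` that are empty. -/
noncomputable def triCount (X : Finset (ℝ × ℝ)) (a b c : ℝ × ℝ) : ℤ :=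
  ind (EmptyTri X a b c 1 1 1) + ind (EmptyTri X a b c 1 1 (-1)) +
    ind (EmptyTri X a b c 1 (-1) 1) + ind (EmptyTri X a b c 1 (-1) (-1))

/-- The indicator of the emptiness of the projective triangle with the middle point negated. -/
noncomputable def midCount (X : Finset (ℝ × ℝ)) (a b c : ℝ × ℝ) : ℤ :=
  ind (EmptyTri X a b c 1 (-1) 1)

theorem emptyTri_rotate_iff {X : Finset (ℝ × ℝ)} {a b c : ℝ × ℝ} {x y z : ℝ} :
    EmptyTri X b c a y z x ↔ EmptyTri X a b c x y z :=
  ⟨fun h => h.rotate.rotate, fun h => h.rotate⟩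

theorem emptyTri_swap_right_iff {X : Finset (ℝ × ℝ)} {a b c : ℝ × ℝ} {x y z : ℝ} :
    EmptyTri X a c b x z y ↔ EmptyTri X a b c x y z :=
  ⟨fun h => h.rotate.swap.rotate.rotate, fun h => h.rotate.swap.rotate.rotate⟩

theorem emptyTri_neg_iff {X : Finset (ℝ × ℝ)} {a b c : ℝ × ℝ} {x y z : ℝ} :
    EmptyTri X a b c (-x) (-y) (-z) ↔ EmptyTri X a b c x y z :=
  ⟨fun h => by have := h.neg; rwa [neg_neg, neg_neg, neg_neg] at this, fun h => h.neg⟩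

/-- The four classes of signings are rewritten with sign 1 at the third vertex, the form in which
the mixed criteria are stated. -/
theorem triCount_normalize (X : Finset (ℝ × ℝ)) (a b c : ℝ × ℝ) : triCount X a b c =
    ind (EmptyTri X a b c 1 1 1) + ind (EmptyTri X a b c (-1) (-1) 1) +
    ind (EmptyTri X a b c 1 (-1) 1) + ind (EmptyTri X a b c (-1) 1 1) := by
  have e1 : EmptyTri X a b c (-1) (-1) 1 ↔ EmptyTri X a b c 1 1 (-1) := by
    rw [← emptyTri_neg_iff, neg_neg]
  have e2 : EmptyTri X a b c (-1) 1 1 ↔ EmptyTri X a b c 1 (-1) (-1) := by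
    rw [← emptyTri_neg_iff, neg_neg]
  rw [ind_congr e1, ind_congr e2]; rfl

theorem triCount_swap_right (X : Finset (ℝ × ℝ)) (a b c : ℝ × ℝ) :
    triCount X a c b = triCount X a b c := by
  unfold triCount
  rw [ind_congr (emptyTri_swap_right_iff (a := a) (b := b) (c := c) (x := 1) (y := 1) (z := 1)),
    ind_congr (emptyTri_swap_right_iff (a := a) (b := b) (c := c) (x := 1) (y := -1) (z := 1)),
    ind_congr (emptyTri_swap_right_iff (a := a) (b := b) (c := c) (x := 1) (y := 1) (z := -1)),
    ind_congr (emptyTri_swap_right_iff (a := a) (b := b) (c := c) (x := 1) (y := -1) (z := -1))]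
  ring

theorem triCount_rotate (X : Finset (ℝ × ℝ)) (a b c : ℝ × ℝ) :
    triCount X c a b = triCount X a b c := by
  rw [triCount_normalize X a b c]
  unfold triCount
  rw [ind_congr (emptyTri_rotate_iff (a := c) (b := a) (c := b) (x := 1) (y := 1) (z := 1)).symm,
    ind_congr (emptyTri_rotate_iff (a := c) (b := a) (c := b) (x := 1) (y := 1) (z := -1)).symm,
    ind_congr (emptyTri_rotate_iff (a := c) (b := a) (c := b) (x := 1) (y := -1) (z := 1)).symm,
    ind_congr (emptyTri_rotate_iff (a := c) (b := a) (c := b) (x := 1) (y := -1) (z := -1)).symm]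
  ring

theorem midCount_swap_right (X : Finset (ℝ × ℝ)) (a b c : ℝ × ℝ) :
    midCount X a c b = ind (EmptyTri X a b c (-1) (-1) 1) := by
  refine ind_congr ?_
  rw [emptyTri_swap_right_iff, ← emptyTri_neg_iff, neg_neg]

theorem midCount_rotate (X : Finset (ℝ × ℝ)) (a b c : ℝ × ℝ) :
    midCount X c a b = ind (EmptyTri X a b c (-1) 1 1) :=
  ind_congr emptyTri_rotate_iff.symm

section Mixed

variable {σ : ℝ} {L U : Finset (ℝ × ℝ)} {a b c : ℝ × ℝ}

theorem triCount_inner (hσ : σ = 1 ∨ σ = -1) (hd : Deep σ L U) (hne : U.Nonempty) (ha : a ∈ L)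
    (hb : b ∈ L) (hc : c ∈ L) (hab : a.1 < b.1) (hbc : b.1 < c.1) :
    triCount (L ∪ U) a b c = triCount L a b c - midCount L a b c ∧
      midCount (L ∪ U) a b c = 0 := by
  have p : (1 : ℝ) = 1 ∨ (1 : ℝ) = -1 := Or.inl rfl
  have q : (-1 : ℝ) = 1 ∨ (-1 : ℝ) = -1 := Or.inr rfl
  have n : ¬(1 : ℝ) = -1 := by norm_num
  have n' : ¬(-1 : ℝ) = 1 := by norm_num
  have hmid : ind (EmptyTri (L ∪ U) a b c 1 (-1) 1) = 0 := by
    refine ind_of_false ?_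
    rw [emptyTri_inner hσ hd hne ha hb hc hab hbc p q p]
    simp
  refine ⟨?_, hmid⟩
  unfold triCount midCount
  rw [hmid, ind_congr (emptyTri_inner hσ hd hne ha hb hc hab hbc p p p),
    ind_congr (emptyTri_inner hσ hd hne ha hb hc hab hbc p p q),
    ind_congr (emptyTri_inner hσ hd hne ha hb hc hab hbc p q q)]
  simp only [n, n', and_false, not_false_eq_true, and_true]
  ring

end Mixed

/-- The number of empty signed triangles among the first `n` points of `f`. -/
noncomputable def triTotal (f : ℕ → ℝ × ℝ) (n : ℕ) : ℤ :=
  triSum (fun i j k => triCount (pts f n) (f i) (f j) (f k)) n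

/-- The number of empty triangles with negated middle point among the first `n` points. -/
noncomputable def midTotal (f : ℕ → ℝ × ℝ) (n : ℕ) : ℤ :=
  triSum (fun i j k => midCount (pts f n) (f i) (f j) (f k)) n

theorem card_triData (f : ℕ → ℝ × ℝ) (n : ℕ) : ((triData f n).card : ℤ) = triTotal f n := by
  classical
  unfold triData triTotal triSum
  rw [Finset.card_filter]
  push_cast
  simp only [Finset.sum_product]
  refine Finset.sum_congr rfl fun i _ => Finset.sum_congr rfl fun j _ =>
    Finset.sum_congr rfl fun k _ => ?_
  simp only [Fintype.sum_bool, sg_true, sg_false]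
  by_cases h : i < j ∧ j < k
  · rw [if_pos h]
    have hind : ∀ (P : Prop) [Decidable P], (if P then (1 : ℤ) else 0) = ind P := by
      intro P _
      by_cases hP : P
      · rw [if_pos hP, ind_of_true hP]
      · rw [if_neg hP, ind_of_false hP]
    simp only [h.1, h.2, true_and, triCount, pts, hind]
    ring
  · have : ∀ P : Prop, ¬(i < j ∧ j < k ∧ P) := fun P h' => h ⟨h'.1, h'.2.1⟩
    rw [if_neg h]
    simp [this]

/-! ### Doubling recursions for the triangle counts -/

section Recursion

variable {f : ℕ → ℝ × ℝ} {m : ℕ}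

/-- The value of the triangle count on two points of one part and one point of the other. -/
theorem mixed_values {σ : ℝ} (hσ : σ = 1 ∨ σ = -1) {g h : ℕ → ℝ × ℝ} (hg : Sorted g m)
    (hh : Sorted h m) (hd : Deep σ (pts g m) (pts h m)) {i j k : ℕ} (hij : i < j) (hj : j < m)
    (hk : k < m) :
    ind (EmptyTri (pts g m ∪ pts h m) (g i) (g j) (h k) 1 1 1) = ind (Inner σ g i j) ∧
    ind (EmptyTri (pts g m ∪ pts h m) (g i) (g j) (h k) (-1) (-1) 1) = ind (Inner (-σ) g i j) ∧
    ind (EmptyTri (pts g m ∪ pts h m) (g i) (g j) (h k) (-1) 1 1) =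
      ind (k = m - 1 ∧ Outer σ g m i j) ∧
    ind (EmptyTri (pts g m ∪ pts h m) (g i) (g j) (h k) 1 (-1) 1) =
      ind (k = 0 ∧ Outer (-σ) g m i j) := by
  have hi : i < m := hij.trans hj
  have mi := apply_mem_pts (f := g) hi
  have mj := apply_mem_pts (f := g) hj
  have mk := apply_mem_pts (f := h) hk
  have hlt := hg i j hij hj
  have iL := hg.injOn_pts
  have iU := hh.injOn_pts
  refine ⟨ind_congr ?_, ind_congr ?_, ind_congr ?_, ind_congr ?_⟩
  · rw [emptyTri_pos_pos hσ hd iL iU mi mj hlt mk, innerFree_pts hg hij hj]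
  · rw [emptyTri_neg_neg hσ hd iL iU mi mj hlt mk, innerFree_pts hg hij hj]
  · rw [emptyTri_neg_pos hσ hd iL iU mi mj hlt mk, outerFree_pts hg hij hj]
    refine and_congr_left fun _ => ⟨fun h' => ?_, ?_⟩
    · have := (hh.le_iff (by omega) hk).1 (h' _ (apply_mem_pts (show m - 1 < m by omega)))
      omega
    · rintro rfl p hp
      obtain ⟨q, hq, rfl⟩ := mem_pts.1 hp
      exact (hh.le_iff hq hk).2 (by omega)
  · rw [emptyTri_pos_neg hσ hd iL iU mi mj hlt mk, outerFree_pts hg hij hj]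
    refine and_congr_left fun _ => ⟨fun h' => ?_, ?_⟩
    · have := (hh.le_iff hk (by omega)).1 (h' _ (apply_mem_pts (show 0 < m by omega)))
      omega
    · rintro rfl p hp
      obtain ⟨q, hq, rfl⟩ := mem_pts.1 hp
      exact (hh.le_iff hk hq).2 (by omega)

theorem sum_ind_eq_and {a : ℕ} (ha : a < m) (P : Prop) :
    ∑ k ∈ Finset.range m, ind (k = a ∧ P) = ind P := by
  by_cases hP : P
  · simp only [hP, and_true, sum_ind_eq ha, ind_of_true]
  · simp only [hP, and_false]
    rw [ind_of_false not_false]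
    simp

/-- The two inner conditions do not depend on the point of the other part, so each counts `m` times.
Each outer condition admits only one extreme point and counts once. -/
theorem sum_triCount_mixed {σ : ℝ} (hσ : σ = 1 ∨ σ = -1) {g h : ℕ → ℝ × ℝ} (hg : Sorted g m)
    (hh : Sorted h m) (hd : Deep σ (pts g m) (pts h m)) {i j : ℕ} (hij : i < j) (hj : j < m) :
    ∑ k ∈ Finset.range m, triCount (pts g m ∪ pts h m) (g i) (g j) (h k) =
      m * (ind (Inner σ g i j) + ind (Inner (-σ) g i j)) +
        (ind (Outer σ g m i j) + ind (Outer (-σ) g m i j)) := by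
  have : ∀ k ∈ Finset.range m, triCount (pts g m ∪ pts h m) (g i) (g j) (h k) =
      (ind (Inner σ g i j) + ind (Inner (-σ) g i j)) + (ind (k = m - 1 ∧ Outer σ g m i j) +
        ind (k = 0 ∧ Outer (-σ) g m i j)) := by
    intro k hk
    obtain ⟨e1, e2, e3, e4⟩ := mixed_values hσ hg hh hd hij hj (Finset.mem_range.1 hk)
    rw [triCount_normalize, e1, e2, e3, e4]
    ring
  rw [Finset.sum_congr rfl this]
  simp only [Finset.sum_add_distrib]
  rw [sum_ind_eq_and (by omega), sum_ind_eq_and (by omega)]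
  simp only [Finset.sum_const, Finset.card_range, nsmul_eq_mul]
  ring

theorem pairSum_mixed (σ : ℝ) (g : ℕ → ℝ × ℝ) : pairSum (fun i j =>
      m * (ind (Inner σ g i j) + ind (Inner (-σ) g i j)) +
        (ind (Outer σ g m i j) + ind (Outer (-σ) g m i j))) m =
      m * (innerCount 1 0 σ g m + innerCount 1 0 (-σ) g m) +
        (outerCount σ g m + outerCount (-σ) g m) := by
  rw [pairSum_add, pairSum_mul, pairSum_add, pairSum_add]
  simp [innerCount, outerCount]

theorem pts_two_mul (f : ℕ → ℝ × ℝ) (m : ℕ) :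
    pts f (2 * m) = pts (fun i => f (2 * i)) m ∪ pts (fun i => f (2 * i + 1)) m := by
  ext p
  simp only [Finset.mem_union, mem_pts]
  constructor
  · rintro ⟨i, hi, rfl⟩
    rcases Nat.even_or_odd' i with ⟨k, rfl | rfl⟩
    · exact Or.inl ⟨k, by omega, rfl⟩
    · exact Or.inr ⟨k, by omega, rfl⟩
  · rintro (⟨i, hi, rfl⟩ | ⟨i, hi, rfl⟩)
    · exact ⟨2 * i, by omega, rfl⟩
    · exact ⟨2 * i + 1, by omega, rfl⟩

theorem sorted_even (hf : Sorted f (2 * m)) : Sorted (fun i => f (2 * i)) m :=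
  fun i j hij hj => hf _ _ (by omega) (by omega)

theorem sorted_odd (hf : Sorted f (2 * m)) : Sorted (fun i => f (2 * i + 1)) m :=
  fun i j hij hj => hf _ _ (by omega) (by omega)

theorem triTotal_two_mul (hm : 1 ≤ m) (hf : Sorted f (2 * m))
    (hd : Deep 1 (pts (fun i => f (2 * i)) m) (pts (fun i => f (2 * i + 1)) m)) :
    triTotal f (2 * m) =
      (triTotal (fun i => f (2 * i)) m - midTotal (fun i => f (2 * i)) m) +
      (triTotal (fun i => f (2 * i + 1)) m - midTotal (fun i => f (2 * i + 1)) m) +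
      (m * (innerCount 1 0 1 (fun i => f (2 * i)) m + innerCount 1 0 (-1) (fun i => f (2 * i)) m) +
        (outerCount 1 (fun i => f (2 * i)) m + outerCount (-1) (fun i => f (2 * i)) m)) +
      (m * (innerCount 1 0 1 (fun i => f (2 * i + 1)) m +
          innerCount 1 0 (-1) (fun i => f (2 * i + 1)) m) +
        (outerCount 1 (fun i => f (2 * i + 1)) m +
          outerCount (-1) (fun i => f (2 * i + 1)) m)) := by
  set g := fun i => f (2 * i) with hg
  set h := fun i => f (2 * i + 1) with hh
  have sg := sorted_even hf
  have sh := sorted_odd hf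
  have hneU : (pts h m).Nonempty := ⟨_, apply_mem_pts hm⟩
  have hneL : (pts g m).Nonempty := ⟨_, apply_mem_pts hm⟩
  unfold triTotal midTotal
  rw [triSum_two_mul, pts_two_mul, ← triSum_sub, ← triSum_sub]
  congr 1
  · congr 1
    · congr 1
      · refine triSum_congr fun i j k hij hjk hk => ?_
        exact (triCount_inner (Or.inl rfl) hd hneU (apply_mem_pts (by omega))
          (apply_mem_pts (by omega)) (apply_mem_pts hk) (sg _ _ hij (by omega))
          (sg _ _ hjk hk)).1
      · refine triSum_congr fun i j k hij hjk hk => ?_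
        rw [Finset.union_comm]
        exact (triCount_inner (Or.inr rfl) hd.swap hneL (apply_mem_pts (by omega))
          (apply_mem_pts (by omega)) (apply_mem_pts hk) (sh _ _ hij (by omega))
          (sh _ _ hjk hk)).1
    · rw [← pairSum_mixed]
      refine pairSum_congr fun i j hij hj => ?_
      rw [← sum_triCount_mixed (Or.inl rfl) sg sh hd hij hj]
      refine Finset.sum_congr rfl fun k _ => ?_
      split_ifs
      · rfl
      · exact triCount_swap_right _ _ _ _
      · exact triCount_rotate _ _ _ _
  · have hp := pairSum_mixed (m := m) (-1) h
    rw [neg_neg, add_comm (innerCount 1 0 (-1) h m), add_comm (outerCount (-1) h m)] at hp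
    rw [← hp]
    refine pairSum_congr fun i j hij hj => ?_
    have hs := sum_triCount_mixed (Or.inr rfl) sh sg hd.swap hij hj
    rw [neg_neg] at hs
    rw [← hs, Finset.union_comm]
    refine Finset.sum_congr rfl fun k _ => ?_
    split_ifs
    · rfl
    · exact triCount_swap_right _ _ _ _
    · exact triCount_rotate _ _ _ _

theorem sum_Ico_const (c : ℤ) {i j : ℕ} (hij : i ≤ j) (hj : j ≤ m) :
    (∑ k ∈ Finset.range m, if i ≤ k ∧ k < j then c else 0) = (j - i) * c := by
  rw [← Finset.sum_filter]
  have : (Finset.range m).filter (fun k => i ≤ k ∧ k < j) = Finset.Ico i j := by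
    ext k
    simp only [Finset.mem_filter, Finset.mem_range, Finset.mem_Ico]
    omega
  rw [this, Finset.sum_const, Nat.card_Ico, nsmul_eq_mul, Nat.cast_sub hij]

/-- Triples within one part do not contribute. In a mixed triple the negated middle point must be
the point of the other part, since otherwise the required extreme index contradicts its position. A
pair then counts once for each admissible index between, which gives the weight `j - i`. -/
theorem midTotal_two_mul (hm : 1 ≤ m) (hf : Sorted f (2 * m))
    (hd : Deep 1 (pts (fun i => f (2 * i)) m) (pts (fun i => f (2 * i + 1)) m)) :
    midTotal f (2 * m) = innerCount 0 1 (-1) (fun i => f (2 * i)) m +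
      innerCount 0 1 1 (fun i => f (2 * i + 1)) m := by
  set g := fun i => f (2 * i) with hg
  set h := fun i => f (2 * i + 1) with hh
  have sg := sorted_even hf
  have sh := sorted_odd hf
  have hneU : (pts h m).Nonempty := ⟨_, apply_mem_pts hm⟩
  have hneL : (pts g m).Nonempty := ⟨_, apply_mem_pts hm⟩
  unfold midTotal
  rw [triSum_two_mul, pts_two_mul]
  have e1 : triSum (fun i j k => midCount (pts g m ∪ pts h m) (g i) (g j) (g k)) m = 0 := by
    rw [← triSum_zero m]
    refine triSum_congr fun i j k hij hjk hk => ?_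
    exact (triCount_inner (Or.inl rfl) hd hneU (apply_mem_pts (by omega))
      (apply_mem_pts (by omega)) (apply_mem_pts hk) (sg _ _ hij (by omega)) (sg _ _ hjk hk)).2
  have e2 : triSum (fun i j k => midCount (pts g m ∪ pts h m) (h i) (h j) (h k)) m = 0 := by
    rw [← triSum_zero m]
    refine triSum_congr fun i j k hij hjk hk => ?_
    rw [Finset.union_comm]
    exact (triCount_inner (Or.inr rfl) hd.swap hneL (apply_mem_pts (by omega))
      (apply_mem_pts (by omega)) (apply_mem_pts hk) (sh _ _ hij (by omega)) (sh _ _ hjk hk)).2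
  rw [show triSum (fun i j k => midCount (pts (fun i => f (2 * i)) m ∪
      pts (fun i => f (2 * i + 1)) m) (f (2 * i)) (f (2 * j)) (f (2 * k))) m = 0 from e1,
    show triSum (fun i j k => midCount (pts (fun i => f (2 * i)) m ∪
      pts (fun i => f (2 * i + 1)) m) (f (2 * i + 1)) (f (2 * j + 1)) (f (2 * k + 1))) m = 0
      from e2, zero_add, zero_add]
  unfold innerCount
  congr 1
  · refine pairSum_congr fun i j hij hj => ?_
    rw [zero_add, one_mul, ← sum_Ico_const (m := m) _ hij.le hj.le]
    refine Finset.sum_congr rfl fun k hk => ?_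
    obtain ⟨v1, v2, v3, v4⟩ := mixed_values (Or.inl rfl) sg sh hd hij hj (Finset.mem_range.1 hk)
    split_ifs with c1 c2 c3 c4 c5
    · omega
    · exact v4.trans (ind_of_false fun h' => by omega)
    · exact (midCount_swap_right _ _ _ _).trans v2
    · omega
    · omega
    · exact (midCount_rotate _ _ _ _).trans (v3.trans (ind_of_false fun h' => by omega))
  · refine pairSum_congr fun i j hij hj => ?_
    -- Even positions between `2 * i + 1` and `2 * j + 1` are those with `i < k ≤ j`, hence the
    -- shifted interval; its length is again `j - i`.
    have hsum := sum_Ico_const (m := m) (ind (Inner 1 h i j)) (i := i + 1) (j := j + 1)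
      (by omega) (by omega)
    rw [zero_add, one_mul, show ((j : ℤ) - i) = ((j + 1 : ℕ) : ℤ) - ((i + 1 : ℕ) : ℤ) by
      push_cast; ring, ← hsum, Finset.union_comm]
    refine Finset.sum_congr rfl fun k hk => ?_
    obtain ⟨v1, v2, v3, v4⟩ :=
      mixed_values (Or.inr rfl) sh sg hd.swap hij hj (Finset.mem_range.1 hk)
    rw [neg_neg] at v2
    split_ifs with c1 c2 c3 c4 c5
    · omega
    · exact v4.trans (ind_of_false fun h' => by omega)
    · exact (midCount_swap_right _ _ _ _).trans v2
    · omega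
    · omega
    · exact (midCount_rotate _ _ _ _).trans (v3.trans (ind_of_false fun h' => by omega))

end Recursion

theorem triSum_two (F : ℕ → ℕ → ℕ → ℤ) : triSum F 2 = 0 := by
  simp [triSum, Finset.sum_range_succ]

/-- The exact counts for perfect Horton sets. -/
theorem Perfect.totals {z : ℕ} {f : ℕ → ℝ × ℝ} (h : Perfect (z + 1) f) :
    4 * triTotal f (2 ^ (z + 1)) = 17 * (2 ^ (z + 1)) ^ 2 +
        2 ^ (z + 1) * (-6 * (z + 1) ^ 2 - 2 * (z + 1) - 22) - 16 * (z + 1) + 8 ∧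
      midTotal f (2 ^ (z + 1)) = (z - 1) * 2 ^ (z + 1) + 2 := by
  induction z generalizing f with
  | zero => simp [triTotal, midTotal, triSum_two]
  | succ z ih =>
    obtain ⟨hs, h0, h1, hd⟩ := h
    obtain ⟨t0, m0⟩ := ih h0
    obtain ⟨t1, m1⟩ := ih h1
    have hm : 1 ≤ 2 ^ (z + 1) := Nat.one_le_two_pow
    rw [show (2 : ℕ) ^ (z + 1 + 1) = 2 * 2 ^ (z + 1) by ring, triTotal_two_mul hm hs hd,
      midTotal_two_mul hm hs hd, h0.innerCount_eq (Or.inl rfl), h0.innerCount_eq (Or.inr rfl),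
      h1.innerCount_eq (Or.inl rfl), h1.innerCount_eq (Or.inr rfl), h0.outerCount_add,
      h1.outerCount_add, m0, m1, h0.innerCount_eq (Or.inr rfl), h1.innerCount_eq (Or.inl rfl)]
    constructor
    · have e : ∀ a b c d e' : ℤ, 4 * ((a - b) + (c - d) + e') =
          4 * a + 4 * c - 4 * b - 4 * d + 4 * e' := by intros; ring
      rw [add_assoc (_ + _ : ℤ), e, t0, t1]
      push_cast
      ring
    · push_cast
      ring

/-! ### From perfect Horton sets to enumerations -/

theorem IsLayer.of_oddPart {X Y : Finset (ℝ × ℝ)} (hX : 2 ≤ X.card) (h : IsLayer (oddPart X) Y) :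
    IsLayer X Y := by
  induction h with
  | self => exact IsLayer.odd X IsLayer.self hX
  | odd Z _ hZ ih => exact IsLayer.odd Z ih hZ
  | even Z _ hZ ih => exact IsLayer.even Z ih hZ

theorem IsLayer.of_evenPart {X Y : Finset (ℝ × ℝ)} (hX : 2 ≤ X.card)
    (h : IsLayer (evenPart X) Y) : IsLayer X Y := by
  induction h with
  | self => exact IsLayer.even X IsLayer.self hX
  | odd Z _ hZ ih => exact IsLayer.odd Z ih hZ
  | even Z _ hZ ih => exact IsLayer.even Z ih hZ

/-- Index 0 is the leftmost point, so requiring it in the lower part makes the even indices the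
lower part at every level. -/
theorem perfect_of_layers {z : ℕ} {f : ℕ → ℝ × ℝ} (hf : Sorted f (2 ^ z))
    (h : ∀ X, IsLayer (pts f (2 ^ z)) X → 2 ≤ X.card →
      ∃ L U, IsLowerUpper X L U ∧ ∃ p ∈ L, ∀ q ∈ X, p.1 ≤ q.1) : Perfect z f := by
  induction z generalizing f with
  | zero => trivial
  | succ z ih =>
    have e : (2 : ℕ) ^ (z + 1) = 2 * 2 ^ z := by ring
    rw [e] at hf h
    have hm : 1 ≤ 2 ^ z := Nat.one_le_two_pow
    have hcard : 2 ≤ (pts f (2 * 2 ^ z)).card := by rw [hf.card_pts]; omega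
    have e₀ : oddPart (pts f (2 * 2 ^ z)) = pts (fun i => f (2 * i)) (2 ^ z) := by
      rw [oddPart_pts hf]; congr 1; omega
    have e₁ : evenPart (pts f (2 * 2 ^ z)) = pts (fun i => f (2 * i + 1)) (2 ^ z) := by
      rw [evenPart_pts hf]; congr 1; omega
    refine ⟨hf, ih (sorted_even hf) fun X hX => h X (IsLayer.of_oddPart hcard (e₀ ▸ hX)),
      ih (sorted_odd hf) fun X hX => h X (IsLayer.of_evenPart hcard (e₁ ▸ hX)), ?_⟩
    obtain ⟨L, U, ⟨⟨rfl, rfl⟩ | ⟨rfl, rfl⟩, hd⟩, p, hp, hle⟩ := h _ IsLayer.self hcard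
    · rw [e₀, e₁] at hd
      exact hd.deep
    · rw [e₁] at hp
      obtain ⟨i, hi, rfl⟩ := mem_pts.1 hp
      have := (hf.le_iff (by omega) (by omega)).1 (hle (f 0) (apply_mem_pts (by omega)))
      omega

theorem IsPerfectHorton.ncard_eq {z : ℕ} (hz : 1 ≤ z) {H : Finset (ℝ × ℝ)}
    (hH : IsPerfectHorton H) (hcard : H.card = 2 ^ z) :
    (planarProjHoles 3 H).Finite ∧ ((planarProjHoles 3 H).ncard : ℝ) =
      4.25 * (2 : ℝ) ^ (2 * z)
        + (2 : ℝ) ^ z * (-3 * (z : ℝ) ^ 2 / 2 - (z : ℝ) / 2 - 5.5) - 4 * (z : ℝ) + 2 := by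
  obtain ⟨f, hf, hHf⟩ := exists_sorted H hH.1.injOn
  rw [hcard] at hf hHf
  subst hHf
  obtain ⟨w, rfl⟩ : ∃ w, z = w + 1 := ⟨z - 1, by omega⟩
  have hP := perfect_of_layers hf hH.2
  obtain ⟨hfin, hn⟩ := ncard_planarProjHoles_three hf hH.1.genPos
  refine ⟨hfin, ?_⟩
  have ht := hP.totals.1
  rw [← card_triData, ← hn] at ht
  have ht' : (4 : ℝ) * ((planarProjHoles 3 (pts f (2 ^ (w + 1)))).ncard : ℝ) =
      17 * (2 ^ (w + 1)) ^ 2 +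
        2 ^ (w + 1) * (-6 * (w + 1) ^ 2 - 2 * (w + 1) - 22) - 16 * (w + 1) + 8 := by
    exact_mod_cast ht
  rw [pow_mul', Nat.cast_add, Nat.cast_one]
  linarith

end ProjHoles

/-! ### The main theorem -/

open ProjHoles in
theorem mainTheorem3 :
    (∀ k : ℕ, 3 ≤ k → k ≤ 7 →
      ∃ c C : ℝ, ∃ N : ℕ, 0 < c ∧ 0 < C ∧
        ∀ H : Finset (ℝ × ℝ), IsHorton H →
          (planarProjHoles k H).Finite ∧
          ((planarProjHoles k H).ncard : ℝ) ≤ C * (H.card : ℝ) ^ 2 ∧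
          (N ≤ H.card → c * (H.card : ℝ) ^ 2 ≤ ((planarProjHoles k H).ncard : ℝ))) ∧
    (∀ z : ℕ, 1 ≤ z → ∀ H : Finset (ℝ × ℝ), IsPerfectHorton H → H.card = 2 ^ z →
      (planarProjHoles 3 H).Finite ∧
      ((planarProjHoles 3 H).ncard : ℝ) =
        4.25 * (2 : ℝ) ^ (2 * z)
          + (2 : ℝ) ^ z * (-3 * (z : ℝ) ^ 2 / 2 - (z : ℝ) / 2 - 5.5) - 4 * (z : ℝ) + 2) ∧
    (∃ c C : ℝ, 0 < c ∧ 0 < C ∧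
      ∀ z : ℕ, 1 ≤ z → ∀ H : Finset (ℝ × ℝ), IsPerfectHorton H → ∀ n : ℕ, H.card = n →
        n = 2 ^ z → ∃ e : ℝ,
          c * (n * Real.logb 2 n) ≤ e ∧ e ≤ C * (n * Real.logb 2 n) ∧
          ((planarProjHoles 3 H).ncard : ℝ) =
            4.25 * (n : ℝ) ^ 2 - 1.5 * n * Real.logb 2 n ^ 2 - e) := by
  refine ⟨fun k hk hk7 => ⟨1 / 4096, 499392, 256, by norm_num, by norm_num, fun H hH => ?_⟩,
    fun z hz H hH hcard => hH.ncard_eq hz hcard, 1 / 2, 10, by norm_num, by norm_num, ?_⟩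
  · obtain ⟨h1, h2⟩ := hH.ncard_planarProjHoles_le hk
    exact ⟨h1, h2, hH.le_ncard_planarProjHoles hk hk7⟩
  · intro z hz H hH n hn hnz
    have hcard := hH.ncard_eq hz (hn.trans hnz)
    have hlog : Real.logb 2 n = z := by
      rw [hnz]; push_cast
      rw [Real.logb_pow, Real.logb_self_eq_one (by norm_num), mul_one]
    have hn' : (n : ℝ) = 2 ^ z := by rw [hnz]; push_cast; rfl
    have hz' : (1 : ℝ) ≤ z := by exact_mod_cast hz
    have h2 : (2 : ℝ) ≤ n := by
      rw [hn']
      calc (2 : ℝ) = 2 ^ 1 := by norm_num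
        _ ≤ 2 ^ z := pow_le_pow_right₀ (by norm_num) hz
    -- The remainder read off from the exact formula. It is at least `n * z / 2`, and for `z ≥ 1` at
    -- most `(0.5 + 5.5 + 4) * n * z`, whence the constants `1 / 2` and 10.
    refine ⟨n * z / 2 + 5.5 * n + 4 * z - 2, ?_, ?_, ?_⟩
    · rw [hlog]; nlinarith
    · rw [hlog]; nlinarith
    · rw [hcard.2, hlog, pow_mul', hn']; ring
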